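/- **Setting.** Work in $\mathbb{R}^d$, $d\ge 1$. Let $\mathscr{B}^r$ be the set of $\varphi\in C_c^\infty$ supported in the closed unit ball with $\|\partial^k\varphi\|_\infty\le 1$ for $|k|\le r$, and $\varphi_x^\lambda=\lambda^{-d}\varphi(\lambda^{-1}(\cdot-x))$. For a germ (a family $F=(F_x)_{x\in\mathbb{R}^d}$ of distributions with $x\mapsto F_x(\varphi)$ measurable) put $$\|F\|_{\mathrm{hom};S,\Lambda,r}^{a}=\sup_{x\in S,\,0<\lambda\le\Lambda,\,\varphi\in\mathscr{B}^r}\frac{|F_x(\varphi_x^\lambda)|}{\lambda^a},\qquad \|F\|^{a,\gamma}_{\mathrm{coh};S,\Lambda,r}=\sup_{x,y\in S,\,0<\lambda\le\Lambda,\,\varphi\in\mathscr{B}^r}\frac{|(F_y-F_x)(\varphi_x^\lambda)|}{\lambda^a(|y-x|+\lambda)^{\gamma-a}} .$$ The germ $F$ is $a$-homogeneous if for some $r$ the first seminorm is finite for all compact $S$ and all $\Lambda\ge1$. *Models.* Fix a finite nonempty set $I$, reals $\boldsymbol\alpha=(\alpha_i)_{i\in I}$ and $r\in\mathbb{N}_0$.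 A model $(\Pi,\Gamma)$ with homogeneities $\boldsymbol\alpha$ and order $r$ consists of germs $\Pi^i$ with $\|\Pi^i\|^{\alpha_i}_{\mathrm{hom};S,\Lambda,r}<\infty$ for all compact $S$ and $\Lambda\ge1$, and reals $\Gamma^{ji}_{xy}$ with $\Pi^i_y=\sum_j\Pi^j_x\Gamma^{ji}_{xy}$. Set $\|\Pi\|_{\mathcal{M}^{\boldsymbol\alpha}_{S,\Lambda}}=\sup_i\|\Pi^i\|^{\alpha_i}_{\mathrm{hom};S,\Lambda,r}$ (also for differences of models). *Modelled distributions.* Let $\gamma>\max\boldsymbol\alpha$. For $f_1,f_2:\mathbb{R}^d\to\mathbb{R}^I$, relative to $\Gamma_1,\Gamma_2$, put $$|||f_1;f_2|||_{\mathcal{D}^\gamma_S}=\sup_{x\in S,\,i}|f_1^i(x)-f_2^i(x)|+\sup_{x,y\in S,\,i}\frac{\big|\sum_j\{(\Gamma_1)^{ij}_{xy}f_1^j(y)-(\Gamma_2)^{ij}_{xy}f_2^j(y)\}-(f_1^i(x)-f_2^i(x))\big|}{|x-y|^{\gamma-\alpha_i}}$$ (with $0/0=0$), and $|||f|||_{\mathcal{D}^\gamma_S}=|||f;0|||_{\mathcal{D}^\gamma_S}$.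 A measurable $f$ is a modelled distribution of order $\gamma$ if $|||f|||_{\mathcal{D}^\gamma_S}<\infty$ for every compact $S$. Put $\langle f,\Pi\rangle_x=\sum_i f^i(x)\Pi^i_x$ and $\bar\alpha=\min\boldsymbol\alpha$. A $\gamma$-reconstruction of the germ $F=\langle f,\Pi\rangle$ is a distribution $R$ such that $\|F-R\|^\gamma_{\mathrm{hom};S,1,s}<\infty$ for all compact $S$ and all integers $s\ge0$ with $s>-\bar\alpha$; it is unique if $\gamma>0$. *Kernel.* Let $\beta>0$ with $\gamma+\beta\notin\mathbb{N}_0$, and let $\mathsf K=\sum_{n\ge0}\mathsf K_n$ a.e. be a $\beta$-regularising kernel of order $(m,r')$ with range $\rho>0$, where $m>\gamma+\beta$ and $r'\ge r$: each $\mathsf K_n$ is of class $C^{m,r'}$, $\operatorname{supp}\mathsf K_n\subset\{|x-y|\le\rho2^{-n}\}$, and for every compact $S$ there is $c_S>0$ such that $|\partial_1^k\partial_2^l\mathsf K_n(x,y)|\le c_S2^{(d-\beta+|l|+|k|)n}$ for $x,y\in S$, $|k|\le m$, $|l|\le r'$, and $|\int(y-x)^l\partial_2^k\mathsf K_n(x,y)\,dx|\le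 c_S2^{-\beta n}$ for $y\in S$, $|k|,|l|\le r'$. For a distribution $T$ of order $r'$, $\mathsf KT(\psi)=\sum_nT(\int\psi(x)\mathsf K_n(x,\cdot)\,dx)$. The pointwise derivative of order $|k|<\delta$ of a distribution $g$ that is weakly homogeneous of degree $\delta$ at $x$ is $D^kg(x)=\lim_{\lambda\downarrow0}(D^kg)(\eta^\lambda_x)$, for any $\eta\in C_c^\infty$ with $\int\eta=1$ and $\int\eta(z)z^l\,dz=0$ for $1\le|l|<\delta$; it is used with $\delta=\alpha_i+\beta$ for $g=\mathsf K\Pi^i_x$ and with $\delta=\gamma+\beta$ for $g=\mathsf K\{\langle f,\Pi\rangle_x-R\}$. The model and $\mathsf K$ are compatible if $(D^k(\mathsf K\Pi^i_x))_x$ is a $0$-homogeneous germ whenever $|k|=\alpha_i+\beta$; put $[\mathsf K\Pi]_{S}=\sum_i\sum_{|k|=\alpha_i+\beta}\|(D^k(\mathsf K\Pi^i_x))_x\|^0_{\mathrm{hom};S,1,r}$. *Lift.* Let $\hat I=I\sqcup\{k\in\mathbb{N}_0^d:|k|<\gamma+\beta\}$, $\hat\alpha_i=\alpha_i+\beta$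 for $i\in I$ and $\hat\alpha_k=|k|$. With $(\Gamma^{\mathrm{poly}})^{lk}_{xy}=\frac{(x-y)^{k-l}}{(k-l)!}\mathbf 1_{l\le k}$, let $\hat\Gamma^{ji}_{xy}=\Gamma^{ji}_{xy}$, $\hat\Gamma^{jk}_{xy}=0$, $\hat\Gamma^{lk}_{xy}=(\Gamma^{\mathrm{poly}})^{lk}_{xy}$ and $$\hat\Gamma^{li}_{xy}=\sum_{j:\,\alpha_j+\beta>|l|}D^l(\mathsf K\Pi^j_x)(x)\,\Gamma^{ji}_{xy}-\sum_{|k|<\alpha_i+\beta}(\Gamma^{\mathrm{poly}})^{lk}_{xy}\,D^k(\mathsf K\Pi^i_y)(y).$$ Given a $\gamma$-reconstruction $R$ of $\langle f,\Pi\rangle$, let $\hat f^i=f^i$ for $i\in I$ and, for $|k|<\gamma+\beta$, $$\hat f^k(x)=\sum_{j:\,\alpha_j+\beta>|k|}f^j(x)\,D^k(\mathsf K\Pi^j_x)(x)-D^k(\mathsf K\{\langle f,\Pi\rangle_x-R\})(x).$$ **Proposition (enhanced continuity).** Let $S\subset\mathbb{R}^d$ be compact, $\Lambda=\max\{1,2\rho\}$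 and $S'=S\oplus B(0,\Lambda+1)$ (so $\Lambda=1$ and $S'=S\oplus B(0,2)$ if $\rho\le\frac12$). There is a constant $C<\infty$ such that, for all models $(\Pi_1,\Gamma_1),(\Pi_2,\Gamma_2)$ with homogeneities $\boldsymbol\alpha$ and order $r$, both compatible with $\mathsf K$ and with $[\mathsf K\Pi_1]_{S'}=[\mathsf K\Pi_2]_{S'}=0$, for all modelled distributions $f_1,f_2$ of order $\gamma$ relative to them, and for all $\gamma$-reconstructions $R_1,R_2$ of $F_1=\langle f_1,\Pi_1\rangle$, $F_2=\langle f_2,\Pi_2\rangle$, $$|||\hat f_1;\hat f_2|||_{\mathcal{D}^{\gamma+\beta}_S}\le C\Big(\big(1+\|\Pi_1\|_{\mathcal{M}^{\boldsymbol\alpha}_{S',\Lambda}}\big)\,|||f_1;f_2|||_{\mathcal{D}^\gamma_{S'}}+\|\Pi_1-\Pi_2\|_{\mathcal{M}^{\boldsymbol\alpha}_{S',\Lambda}}\,|||f_2|||_{\mathcal{D}^\gamma_{S'}}\Big),$$ where the left-hand side is taken with respect to $\hat\Gamma_1,\hat\Gamma_2,\boldsymbol{\hat\alpha}$. If $\gamma\le0$,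 where reconstructions are not unique, $R_1$ and $R_2$ are moreover required to be chosen consistently: with constants $c(L,\ell)<\infty$ fixed in advance, for all compact $L$ and $\ell\ge1$, $\|F_i-R_i\|^\gamma_{\mathrm{hom};L,1,r}<\infty$ ($i=1,2$) and $$\|(F_1-R_1)-(F_2-R_2)\|^\gamma_{\mathrm{hom};L,\ell,r}\le c(L,\ell)\,\|F_1-F_2\|^{\bar\alpha,\gamma}_{\mathrm{coh};L\oplus B(0,\ell+1),\ell,r}$$ (as holds for $R_i=\mathcal R F_i$ with $\mathcal R$ linear and continuous in this sense). The constant $C$ depends only on $d,I,\boldsymbol\alpha,r,\gamma,\beta$, the kernel (with its decomposition), $S$ and, if $\gamma\le0$, on $c$. -/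

import Mathlib

open MeasureTheory Set Filter TopologicalSpace
open scoped Topology ENNReal NNReal ContDiff Distributions LineDeriv Pointwise

noncomputable section

namespace MultilevelSchauder

/-- Euclidean space `ℝ^d`. -/
abbrev Space (d : ℕ) : Type := EuclideanSpace ℝ (Fin d)

/-- Smooth compactly supported test functions on `ℝ^d`. -/
abbrev Test (d : ℕ) : Type := TestFunction (⊤ : Opens (Space d)) ℝ ⊤

/-- Compactly supported functions of class `C^r` on `ℝ^d`. -/
abbrev TestOfOrder (d r : ℕ) : Type := TestFunction (⊤ : Opens (Space d)) ℝ (r : ℕ∞)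

/-- Distributions on `ℝ^d`: continuous linear functionals on the test functions. -/
abbrev Distr (d : ℕ) : Type := Distribution (⊤ : Opens (Space d)) ℝ ⊤

/-- Distributions of order (at most) `r`, as continuous functionals on compactly supported
`C^r` functions. -/
abbrev DistrOfOrder (d r : ℕ) : Type := Distribution (⊤ : Opens (Space d)) ℝ (r : ℕ∞)

variable {d : ℕ}

/-! ### Multi-indices and partial derivatives -/

/-- The length `|k| = k_1 + ... + k_d` of a multi-index. -/
def deg (k : Fin d → ℕ) : ℕ := ∑ i, k i

/-- The monomial `z^k`. -/
def monomial (k : Fin d → ℕ) (z : Space d) : ℝ := ∏ i, z i ^ k i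

/-- The factorial `k!` of a multi-index. -/
def mfactorial (k : Fin d → ℕ) : ℕ := ∏ i, (k i).factorial

/-- The finite set of multi-indices `k` with `|k| < t` (empty if `t ≤ 0`). -/
def poly (d : ℕ) (t : ℝ) : Finset (Fin d → ℕ) :=
  (Fintype.piFinset fun _ => Finset.range ⌈t⌉₊).filter fun k => (deg k : ℝ) < t

theorem mem_poly (t : ℝ) (k : Fin d → ℕ) : k ∈ poly d t ↔ (deg k : ℝ) < t := by
  simp only [poly, Finset.mem_filter, Fintype.mem_piFinset, Finset.mem_range,
    and_iff_right_iff_imp]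
  intro h i
  have h1 : k i ≤ deg k := Finset.single_le_sum (f := k) (fun _ _ => Nat.zero_le _)
    (Finset.mem_univ i)
  exact lt_of_le_of_lt h1 (Nat.lt_ceil.2 h)

/-- The `i`-th unit vector. -/
def unitVec (i : Fin d) : Space d := EuclideanSpace.single i (1 : ℝ)

/-- The partial derivative `∂^k g` of a function. -/
def mderiv (k : Fin d → ℕ) (g : Space d → ℝ) : Space d → ℝ :=
  (List.finRange d).foldr
    (fun i h => (fun (u : Space d → ℝ) (x : Space d) => lineDeriv ℝ u x (unitVec i))^[k i] h) g

/-- The partial derivative `∂^k φ` of a test function, as a test function. -/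
def testDeriv (k : Fin d → ℕ) (φ : Test d) : Test d :=
  (List.finRange d).foldr
    (fun i h => (fun u : Test d => LineDeriv.lineDerivOp (unitVec i) u)^[k i] h) φ

theorem coe_testDeriv (k : Fin d → ℕ) (φ : Test d) :
    (testDeriv k φ : Space d → ℝ) = mderiv k φ := by
  unfold testDeriv mderiv
  induction List.finRange d with
  | nil => rfl
  | cons i L ih =>
    simp only [List.foldr_cons]
    rw [← ih]
    generalize List.foldr _ φ L = u
    induction k i with
    | zero => rfl
    | succ n ihn =>
      rw [Function.iterate_succ_apply', Function.iterate_succ_apply', ← ihn]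
      funext x
      rw [TestFunction.lineDerivOp_eq_lineDerivCLM ℝ]
      rw [TestFunction.lineDerivCLM_apply_of_le (by simp)]

/-! ### Test functions -/

/-- The rescaled and recentred test function `φ_x^ε = ε^{-d} φ(ε^{-1}(· - x))`, for `ε > 0`. -/
def scale (φ : Test d) (x : Space d) (ε : ℝ) : Test d :=
  if hε : 0 < ε then
    { toFun := fun y => (ε⁻¹) ^ d * φ (ε⁻¹ • (y - x))
      contDiff' := by
        have h := φ.contDiff
        fun_prop
      hasCompactSupport' := by
        have h1 : HasCompactSupport fun y : Space d => φ (ε⁻¹ • (y - x)) := by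
          have h2 := φ.hasCompactSupport.comp_homeomorph
            ((Homeomorph.subRight x).trans (Homeomorph.smulOfNeZero ε⁻¹ (inv_pos.2 hε).ne'))
          exact h2
        exact h1.mul_left
      tsupport_subset' := fun _ _ => trivial }
  else 0

theorem scale_apply (φ : Test d) (x : Space d) {ε : ℝ} (hε : 0 < ε) (y : Space d) :
    scale φ x ε y = (ε⁻¹) ^ d * φ (ε⁻¹ • (y - x)) := by
  simp only [scale, hε, dif_pos]
  rfl

/-- The class `𝓑^r`: test functions supported in the closed unit ball with `‖φ‖_{C^r} ≤ 1`. -/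
def unitTest (d r : ℕ) : Set (Test d) :=
  {φ | tsupport φ ⊆ Metric.closedBall 0 1 ∧
    ∀ k : Fin d → ℕ, deg k ≤ r → ∀ z, |testDeriv k φ z| ≤ 1}

open Classical in
/-- A function of class `C^r` with compact support, viewed as a `C^r` test function. -/
def toTest (r : ℕ) (g : Space d → ℝ) : TestOfOrder d r :=
  if h : ContDiff ℝ r g ∧ HasCompactSupport g then
    { toFun := g
      contDiff' := h.1
      hasCompactSupport' := h.2
      tsupport_subset' := fun _ _ => trivial }
  else 0

/-! ### Distributions of finite order, germs and their seminorms -/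

/-- `T'` is the extension to compactly supported `C^r` functions of the distribution `T`. -/
def IsExtension (r : ℕ) (T : Distr d) (T' : DistrOfOrder d r) : Prop :=
  ∀ φ : Test d, T' (TestFunction.monoCLM ℝ φ : TestOfOrder d r) = T φ

open Classical in
/-- The canonical extension of a distribution of order `r` to compactly supported `C^r`
functions. -/
def extension (r : ℕ) (T : Distr d) : DistrOfOrder d r :=
  if h : ∃ T' : DistrOfOrder d r, IsExtension r T T' then h.choose else 0

/-- Derivative by duality, `D^k f (φ) = (-1)^{|k|} f(∂^k φ)`, for a functional on test functions. -/
def distDeriv (k : Fin d → ℕ) (f : Test d → ℝ) (φ : Test d) : ℝ :=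
  (-1) ^ deg k * f (testDeriv k φ)

/-- A family of functionals, indexed by base points and depending measurably on the base point. -/
def IsGerm (F : Space d → Test d → ℝ) : Prop := ∀ φ, Measurable fun x => F x φ

/-- The homogeneity seminorm
`sup { |F_x(φ_x^ε)| / ε^a : x ∈ S, 0 < ε ≤ Λ, φ ∈ 𝓑^r }`, with values in `[0, ∞]`. -/
def homSeminorm (F : Space d → Test d → ℝ) (S : Set (Space d)) (Λ : ℝ) (r : ℕ) (a : ℝ) : ℝ≥0∞ :=
  ⨆ x ∈ S, ⨆ ε ∈ Ioc (0 : ℝ) Λ, ⨆ φ ∈ unitTest d r,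
    ENNReal.ofReal (|F x (scale φ x ε)| / ε ^ a)

/-- The coherence seminorm
`sup { |(F_y - F_x)(φ_x^ε)| / (ε^a (|y-x| + ε)^{γ-a}) : x, y ∈ S, 0 < ε ≤ Λ, φ ∈ 𝓑^r }`. -/
def cohSeminorm (F : Space d → Test d → ℝ) (S : Set (Space d)) (Λ : ℝ) (r : ℕ) (a γ : ℝ) :
    ℝ≥0∞ :=
  ⨆ x ∈ S, ⨆ y ∈ S, ⨆ ε ∈ Ioc (0 : ℝ) Λ, ⨆ φ ∈ unitTest d r,
    ENNReal.ofReal (|F y (scale φ x ε) - F x (scale φ x ε)| / (ε ^ a * (‖y - x‖ + ε) ^ (γ - a)))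

/-- `F` is an `a`-homogeneous germ (of some order). -/
def IsHomogeneousGerm (F : Space d → Test d → ℝ) (a : ℝ) : Prop :=
  IsGerm F ∧ ∃ s : ℕ, ∀ S : Set (Space d), IsCompact S → ∀ Λ : ℝ, 1 ≤ Λ →
    homSeminorm F S Λ s a < ⊤

/-- The distribution `R` is a `γ`-reconstruction of the `(a, γ)`-coherent germ `F`. -/
def IsReconstruction (a γ : ℝ) (F : Space d → Distr d) (R : Distr d) : Prop :=
  ∀ s : ℕ, -a < s → ∀ S : Set (Space d), IsCompact S →
    homSeminorm (fun x φ => (F x - R) φ) S 1 s γ < ⊤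

/-! ### Regularising kernels -/

/-- Functions of two variables of class `C^{m,r}`. -/
structure IsCmr (m r : ℕ) (κ : Space d → Space d → ℝ) : Prop where
  smooth_snd : ∀ x, ContDiff ℝ r (κ x)
  smooth_fst : ∀ l : Fin d → ℕ, deg l ≤ r → ∀ y, ContDiff ℝ m fun x => mderiv l (κ x) y
  cont : ∀ k l : Fin d → ℕ, deg k ≤ m → deg l ≤ r →
    Continuous fun p : Space d × Space d => mderiv k (fun x => mderiv l (κ x) p.2) p.1

/-- `K` is a `β`-regularising kernel of order `(m, r)` with range `ρ`, and `K = ∑ Kn n` is a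
decomposition witnessing it. -/
structure IsRegularisingKernel (β : ℝ) (m r : ℕ) (ρ : ℝ) (K : Space d → Space d → ℝ)
    (Kn : ℕ → Space d → Space d → ℝ) : Prop where
  beta_pos : 0 < β
  range_pos : 0 < ρ
  decomposition : ∀ᵐ p : Space d × Space d, HasSum (fun n => Kn n p.1 p.2) (K p.1 p.2)
  smooth : ∀ n, IsCmr m r (Kn n)
  support : ∀ n x y, Kn n x y ≠ 0 → ‖x - y‖ ≤ ρ * 2 ^ (-(n : ℝ))
  bound : ∀ S : Set (Space d), IsCompact S → ∃ c : ℝ, 0 < c ∧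
    (∀ n (k l : Fin d → ℕ), deg k ≤ m → deg l ≤ r → ∀ x ∈ S, ∀ y ∈ S,
      |mderiv k (fun x' => mderiv l (Kn n x') y) x| ≤
        c * 2 ^ (((d : ℝ) - β + deg l + deg k) * n)) ∧
    (∀ n (k l : Fin d → ℕ), deg k ≤ r → deg l ≤ r → ∀ y ∈ S,
      |∫ x, monomial l (y - x) * mderiv k (Kn n x) y| ≤ c * 2 ^ (-β * n))

/-- `(κ^* ψ)(y) = ∫ ψ(x) κ(x, y) dx`. -/
def dualInt (κ : Space d → Space d → ℝ) (ψ : Test d) (y : Space d) : ℝ := ∫ x, ψ x * κ x y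

/-- The integration `(K T)(ψ) = ∑_n T(K_n^* ψ)` of a distribution `T` of order `r` with the
kernel `K = ∑_n K_n`. -/
def kernelInt (Kn : ℕ → Space d → Space d → ℝ) (r : ℕ) (T : Distr d) (ψ : Test d) : ℝ :=
  ∑' n, extension r T (toTest r (dualInt (Kn n) ψ))

/-! ### Pointwise derivatives -/

/-- `v` is the pointwise derivative `D^k f (x)`: the limit as `ε ↓ 0` of `D^k f (η_x^ε)` for every
test function `η` with `∫ η = 1` that annihilates the monomials of degree in `[1, δ)`. -/
def HasPointwiseDeriv (δ : ℝ) (k : Fin d → ℕ) (f : Test d → ℝ) (x : Space d) (v : ℝ) : Prop :=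
  ∀ η : Test d, ∫ z, η z = 1 →
    (∀ l : Fin d → ℕ, 1 ≤ deg l → (deg l : ℝ) < δ → ∫ z, η z * monomial l z = 0) →
    Tendsto (fun ε => distDeriv k f (scale η x ε)) (𝓝[>] (0 : ℝ)) (𝓝 v)

open Classical in
/-- The pointwise derivative `D^k f (x)`, for `|k| < δ`, of a functional that is weakly
homogeneous of degree `δ` at `x`. -/
def pointwiseDeriv (δ : ℝ) (k : Fin d → ℕ) (f : Test d → ℝ) (x : Space d) : ℝ :=
  if h : ∃ v, HasPointwiseDeriv δ k f x v then h.choose else 0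

/-! ### Models and modelled distributions -/

variable {I : Type*} [Fintype I]

/-- The model seminorm `sup_i ‖P^i‖_{hom; S, Λ, r}^{α_i}`, for a family of germs. -/
def modelNorm (α : I → ℝ) (r : ℕ) (S : Set (Space d)) (Λ : ℝ) (P : I → Space d → Distr d) :
    ℝ≥0∞ :=
  ⨆ i, homSeminorm (fun x φ => P i x φ) S Λ r (α i)

/-- `(P, Γ)` is a model with homogeneities `α` and order `r`. The coefficient `Γ_{xy}^{ji}` is
`Γ x y j i`. -/
structure IsModel (α : I → ℝ) (r : ℕ) (P : I → Space d → Distr d)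
    (Γ : Space d → Space d → I → I → ℝ) : Prop where
  germ : ∀ i, IsGerm fun x φ => P i x φ
  hom : ∀ i, ∀ S : Set (Space d), IsCompact S → ∀ Λ : ℝ, 1 ≤ Λ →
    homSeminorm (fun x φ => P i x φ) S Λ r (α i) < ⊤
  reexpansion : ∀ i x y, P i y = ∑ j, Γ x y j i • P j x

/-- The germ `⟨f, P⟩_x = ∑_i f^i(x) P^i_x`. -/
def pairing (f : I → Space d → ℝ) (P : I → Space d → Distr d) (x : Space d) : Distr d :=
  ∑ i, f i x • P i x

/-- The seminorm `|||f|||` of order `γ` on `S`; at `x = y` the quotient is `0` if its numerator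
vanishes and `∞` otherwise. -/
def modelledNorm (α : I → ℝ) (γ : ℝ) (S : Set (Space d)) (Γ : Space d → Space d → I → I → ℝ)
    (f : I → Space d → ℝ) : ℝ≥0∞ :=
  (⨆ x ∈ S, ⨆ i, ENNReal.ofReal |f i x|) +
    ⨆ x ∈ S, ⨆ y ∈ S, ⨆ i,
      ENNReal.ofReal |∑ j, Γ x y i j * f j y - f i x| / ENNReal.ofReal (‖y - x‖ ^ (γ - α i))

/-- The distance `|||f₁ ; f₂|||` of order `γ` on `S` between modelled distributions relative to
two models, with reexpansion coefficients `Γ₁` and `Γ₂`. -/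
def modelledDist (α : I → ℝ) (γ : ℝ) (S : Set (Space d)) (Γ₁ Γ₂ : Space d → Space d → I → I → ℝ)
    (f₁ f₂ : I → Space d → ℝ) : ℝ≥0∞ :=
  (⨆ x ∈ S, ⨆ i, ENNReal.ofReal |f₁ i x - f₂ i x|) +
    ⨆ x ∈ S, ⨆ y ∈ S, ⨆ i,
      ENNReal.ofReal |∑ j, (Γ₁ x y i j * f₁ j y - Γ₂ x y i j * f₂ j y) - (f₁ i x - f₂ i x)| /
        ENNReal.ofReal (‖x - y‖ ^ (γ - α i))

/-- `f` is a modelled distribution of order `γ`. -/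
structure IsModelled (α : I → ℝ) (γ : ℝ) (Γ : Space d → Space d → I → I → ℝ)
    (f : I → Space d → ℝ) : Prop where
  measurable : ∀ i, Measurable (f i)
  finite : ∀ S : Set (Space d), IsCompact S → modelledNorm α γ S Γ f < ⊤

/-! ### Compatibility of a model and a kernel -/

/-- The model and the kernel are compatible: `(D^k (K P^i_x))_x` is a `0`-homogeneous germ
whenever `|k| = α_i + β`. -/
def IsCompatible (α : I → ℝ) (β : ℝ) (Kn : ℕ → Space d → Space d → ℝ) (rK : ℕ)
    (P : I → Space d → Distr d) : Prop :=
  ∀ i (k : Fin d → ℕ), (deg k : ℝ) = α i + β →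
    IsHomogeneousGerm (fun x => distDeriv k (kernelInt Kn rK (P i x))) 0

/-- The quantity `[K P]_{S, Λ}`: the sum over `i` and over the multi-indices `k` with
`|k| = α_i + β` of the `0`-homogeneity seminorms (of order `r`) of `(D^k (K P^i_x))_x`. -/
def compatNorm (α : I → ℝ) (β : ℝ) (Kn : ℕ → Space d → Space d → ℝ) (rK r : ℕ)
    (S : Set (Space d)) (Λ : ℝ) (P : I → Space d → Distr d) : ℝ≥0∞ :=
  ∑ i, ∑ k ∈ (poly d (α i + β + 1)).filter (fun k => (deg k : ℝ) = α i + β),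
    homSeminorm (fun x => distDeriv k (kernelInt Kn rK (P i x))) S Λ r 0

/-! ### The lifted model coefficients and the lifted modelled distribution -/

/-- The index set `I ⊔ {k : |k| < t}`. -/
abbrev HatIndex (I : Type*) (d : ℕ) (t : ℝ) : Type _ := I ⊕ {k : Fin d → ℕ // k ∈ poly d t}

/-- The homogeneities `α̂` of the lifted model. -/
def hatAlpha (α : I → ℝ) (γ β : ℝ) : HatIndex I d (γ + β) → ℝ
  | .inl i => α i + β
  | .inr k => (deg k.1 : ℝ)

/-- The coefficients of the polynomial model,
`(Γ^poly)_{xy}^{lk} = (x - y)^{k-l} / (k-l)!` if `l ≤ k`, and `0` otherwise. -/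
def gammaPoly (x y : Space d) (l k : Fin d → ℕ) : ℝ :=
  if ∀ i, l i ≤ k i then
    monomial (fun i => k i - l i) (x - y) / mfactorial (fun i => k i - l i)
  else 0

/-- The number `D^k (K P^i_x)(x)`, for `|k| < α_i + β`. -/
def derivKP (α : I → ℝ) (β : ℝ) (Kn : ℕ → Space d → Space d → ℝ) (rK : ℕ)
    (P : I → Space d → Distr d) (k : Fin d → ℕ) (i : I) (x : Space d) : ℝ :=
  pointwiseDeriv (α i + β) k (kernelInt Kn rK (P i x)) x

/-- The reexpansion coefficients `Γ̂` of the lifted model. -/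
def hatGamma (α : I → ℝ) (γ β : ℝ) (Kn : ℕ → Space d → Space d → ℝ) (rK : ℕ)
    (P : I → Space d → Distr d) (Γ : Space d → Space d → I → I → ℝ) (x y : Space d) :
    HatIndex I d (γ + β) → HatIndex I d (γ + β) → ℝ
  | .inl j, .inl i => Γ x y j i
  | .inl _, .inr _ => 0
  | .inr l, .inl i =>
      ∑ j ∈ Finset.univ.filter (fun j => (deg l.1 : ℝ) < α j + β),
          derivKP α β Kn rK P l.1 j x * Γ x y j i
        - ∑ k ∈ poly d (α i + β), gammaPoly x y l.1 k * derivKP α β Kn rK P k i y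
  | .inr l, .inr k => gammaPoly x y l.1 k.1

/-- The lifted modelled distribution `f̂`, relative to the `γ`-reconstruction `R` of `⟨f, P⟩`. -/
def hatf (α : I → ℝ) (γ β : ℝ) (Kn : ℕ → Space d → Space d → ℝ) (rK : ℕ)
    (P : I → Space d → Distr d) (f : I → Space d → ℝ) (R : Distr d) :
    HatIndex I d (γ + β) → Space d → ℝ
  | .inl i, x => f i x
  | .inr k, x =>
      ∑ j ∈ Finset.univ.filter (fun j => (deg k.1 : ℝ) < α j + β),
          f j x * derivKP α β Kn rK P k.1 j x
        - pointwiseDeriv (γ + β) k.1 (kernelInt Kn rK (pairing f P x - R)) x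

/-- Two reconstructions `R₁` of `F₁` and `R₂` of `F₂`, at order `r`, chosen consistently: the
reconstruction error depends on the germ in a Lipschitz way, with constants `c S Λ`. This holds
in particular if `R₁` and `R₂` are the images of `F₁` and `F₂` under one linear reconstruction map
with `‖F - R F‖_{hom; S, Λ}^γ ≤ c S Λ * ‖F‖_{coh; S ⊕ B(0, Λ+1), Λ}^{a, γ}`. -/
structure ConsistentReconstructions (a γ : ℝ) (r : ℕ) (c : Set (Space d) → ℝ → ℝ≥0)
    (F₁ F₂ : Space d → Distr d) (R₁ R₂ : Distr d) : Prop where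
  left : ∀ S : Set (Space d), IsCompact S → homSeminorm (fun x φ => (F₁ x - R₁) φ) S 1 r γ < ⊤
  right : ∀ S : Set (Space d), IsCompact S → homSeminorm (fun x φ => (F₂ x - R₂) φ) S 1 r γ < ⊤
  lipschitz : ∀ S : Set (Space d), IsCompact S → ∀ Λ : ℝ, 1 ≤ Λ →
    homSeminorm (fun x φ => ((F₁ x - R₁) - (F₂ x - R₂)) φ) S Λ r γ ≤
      c S Λ * cohSeminorm (fun x φ => (F₁ x - F₂ x) φ)
        (S + Metric.closedBall (0 : Space d) (Λ + 1)) Λ r a γ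

end MultilevelSchauder

end

open MultilevelSchauder

/-! Everything is read off scale by scale. If `T` is homogeneous of degree `a` at `x` and `|k| < a +
β`, then `D^k(K T)(x)` is the convergent series `Σ_n T(∂_1^k K_n(x, ·))`, whose `n`-th term has
order `2^{-n(a+β-|k|)}` (`hasPointwiseDeriv_kernelInt`).

Write `G_x = F_x - R` and `q^j = (Γ_{xy} f(y) - f(x))^j`, so that `G_y = G_x + Σ_j q^j P^j_x`. By
the form of `Γ̂`, the derivatives of the model at `y` cancel, and the `k`-th polynomial component of
`Γ̂_{xy} f̂(y) - f̂(x)` is (`hat_increment`) `Σ_{α_j+β>|k|} q^j D^k(K P^j_x)(x) + D^k(K G_x)(x) -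
Σ_p (x-y)^p/p! D^{k+p}(K G_y)(y)`. This is linear in the distributions `q^j P^j_x`, `G_x`, `G_y`, so
the two lifts can be subtracted before anything is estimated. Only two objects remain: `Q_j = q_1^j
P_1^j - q_2^j P_2^j`, homogeneous of degree `α_j` at `x` with constant `E |x-y|^{γ-α_j}`, and `G =
G_1 - G_2`, homogeneous of degree `γ` with constant of order `E`, where `E` is the bracket on the
right-hand side of the claim.

The linear estimate is `exists_schauder_bound`. The series are cut at the scale `2^{-n} ≈ |x-y|`.
Below it, every term is estimated on its own, and all exponents are positive. Above it, `G_x` plus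
the `Q_j` with `α_j + β > |k|` is replaced by `G_y` minus the remaining `Q_j`. Then `G_y` acts on a
Taylor remainder of the kernel in its first variable, which is summable towards large scales since
`γ + β` is not an integer. The remaining `Q_j` have `|k| ≥ α_j + β`. If the inequality is strict,
the sum is geometric. If equality holds, all scales contribute equally and a logarithm threatens;
this is where `[K Π] = 0` enters. The smoothed derivative `D^k(K Q_j)(η_x^ε)` vanishes, and it
differs from the sum over scales above `ε` by a bounded amount (`exists_borderline_bound`).

The homogeneity of `G` comes from coherence (`exists_reconstruction_bound`). If `γ ≤ 0` it is the
consistency assumption. If `γ > 0` it is a quantitative form of uniqueness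
(`exists_homBound_of_coh`): a test function is cut into pieces at a scale smaller by a factor `μ`,
each base point is moved to the centre of its piece at a coherence cost, and the prefactor `C μ^γ ≤
1/2` makes this a contraction. Iteration removes the a priori constant, which is only known to be
finite.

The groundwork is caused by finite regularity: `K_n(x, ·)` is only `C^{r'}`, so distributions are
extended by mollification, and derivatives are handled through jets, that is, families of partial
derivatives. -/

namespace MultilevelSchauder

variable {d : ℕ}

/-! ### Jets -/

/-- A family `J` of continuous functions indexed by multi-indices of length at most `r`, which
consists of the partial derivatives of `J 0`. -/
structure IsJet (r : ℕ) (J : (Fin d → ℕ) → Space d → ℝ) : Prop where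
  cont : ∀ l, deg l ≤ r → Continuous (J l)
  deriv : ∀ l i, deg l < r → ∀ y, HasLineDerivAt ℝ (J l) (J (l + Pi.single i 1) y) y (unitVec i)

theorem deg_add (k l : Fin d → ℕ) : deg (k + l) = deg k + deg l := by
  simp [deg, Finset.sum_add_distrib]

@[simp] theorem deg_zero : deg (0 : Fin d → ℕ) = 0 := by simp [deg]

theorem deg_single (i : Fin d) (n : ℕ) : deg (Pi.single i n : Fin d → ℕ) = n := by
  simp [deg, Finset.sum_pi_single']

theorem deg_add_single (l : Fin d → ℕ) (i : Fin d) : deg (l + Pi.single i 1) = deg l + 1 := by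
  rw [deg_add, deg_single]

theorem norm_unitVec (i : Fin d) : ‖unitVec i‖ = 1 := by simp [unitVec]

theorem deg_eq_zero {k : Fin d → ℕ} (h : deg k = 0) : k = 0 := by
  funext i
  simpa using (Finset.sum_eq_zero_iff.1 h) i (Finset.mem_univ i)

theorem exists_eq_add_single {k : Fin d → ℕ} {n : ℕ} (h : deg k = n + 1) :
    ∃ i k', k = k' + Pi.single i 1 ∧ deg k' = n := by
  obtain ⟨i, hi⟩ : ∃ i, k i ≠ 0 := by
    by_contra! hc
    have : deg k = 0 := Finset.sum_eq_zero fun i _ => hc i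
    omega
  refine ⟨i, k - Pi.single i 1, ?_, ?_⟩
  · funext j
    by_cases hj : j = i
    · subst hj; simp; omega
    · simp [hj]
  · have : k = (k - Pi.single i 1) + Pi.single i 1 := by
      funext j
      by_cases hj : j = i
      · subst hj; simp; omega
      · simp [hj]
    have h2 := deg_add_single (k - Pi.single i 1) i
    rw [← this] at h2
    omega

/-- Induction on multi-indices by adding unit multi-indices. -/
theorem multiIndex_induction {p : (Fin d → ℕ) → Prop} (h0 : p 0)
    (h1 : ∀ k i, p k → p (k + Pi.single i 1)) (k : Fin d → ℕ) : p k := by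
  induction hn : deg k generalizing k with
  | zero => rw [deg_eq_zero hn]; exact h0
  | succ n ih =>
    obtain ⟨i, k', rfl, hk'⟩ := exists_eq_add_single hn
    exact h1 _ _ (ih _ hk')

/-- The `i`-th coordinate as a continuous linear form. -/
noncomputable def coord (i : Fin d) : Space d →L[ℝ] ℝ := EuclideanSpace.proj i

@[simp] theorem coord_apply (i : Fin d) (x : Space d) : coord i x = x i := rfl

theorem abs_apply_le_norm (x : Space d) (i : Fin d) : |x i| ≤ ‖x‖ := by
  simpa using PiLp.norm_apply_le x i

theorem norm_coord_le (i : Fin d) : ‖(coord i : Space d →L[ℝ] ℝ)‖ ≤ 1 :=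
  ContinuousLinearMap.opNorm_le_bound _ zero_le_one fun x => by
    simpa using abs_apply_le_norm x i

theorem sum_smul_unitVec (x : Space d) : ∑ i, x i • unitVec i = x := by
  ext j
  simp [unitVec, Pi.single_apply]

/-- A function with continuous partial derivatives is differentiable. -/
theorem hasFDerivAt_of_continuous_partial {f : Space d → ℝ} {f' : Fin d → Space d → ℝ}
    (hc : ∀ i, Continuous (f' i))
    (hf : ∀ i y, HasLineDerivAt ℝ f (f' i y) y (unitVec i)) (y : Space d) :
    HasFDerivAt f (∑ i, f' i y • (coord i : Space d →L[ℝ] ℝ)) y := by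
  -- The coordinates of the increment are switched on one at a time; each switch costs `o(h)` by the
  -- mean value inequality and the continuity of that partial derivative at `y`.
  have key : ∀ s : Finset (Fin d), (fun h : Space d =>
      f (y + ∑ i ∈ s, h i • unitVec i) - f y - ∑ i ∈ s, h i * f' i y) =o[𝓝 0] fun h => h := by
    intro s
    induction s using Finset.induction_on with
    | empty => simp
    | insert a s ha ih =>
      have h1 : (fun h : Space d => f (y + ∑ i ∈ insert a s, h i • unitVec i) -
          f (y + ∑ i ∈ s, h i • unitVec i) - h a * f' a y) =o[𝓝 0] fun h => h := by
        rw [Asymptotics.isLittleO_iff]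
        intro c hc0
        obtain ⟨δ, hδ, hδ'⟩ := Metric.continuousAt_iff.1 (hc a).continuousAt c hc0
        have hcont : Continuous fun p : Space d × ℝ =>
            ∑ i ∈ s, p.1 i • unitVec i + (p.2 * p.1 a) • unitVec a := by fun_prop
        have hsmall : ∀ᶠ h : Space d in 𝓝 0, ∀ t ∈ Icc (0:ℝ) 1,
            ‖∑ i ∈ s, h i • unitVec i + (t * h a) • unitVec a‖ < δ := by
          have hb : ∀ h : Space d, ∀ t ∈ Icc (0:ℝ) 1,
              ‖∑ i ∈ s, h i • unitVec i + (t * h a) • unitVec a‖ ≤ (s.card + 1) * ‖h‖ := by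
            intro h t ht
            calc _ ≤ ∑ i ∈ s, ‖h i • unitVec i‖ + ‖(t * h a) • unitVec a‖ :=
                  (norm_add_le _ _).trans (by gcongr; exact norm_sum_le _ _)
              _ ≤ ∑ i ∈ s, ‖h‖ + ‖h‖ := by
                  gcongr with i hi
                  · rw [norm_smul, norm_unitVec, mul_one]; exact abs_apply_le_norm h i
                  · rw [norm_smul, norm_unitVec, mul_one, norm_mul]
                    have h2 : ‖t‖ ≤ 1 := by rw [Real.norm_eq_abs, abs_of_nonneg ht.1]; exact ht.2
                    calc ‖t‖ * ‖h a‖ ≤ 1 * ‖h‖ := by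
                          gcongr; exact abs_apply_le_norm h a
                      _ = ‖h‖ := one_mul _
              _ = _ := by simp; ring
          have : Tendsto (fun h : Space d => ((s.card : ℝ) + 1) * ‖h‖) (𝓝 0) (𝓝 0) := by
            have h3 : Continuous fun h : Space d => ((s.card : ℝ) + 1) * ‖h‖ := by fun_prop
            simpa using h3.tendsto 0
          filter_upwards [this.eventually (gt_mem_nhds hδ)] with h hh t ht
          exact (hb h t ht).trans_lt hh
        filter_upwards [hsmall] with h hh
        set p := y + ∑ i ∈ s, h i • unitVec i with hp
        have hder : ∀ t ∈ Icc (0:ℝ) 1, HasDerivWithinAt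
            (fun t : ℝ => f (p + (t * h a) • unitVec a) - t * (h a * f' a y))
            (h a * (f' a (p + (t * h a) • unitVec a) - f' a y)) (Icc 0 1) t := by
          intro t ht
          have h2 := hf a (p + (t * h a) • unitVec a)
          have h3 : HasDerivAt (fun t' : ℝ => (t' - t) * h a) (h a) t := by
            simpa using ((hasDerivAt_id t).sub_const t).mul_const (h a)
          have h4 : HasDerivAt (fun s => f (p + (t * h a) • unitVec a + s • unitVec a))
              (f' a (p + (t * h a) • unitVec a)) ((t - t) * h a) := by
            rw [sub_self, zero_mul]; exact h2
          have h5 := h4.comp t h3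
          have h6 : HasDerivAt (fun t : ℝ => t * (h a * f' a y)) (h a * f' a y) t := by
            simpa using (hasDerivAt_id t).mul_const (h a * f' a y)
          have h7 := (h5.sub h6).hasDerivWithinAt (s := Icc 0 1)
          refine (h7.congr_deriv (by ring)).congr_of_mem (fun t' _ => ?_) ht
          simp only [Pi.sub_apply, Function.comp]
          have e : p + (t' * h a) • unitVec a =
              p + (t * h a) • unitVec a + ((t' - t) * h a) • unitVec a := by
            rw [add_assoc p, ← add_smul]; congr 2; ring
          rw [e]
        have hbd : ∀ t ∈ Ico (0:ℝ) 1, ‖h a * (f' a (p + (t * h a) • unitVec a) - f' a y)‖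
            ≤ c * ‖h‖ := by
          intro t ht
          have h2 := hδ' (x := p + (t * h a) • unitVec a) (by
            rw [dist_eq_norm, hp, add_assoc, add_sub_cancel_left]
            exact hh t (Ico_subset_Icc_self ht))
          rw [norm_mul, mul_comm c]
          gcongr
          · exact abs_apply_le_norm h a
          · rw [← dist_eq_norm]; exact h2.le
        have h8 := norm_image_sub_le_of_norm_deriv_le_segment_01' hder hbd
        have h9 : y + ∑ i ∈ insert a s, h i • unitVec i = p + h a • unitVec a := by
          rw [Finset.sum_insert ha, hp]; abel
        rw [h9]
        refine le_trans (le_of_eq ?_) h8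
        congr 1
        simp only [one_mul, zero_mul, zero_smul, add_zero]
        ring
      refine (h1.add ih).congr_left fun h => ?_
      rw [Finset.sum_insert ha (f := fun i => h i * f' i y)]
      ring
  rw [hasFDerivAt_iff_isLittleO_nhds_zero]
  refine (key Finset.univ).congr_left fun h => ?_
  rw [sum_smul_unitVec]
  congr 1
  simp [mul_comm]

namespace IsJet

variable {r : ℕ} {J : (Fin d → ℕ) → Space d → ℝ}

theorem mono (hJ : IsJet r J) {s : ℕ} (h : s ≤ r) : IsJet s J :=
  ⟨fun l hl => hJ.cont l (hl.trans h), fun l i hl => hJ.deriv l i (hl.trans_le h)⟩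

theorem shift (hJ : IsJet r J) (k : Fin d → ℕ) {s : ℕ} (h : deg k + s ≤ r) :
    IsJet s (fun l => J (k + l)) :=
  ⟨fun l hl => hJ.cont _ (by rw [deg_add]; omega), fun l i hl => by
    rw [← add_assoc]; exact hJ.deriv _ i (by rw [deg_add]; omega)⟩

theorem hasFDerivAt (hJ : IsJet r J) {l : Fin d → ℕ} (hl : deg l < r) (y : Space d) :
    HasFDerivAt (J l) (∑ i, J (l + Pi.single i 1) y • (coord i : Space d →L[ℝ] ℝ)) y :=
  hasFDerivAt_of_continuous_partial (f' := fun i => J (l + Pi.single i 1))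
    (fun i => hJ.cont _ (by rw [deg_add_single]; omega)) (fun i y => hJ.deriv l i hl y) y

theorem fderiv_eq (hJ : IsJet r J) {l : Fin d → ℕ} (hl : deg l < r) :
    fderiv ℝ (J l) = fun y => ∑ i, J (l + Pi.single i 1) y • (coord i : Space d →L[ℝ] ℝ) :=
  funext fun y => (hJ.hasFDerivAt hl y).fderiv

theorem contDiff (hJ : IsJet r J) {n : ℕ} {l : Fin d → ℕ} (h : deg l + n ≤ r) :
    ContDiff ℝ n (J l) := by
  induction n generalizing l with
  | zero => exact contDiff_zero.2 (hJ.cont l (by omega))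
  | succ n ih =>
    push_cast
    rw [contDiff_succ_iff_hasFDerivAt]
    · refine ⟨_, ?_, hJ.hasFDerivAt (by omega)⟩
      refine ContDiff.sum fun i _ => ?_
      exact (ih (by rw [deg_add_single]; omega)).smul contDiff_const

/-- An entry of a jet depends only on the accumulated multi-index, so the order of differentiation
fixed in `mderiv` plays no role. Through this, iterated derivatives are read off as entries of the
jet. -/
theorem foldr_eq (hJ : IsJet r J) (k : Fin d → ℕ) (L : List (Fin d)) {l : Fin d → ℕ}
    (h : deg l + (L.map k).sum ≤ r) :
    L.foldr (fun i h => (fun (u : Space d → ℝ) (x : Space d) =>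
      lineDeriv ℝ u x (unitVec i))^[k i] h) (J l) =
      J (l + (L.map fun i => Pi.single i (k i)).sum) := by
  induction L with
  | nil => simp
  | cons a L ih =>
    rw [List.map_cons, List.sum_cons] at h
    rw [List.foldr_cons, ih (by omega)]
    have hs : ∀ L : List (Fin d),
        deg ((L.map fun i => (Pi.single i (k i) : Fin d → ℕ)).sum) = (L.map k).sum := by
      intro L
      induction L with
      | nil => simp
      | cons a L ih => simp [deg_add, deg_single, ih]
    have : ∀ n : ℕ, ∀ q : Fin d → ℕ, deg q + n ≤ r →
        (fun (u : Space d → ℝ) (x : Space d) => lineDeriv ℝ u x (unitVec a))^[n] (J q) =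
        J (q + Pi.single a n) := by
      intro n
      induction n with
      | zero => intro q _; simp
      | succ n ihn =>
        intro q hq
        rw [Function.iterate_succ_apply']
        rw [ihn q (by omega)]
        funext x
        rw [(hJ.deriv _ a (by rw [deg_add, deg_single]; omega) x).lineDeriv, add_assoc,
          ← Pi.single_add]
    rw [this _ _ (by rw [deg_add, hs]; omega), List.map_cons, List.sum_cons]
    congr 1
    rw [add_assoc, add_comm (List.sum _)]

theorem mderiv_eq (hJ : IsJet r J) {k l : Fin d → ℕ} (h : deg l + deg k ≤ r) :
    mderiv k (J l) = J (l + k) := by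
  have h1 : ((List.finRange d).map k).sum = deg k := by
    simp [deg, List.sum_ofFn, ← List.ofFn_eq_map]
  have h2 : ((List.finRange d).map fun i => (Pi.single i (k i) : Fin d → ℕ)).sum = k := by
    rw [← List.ofFn_eq_map, List.sum_ofFn]
    exact Finset.univ_sum_single k
  rw [mderiv, hJ.foldr_eq k _ (by rw [h1]; exact h), h2]

theorem mderiv_zero_eq (hJ : IsJet r J) {k : Fin d → ℕ} (h : deg k ≤ r) :
    mderiv k (J 0) = J k := by
  rw [hJ.mderiv_eq (by simpa using h), zero_add]

/-- Each Fréchet derivative is a sum over `d` coordinate forms of norm at most one, whence the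
factor `d ^ n`. Together with the converse `abs_le_norm_iteratedFDeriv`, this links bounds on
partial derivatives to the seminorms that define the topology of test functions. -/
theorem norm_iteratedFDeriv_le (hJ : IsJet r J) {n : ℕ} {l : Fin d → ℕ} (h : deg l + n ≤ r)
    (x : Space d) {M : ℝ} (hM : ∀ k, deg k = n → |J (l + k) x| ≤ M) :
    ‖iteratedFDeriv ℝ n (J l) x‖ ≤ d ^ n * M := by
  induction n generalizing l with
  | zero => simpa using hM 0 deg_zero
  | succ n ih =>
    rw [← norm_iteratedFDeriv_fderiv, hJ.fderiv_eq (by omega)]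
    have hs : ∀ i, ContDiff ℝ n (fun y => J (l + Pi.single i 1) y • (coord i : Space d →L[ℝ] ℝ)) :=
      fun i => (hJ.contDiff (by rw [deg_add_single]; omega)).smul contDiff_const
    rw [iteratedFDeriv_fun_sum_apply (fun i _ => (hs i).contDiffAt)]
    refine (norm_sum_le _ _).trans ?_
    have hi : ∀ i ∈ Finset.univ, ‖iteratedFDeriv ℝ n
        (fun y => J (l + Pi.single i 1) y • (coord i : Space d →L[ℝ] ℝ)) x‖ ≤ d ^ n * M := by
      intro i _
      have h1 : (fun y => J (l + Pi.single i 1) y • (coord i : Space d →L[ℝ] ℝ)) =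
          (ContinuousLinearMap.toSpanSingleton ℝ (coord i : Space d →L[ℝ] ℝ)) ∘
            J (l + Pi.single i 1) := by
        funext y; simp
      rw [h1]
      refine (ContinuousLinearMap.norm_iteratedFDeriv_comp_left _
        (hJ.contDiff (n := n) (by rw [deg_add_single]; omega)).contDiffAt le_rfl).trans ?_
      rw [ContinuousLinearMap.norm_toSpanSingleton]
      calc _ ≤ 1 * ‖iteratedFDeriv ℝ n (J (l + Pi.single i 1)) x‖ := by
            gcongr; exact norm_coord_le i
        _ = ‖iteratedFDeriv ℝ n (J (l + Pi.single i 1)) x‖ := one_mul _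
        _ ≤ _ := ih (by rw [deg_add_single]; omega) fun k hk => by
            have := hM (Pi.single i 1 + k) (by rw [deg_add, deg_single, hk]; omega)
            rwa [← add_assoc] at this
    refine (Finset.sum_le_sum hi).trans_eq ?_
    simp [pow_succ]
    ring

theorem abs_le_norm_iteratedFDeriv (hJ : IsJet r J) {l k : Fin d → ℕ} (h : deg l + deg k ≤ r)
    (x : Space d) : |J (l + k) x| ≤ ‖iteratedFDeriv ℝ (deg k) (J l) x‖ := by
  induction hn : deg k generalizing l k with
  | zero =>
    rw [deg_eq_zero hn]; simp
  | succ n ih =>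
    obtain ⟨i, k', rfl, hk'⟩ := exists_eq_add_single hn
    have h1 : J (l + Pi.single i 1) =
        (ContinuousLinearMap.apply ℝ ℝ (unitVec i)) ∘ fderiv ℝ (J l) := by
      funext y
      rw [hJ.fderiv_eq (by omega)]
      simp [unitVec]
    have h2 := ih (l := l + Pi.single i 1) (k := k') (by rw [deg_add_single]; omega) hk'
    rw [add_assoc, add_comm (Pi.single i 1)] at h2
    refine h2.trans ?_
    have h3 : ContDiff ℝ n (fderiv ℝ (J l)) :=
      (hJ.contDiff (n := n + 1) (by omega)).fderiv_right (by simp)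
    rw [h1]
    refine (ContinuousLinearMap.norm_iteratedFDeriv_comp_left _ h3.contDiffAt le_rfl).trans ?_
    rw [← norm_iteratedFDeriv_fderiv]
    have h4 : ‖ContinuousLinearMap.apply ℝ ℝ (unitVec i)‖ ≤ 1 :=
      ContinuousLinearMap.opNorm_le_bound _ zero_le_one fun f => by
        simpa [norm_unitVec, mul_comm] using f.le_opNorm (unitVec i)
    calc _ ≤ 1 * ‖iteratedFDeriv ℝ n (fderiv ℝ (J l)) x‖ := by gcongr
      _ = _ := one_mul _

end IsJet

/-! ### The jet of a function of class `C^r` -/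

/-- The partial derivative in the `i`-th direction. -/
noncomputable def pderiv (i : Fin d) (u : Space d → ℝ) (x : Space d) : ℝ :=
  lineDeriv ℝ u x (unitVec i)

theorem mderiv_eq_foldr (k : Fin d → ℕ) (g : Space d → ℝ) :
    mderiv k g = (List.finRange d).foldr (fun i h => (pderiv i)^[k i] h) g := rfl

@[simp] theorem mderiv_zero (g : Space d → ℝ) : mderiv 0 g = g := by
  rw [mderiv_eq_foldr]
  induction List.finRange d with
  | nil => rfl
  | cons a L ih => simp

theorem pderiv_eq_fderiv {u : Space d → ℝ} (hu : ContDiff ℝ 1 u) (i : Fin d) :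
    pderiv i u = fun x => fderiv ℝ u x (unitVec i) :=
  funext fun x => ((hu.differentiable (by simp)) x).lineDeriv_eq_fderiv

theorem contDiff_pderiv {u : Space d → ℝ} {n : ℕ} (hu : ContDiff ℝ (n + 1 : ℕ) u) (i : Fin d) :
    ContDiff ℝ n (pderiv i u) := by
  rw [pderiv_eq_fderiv (hu.of_le (by simp))]
  exact (hu.fderiv_right (m := n) (by simp)).clm_apply contDiff_const

theorem pderiv_comm {u : Space d → ℝ} (hu : ContDiff ℝ 2 u) (i j : Fin d) :
    pderiv i (pderiv j u) = pderiv j (pderiv i u) := by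
  have h1 : ContDiff ℝ 1 u := hu.of_le (by norm_num)
  have h2 : ∀ i, ContDiff ℝ 1 (pderiv i u) := fun i =>
    contDiff_pderiv (n := 1) (by simpa [one_add_one_eq_two] using hu) i
  have h3 : Differentiable ℝ (fderiv ℝ u) :=
    (hu.fderiv_right (m := 1) (by norm_num)).differentiable (by simp)
  have h4 : ∀ i j x, pderiv i (pderiv j u) x =
      fderiv ℝ (fderiv ℝ u) x (unitVec i) (unitVec j) := by
    intro i j x
    rw [pderiv_eq_fderiv (h2 j), pderiv_eq_fderiv h1]
    have := ((h3 x).hasFDerivAt.clm_apply (hasFDerivAt_const (unitVec j) x)).fderiv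
    simp only [this]
    simp
  funext x
  rw [h4, h4]
  exact (hu.contDiffAt.isSymmSndFDerivAt (by simp)).eq _ _

theorem contDiff_pderiv_iterate {u : Space d → ℝ} {a n : ℕ} (hu : ContDiff ℝ (a + n : ℕ) u)
    (i : Fin d) : ContDiff ℝ a ((pderiv i)^[n] u) := by
  induction n generalizing a with
  | zero => exact hu
  | succ n ih =>
    rw [Function.iterate_succ_apply']
    exact contDiff_pderiv (ih (by rwa [add_assoc, add_comm 1])) i

theorem pderiv_iterate_comm {u : Space d → ℝ} {n : ℕ} (hu : ContDiff ℝ (n + 1 : ℕ) u)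
    (i j : Fin d) : pderiv i ((pderiv j)^[n] u) = (pderiv j)^[n] (pderiv i u) := by
  induction n with
  | zero => rfl
  | succ n ih =>
    rw [Function.iterate_succ_apply', Function.iterate_succ_apply',
      pderiv_comm (contDiff_pderiv_iterate (a := 2) (by convert hu using 2; omega) j),
      ih (hu.of_le (by norm_cast; omega))]

theorem contDiff_foldr {u : Space d → ℝ} (k : Fin d → ℕ) (L : List (Fin d)) {a : ℕ}
    (hu : ContDiff ℝ (a + (L.map k).sum : ℕ) u) :
    ContDiff ℝ a (L.foldr (fun i h => (pderiv i)^[k i] h) u) := by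
  induction L generalizing a with
  | nil => simpa using hu
  | cons b L ih =>
    rw [List.foldr_cons]
    refine contDiff_pderiv_iterate (ih ?_) b
    rw [List.map_cons, List.sum_cons] at hu
    rwa [add_assoc]

/-- A further derivative in direction `i` commutes inwards until it meets the block of direction
`i`, which it lengthens by one. Without repetitions in the list there is only one such block. -/
theorem pderiv_foldr {u : Space d → ℝ} (k : Fin d → ℕ) (L : List (Fin d)) (hL : L.Nodup)
    (i : Fin d) (hu : ContDiff ℝ ((L.map k).sum + 1 : ℕ) u) :
    pderiv i (L.foldr (fun i h => (pderiv i)^[k i] h) u) =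
      if i ∈ L then L.foldr (fun j h => (pderiv j)^[(k + Pi.single i 1 : Fin d → ℕ) j] h) u
      else L.foldr (fun i h => (pderiv i)^[k i] h) (pderiv i u) := by
  induction L with
  | nil => simp
  | cons b L ih =>
    rw [List.nodup_cons] at hL
    rw [List.map_cons, List.sum_cons] at hu
    have hu' : ContDiff ℝ ((L.map k).sum + 1 : ℕ) u := hu.of_le (by norm_cast; omega)
    have ih := ih hL.2 hu'
    simp only [List.foldr_cons]
    by_cases hib : i = b
    · subst hib
      rw [if_pos (by simp)]
      have : L.foldr (fun j h => (pderiv j)^[(k + Pi.single i 1 : Fin d → ℕ) j] h) u =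
          L.foldr (fun i h => (pderiv i)^[k i] h) u := by
        refine List.foldr_ext _ _ _ fun j hj h => ?_
        have : j ≠ i := fun h => hL.1 (h ▸ hj)
        simp [this]
      rw [this, ← Function.iterate_succ_apply' (pderiv i)]
      simp
    · have hc : ContDiff ℝ (k b + 1 : ℕ) (L.foldr (fun i h => (pderiv i)^[k i] h) u) :=
        contDiff_foldr k L (hu.of_le (by norm_cast; omega))
      rw [pderiv_iterate_comm hc, ih]
      by_cases hi : i ∈ L
      · rw [if_pos hi, if_pos (by simp [hi])]
        simp [Ne.symm hib]
      · rw [if_neg hi, if_neg (by simp [hi, hib])]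

/-- The partial derivatives of a function of class `C^r` form a jet. -/
theorem isJet_mderiv {r : ℕ} {g : Space d → ℝ} (hg : ContDiff ℝ r g) :
    IsJet r fun l => mderiv l g := by
  have hsum : ∀ k : Fin d → ℕ, ((List.finRange d).map k).sum = deg k := fun k => by
    simp [deg, List.sum_ofFn, ← List.ofFn_eq_map]
  have hC : ∀ (a : ℕ) (l : Fin d → ℕ), a + deg l ≤ r → ContDiff ℝ a (mderiv l g) := by
    intro a l h
    refine contDiff_foldr l _ (hg.of_le ?_)
    rw [hsum]
    exact_mod_cast h
  refine ⟨fun l hl => (hC 0 l (by omega)).continuous, fun l i hl y => ?_⟩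
  have h1 := (((hC 1 l (by omega)).differentiable (by simp)) y).hasFDerivAt.hasLineDerivAt
    (unitVec i)
  have h2 : mderiv (l + Pi.single i 1) g = pderiv i (mderiv l g) := by
    rw [mderiv_eq_foldr l, pderiv_foldr l _ (List.nodup_finRange d) i
      (hg.of_le (by rw [hsum]; exact_mod_cast hl)), if_pos (List.mem_finRange i)]
    rfl
  simp only [h2]
  rwa [pderiv_eq_fderiv (hC 1 l (by omega))]

/-- The derivative of a jet along a line. -/
theorem IsJet.hasDerivAt_line {r : ℕ} {J : (Fin d → ℕ) → Space d → ℝ} (hJ : IsJet r J)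
    {l : Fin d → ℕ} (hl : deg l < r) (y v : Space d) (t : ℝ) :
    HasDerivAt (fun t : ℝ => J l (y + t • v)) (∑ i, v i * J (l + Pi.single i 1) (y + t • v)) t := by
  have h1 := hJ.hasFDerivAt hl (y + t • v)
  have h2 : HasDerivAt (fun t : ℝ => y + t • v) v t := by
    simpa using ((hasDerivAt_id t).smul_const v).const_add y
  refine (h1.comp_hasDerivAt t h2).congr_deriv ?_
  simp [mul_comm]

/-! ### Taylor's formula -/

theorem monomial_smul (p : Fin d → ℕ) (t : ℝ) (v : Space d) :
    monomial p (t • v) = t ^ deg p * monomial p v := by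
  simp [monomial, deg, mul_pow, Finset.prod_mul_distrib, Finset.prod_pow_eq_pow_sum]

theorem monomial_add_single (q : Fin d → ℕ) (i : Fin d) (v : Space d) :
    monomial (q + Pi.single i 1) v = v i * monomial q v := by
  simp only [monomial, Pi.add_apply, pow_add, Finset.prod_mul_distrib]
  rw [mul_comm]
  congr 1
  rw [Finset.prod_eq_single i] <;> simp +contextual

theorem mfactorial_add_single (q : Fin d → ℕ) (i : Fin d) :
    mfactorial (q + Pi.single i 1) = (q i + 1) * mfactorial q := by
  have : ∀ j, ((q + Pi.single i 1 : Fin d → ℕ) j).factorial =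
      (q j).factorial * if j = i then q i + 1 else 1 := by
    intro j
    by_cases h : j = i
    · subst h; simp [Nat.factorial_succ, mul_comm]
    · simp [h]
  simp only [mfactorial, this, Finset.prod_mul_distrib, Finset.prod_ite_eq', Finset.mem_univ,
    if_true]
  ring

theorem mfactorial_pos (q : Fin d → ℕ) : 0 < mfactorial q :=
  Finset.prod_pos fun _ _ => Nat.factorial_pos _

theorem mem_poly_nat (N : ℕ) (k : Fin d → ℕ) : k ∈ poly d (N : ℝ) ↔ deg k < N := by
  rw [mem_poly]; exact_mod_cast Iff.rfl

theorem abs_monomial_le (p : Fin d → ℕ) (v : Space d) : |monomial p v| ≤ ‖v‖ ^ deg p := by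
  rw [monomial, Finset.abs_prod, deg, ← Finset.prod_pow_eq_pow_sum]
  refine Finset.prod_le_prod (fun _ _ => abs_nonneg _) fun i _ => ?_
  rw [abs_pow]
  exact pow_le_pow_left₀ (abs_nonneg _) (abs_apply_le_norm v i) _

theorem monomial_zero_left (v : Space d) : monomial 0 v = 1 := by simp [monomial]

@[simp] theorem mfactorial_zero : mfactorial (0 : Fin d → ℕ) = 1 := by simp [mfactorial]

theorem monomial_zero_right {p : Fin d → ℕ} (hp : p ≠ 0) : monomial p (0 : Space d) = 0 := by
  have := monomial_smul p 0 (0 : Space d)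
  rw [zero_pow (fun h => hp (deg_eq_zero h)), zero_mul, smul_zero] at this
  exact this

/-- Taylor's formula for jets, with a bound for the remainder. -/
theorem IsJet.taylor {N : ℕ} {J : (Fin d → ℕ) → Space d → ℝ} (hJ : IsJet N J) (x y : Space d)
    {M : ℝ} (hM0 : 0 ≤ M) (hM : ∀ p, deg p = N → ∀ t ∈ Icc (0 : ℝ) 1, |J p (y + t • (x - y))| ≤ M) :
    |J 0 x - ∑ p ∈ poly d (N : ℝ), monomial p (x - y) / mfactorial p * J p y| ≤
      (d * ‖x - y‖) ^ N * M := by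
  induction N generalizing J x with
  | zero =>
    have : poly d ((0 : ℕ) : ℝ) = ∅ := Finset.eq_empty_of_forall_notMem fun k hk => by
      rw [mem_poly_nat] at hk; omega
    rw [this]
    simpa using hM 0 deg_zero 1 (by simp)
  | succ N ih =>
    set v := x - y with hv
    -- The remainder along the segment. Its derivative is `Σ_i v_i` times the remainder, of order
    -- one less, of the `i`-th partial derivative, so the induction hypothesis bounds it; reindexing
    -- by `p = q + e_i` identifies the polynomial parts.
    let S : ℝ → ℝ := fun t => J 0 (y + t • v) -
      ∑ p ∈ poly d ((N + 1 : ℕ) : ℝ), t ^ deg p * (monomial p v / mfactorial p * J p y)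
    have hpoly : ∀ t : ℝ, ∑ p ∈ poly d ((N + 1 : ℕ) : ℝ),
          (deg p : ℝ) * t ^ (deg p - 1) * (monomial p v / mfactorial p * J p y) =
        ∑ i, v i * ∑ q ∈ poly d (N : ℝ), monomial q (t • v) / mfactorial q *
          J (Pi.single i 1 + q) y := by
      intro t
      have h1 : ∀ p : Fin d → ℕ, (deg p : ℝ) * t ^ (deg p - 1) *
          (monomial p v / mfactorial p * J p y) = ∑ i, (p i : ℝ) * t ^ (deg p - 1) *
          (monomial p v / mfactorial p * J p y) := by
        intro p
        rw [← Finset.sum_mul, ← Finset.sum_mul, deg]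
        push_cast
        rfl
      rw [Finset.sum_congr rfl fun p _ => h1 p, Finset.sum_comm]
      refine Finset.sum_congr rfl fun i _ => ?_
      rw [Finset.mul_sum]
      symm
      refine Finset.sum_of_injOn (fun q => q + Pi.single i 1) (add_left_injective _).injOn ?_ ?_ ?_
      · intro q hq
        rw [Finset.mem_coe, mem_poly_nat] at hq ⊢
        rw [deg_add_single]; omega
      · intro p hp hp'
        have : p i = 0 := by
          by_contra hne
          refine hp' ⟨p - Pi.single i 1, ?_, ?_⟩
          · rw [mem_poly_nat] at hp
            rw [Finset.mem_coe, mem_poly_nat]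
            have h3 : p - Pi.single i 1 + Pi.single i 1 = p := by
              funext j
              by_cases hj : j = i
              · subst hj; simp; omega
              · simp [hj]
            have := deg_add_single (p - Pi.single i 1) i
            rw [h3] at this
            omega
          · funext j
            by_cases hj : j = i
            · subst hj; simp; omega
            · simp [hj]
        simp [this]
      · intro q hq
        simp only [deg_add_single, monomial_add_single, mfactorial_add_single, Pi.add_apply,
          Pi.single_eq_same, monomial_smul, add_comm (Pi.single i 1)]
        have h5 : (mfactorial q : ℝ) ≠ 0 := by exact_mod_cast (mfactorial_pos q).ne'
        have h6 : (q i : ℝ) + 1 ≠ 0 := by positivity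
        push_cast
        field_simp
    have hder : ∀ t ∈ Icc (0:ℝ) 1, HasDerivWithinAt S (∑ i, v i *
        (J (Pi.single i 1 + 0) (y + t • v) - ∑ q ∈ poly d (N : ℝ),
          monomial q (t • v) / mfactorial q * J (Pi.single i 1 + q) y)) (Icc 0 1) t := by
      intro t _
      have h1 := hJ.hasDerivAt_line (l := 0) (by simp) y v t
      have h2 : HasDerivAt (fun t : ℝ => ∑ p ∈ poly d ((N + 1 : ℕ) : ℝ),
          t ^ deg p * (monomial p v / mfactorial p * J p y)) (∑ p ∈ poly d ((N + 1 : ℕ) : ℝ),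
          (deg p : ℝ) * t ^ (deg p - 1) * (monomial p v / mfactorial p * J p y)) t := by
        refine HasDerivAt.fun_sum fun p _ => ?_
        exact (hasDerivAt_pow (deg p) t).mul_const _
      refine ((h1.sub h2).congr_deriv ?_).hasDerivWithinAt
      rw [hpoly, ← Finset.sum_sub_distrib]
      refine Finset.sum_congr rfl fun i _ => ?_
      rw [zero_add, add_zero, mul_sub]
    have hbd : ∀ t ∈ Ico (0:ℝ) 1, ‖∑ i, v i *
        (J (Pi.single i 1 + 0) (y + t • v) - ∑ q ∈ poly d (N : ℝ),
          monomial q (t • v) / mfactorial q * J (Pi.single i 1 + q) y)‖ ≤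
        (d * ‖v‖) ^ (N + 1) * M := by
      intro t ht
      have h1 : ∀ i ∈ Finset.univ, ‖v i * (J (Pi.single i 1 + 0) (y + t • v) -
          ∑ q ∈ poly d (N : ℝ), monomial q (t • v) / mfactorial q * J (Pi.single i 1 + q) y)‖ ≤
          ‖v‖ * ((d * ‖v‖) ^ N * M) := by
        intro i _
        rw [norm_mul]
        gcongr
        · exact abs_apply_le_norm v i
        · have h2 := ih (hJ.shift (Pi.single i 1) (s := N) (by rw [deg_single]; omega))
            (y + t • v) (fun p hp s hs => by
              have := hM (Pi.single i 1 + p) (by rw [deg_add, deg_single, hp]; omega) (s * t)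
                ⟨mul_nonneg hs.1 ht.1, mul_le_one₀ hs.2 ht.1 ht.2.le⟩
              simpa [mul_smul] using this)
          rw [add_sub_cancel_left] at h2
          refine h2.trans ?_
          gcongr
          rw [norm_smul, Real.norm_eq_abs, abs_of_nonneg ht.1]
          calc t * ‖v‖ ≤ 1 * ‖v‖ := by gcongr; exact ht.2.le
            _ = ‖v‖ := one_mul _
      refine (norm_sum_le_of_le _ h1).trans_eq ?_
      simp
      ring
    have h := norm_image_sub_le_of_norm_deriv_le_segment_01' hder hbd
    have hS0 : S 0 = 0 := by
      simp only [S, zero_smul, add_zero]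
      rw [Finset.sum_eq_single 0]
      · simp [monomial_zero_left]
      · intro p _ hp
        rw [zero_pow (fun h => hp (deg_eq_zero h)), zero_mul]
      · intro h0; exact absurd ((mem_poly_nat _ _).2 (by simp)) h0
    rw [hS0, sub_zero] at h
    convert h using 2
    simp [S, hv]

/-! ### Operations on jets -/

namespace IsJet

variable {r : ℕ} {J J' : (Fin d → ℕ) → Space d → ℝ}

theorem const_mul (hJ : IsJet r J) (c : ℝ) : IsJet r fun l y => c * J l y :=
  ⟨fun l hl => (hJ.cont l hl).const_mul c, fun l i hl y => (hJ.deriv l i hl y).const_mul c⟩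

theorem sub (hJ : IsJet r J) (hJ' : IsJet r J') : IsJet r fun l y => J l y - J' l y :=
  ⟨fun l hl => (hJ.cont l hl).sub (hJ'.cont l hl),
    fun l i hl y => HasDerivAt.sub (hJ.deriv l i hl y) (hJ'.deriv l i hl y)⟩

theorem sum {ι : Type*} (s : Finset ι) {F : ι → (Fin d → ℕ) → Space d → ℝ}
    (hF : ∀ i ∈ s, IsJet r (F i)) : IsJet r fun l y => ∑ i ∈ s, F i l y :=
  ⟨fun l hl => continuous_finsetSum s fun i hi => (hF i hi).cont l hl,
    fun l j hl y => HasDerivAt.fun_sum fun i hi => (hF i hi).deriv l j hl y⟩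

/-- The jet of `y ↦ g (a • (y - x))`. -/
theorem comp_smul_sub (hJ : IsJet r J) (a : ℝ) (x : Space d) :
    IsJet r fun l y => a ^ deg l * J l (a • (y - x)) := by
  refine ⟨fun l hl => ?_, fun l i hl y => ?_⟩
  · have := hJ.cont l hl
    fun_prop
  · have h1 : HasDerivAt (fun t : ℝ => a * t) a 0 := by
      simpa using (hasDerivAt_id (0:ℝ)).const_mul a
    have h2 := hJ.deriv l i hl (a • (y - x))
    have h3 : HasDerivAt (fun t => J l (a • (y - x) + t • unitVec i))
        (J (l + Pi.single i 1) (a • (y - x))) (a * 0) := by rw [mul_zero]; exact h2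
    refine (((h3.comp (0:ℝ) h1).const_mul (a ^ deg l)).congr_deriv ?_).congr_of_eventuallyEq ?_
    · rw [deg_add_single]; ring
    · refine Eventually.of_forall fun t => ?_
      simp only [Function.comp]
      congr 2
      module

theorem eq_zero_of_isOpen (hJ : IsJet r J) {U : Set (Space d)} (hU : IsOpen U)
    (h0 : ∀ y ∈ U, J 0 y = 0) {l : Fin d → ℕ} (hl : deg l ≤ r) : ∀ y ∈ U, J l y = 0 := by
  induction l using multiIndex_induction with
  | h0 => exact h0
  | h1 k i ih =>
    rw [deg_add_single] at hl
    intro y hy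
    refine HasDerivAt.unique (hJ.deriv k i (by omega) y) ?_
    refine (hasDerivAt_const (0:ℝ) (0:ℝ)).congr_of_eventuallyEq ?_
    have : ContinuousAt (fun t : ℝ => y + t • unitVec i) 0 := by fun_prop
    filter_upwards [this.preimage_mem_nhds (hU.mem_nhds (by simpa using hy))] with t ht
    exact ih (by omega) _ ht

theorem eq_zero_of_support (hJ : IsJet r J) {K : Set (Space d)} (hK : IsClosed K)
    (h0 : ∀ y, y ∉ K → J 0 y = 0) {l : Fin d → ℕ} (hl : deg l ≤ r) {y : Space d} (hy : y ∉ K) :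
    J l y = 0 :=
  hJ.eq_zero_of_isOpen hK.isOpen_compl h0 hl y hy

end IsJet

theorem isJet_test (φ : Test d) (r : ℕ) : IsJet r fun l => mderiv l φ :=
  isJet_mderiv (φ.contDiff.of_le (by exact_mod_cast le_top))

theorem testDeriv_apply (k : Fin d → ℕ) (φ : Test d) (z : Space d) :
    testDeriv k φ z = mderiv k φ z := by rw [coe_testDeriv]

/-! ### Mixed partial derivatives of functions of two variables -/

/-- A family of mixed partial derivatives of a function of two variables. -/
structure IsBijet (m r : ℕ) (V : (Fin d → ℕ) → (Fin d → ℕ) → Space d → Space d → ℝ) :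
    Prop where
  cont : ∀ k l, deg k ≤ m → deg l ≤ r → Continuous fun p : Space d × Space d => V k l p.1 p.2
  fst : ∀ l, deg l ≤ r → ∀ y, IsJet m fun k x => V k l x y
  snd : ∀ k, deg k ≤ m → ∀ x, IsJet r fun l y => V k l x y

theorem abs_sub_le_of_hasDerivAt {f f' : ℝ → ℝ} {C t : ℝ}
    (hf : ∀ s, |s| ≤ |t| → HasDerivAt f (f' s) s) (hb : ∀ s, |s| ≤ |t| → |f' s| ≤ C) :
    |f t - f 0| ≤ C * |t| := by
  have h := (convex_Icc (-|t|) |t|).norm_image_sub_le_of_norm_hasDerivWithin_le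
    (f := f) (f' := f') (C := C) (x := 0) (y := t)
    (fun s hs => (hf s (abs_le.2 hs)).hasDerivWithinAt) (fun s hs => hb s (abs_le.2 hs))
    (abs_le.1 (by simp)) (abs_le.1 le_rfl)
  simpa using h

theorem hasDerivAt_add_smul {f : Space d → ℝ} {f' : ℝ} {x v : Space d} {s : ℝ}
    (h : HasLineDerivAt ℝ f f' (x + s • v) v) : HasDerivAt (fun s : ℝ => f (x + s • v)) f' s := by
  have h2 : HasDerivAt (fun s' : ℝ => s' - s) 1 s := by simpa using (hasDerivAt_id s).sub_const s
  have h3 : HasDerivAt (fun t : ℝ => f (x + s • v + t • v)) f' (s - s) := by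
    rw [sub_self]; exact h
  refine ((HasDerivAt.comp (h := fun s' : ℝ => s' - s) s h3 h2).congr_deriv
    (mul_one _)).congr_of_eventuallyEq (Eventually.of_forall fun t => ?_)
  simp only [Function.comp]
  congr 1
  module

/-- A mixed partial derivative that exists in one order and is continuous exists in the other. -/
theorem hasLineDerivAt_swap {V U W Z : Space d → Space d → ℝ} {u v : Space d}
    (hZ : ∀ x y, HasLineDerivAt ℝ (fun x => V x y) (Z x y) x u)
    (hU : ∀ x y, HasLineDerivAt ℝ (V x) (U x y) y v)
    (hW : ∀ x y, HasLineDerivAt ℝ (fun x => U x y) (W x y) x u)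
    (hc : Continuous fun p : Space d × Space d => W p.1 p.2) (x y : Space d) :
    HasLineDerivAt ℝ (Z x) (W x y) y v := by
  have lineU : ∀ x y s, HasDerivAt (fun s : ℝ => U (x + s • u) y) (W (x + s • u) y) s :=
    fun x y s => hasDerivAt_add_smul (f := fun x => U x y) (hW _ y)
  have lineV : ∀ x y s, HasDerivAt (fun s : ℝ => V x (y + s • v)) (U x (y + s • v)) s :=
    fun x y s => hasDerivAt_add_smul (f := V x) (hU x _)
  have hc2 : Continuous fun p : ℝ × ℝ => W (x + p.1 • u) (y + p.2 • v) :=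
    hc.comp (by fun_prop : Continuous fun p : ℝ × ℝ => (x + p.1 • u, y + p.2 • v))
  unfold HasLineDerivAt
  rw [hasDerivAt_iff_isLittleO_nhds_zero, Asymptotics.isLittleO_iff]
  intro c hc0
  obtain ⟨δ, hδ, hδ'⟩ := Metric.continuousAt_iff.1 (hc2.continuousAt (x := (0, 0))) c hc0
  have hδ2 : ∀ s t : ℝ, |s| < δ → |t| < δ → |W (x + s • u) (y + t • v) - W x y| ≤ c := by
    intro s t hs ht
    have := hδ' (x := (s, t)) (by
      rw [Prod.dist_eq]; simpa using ⟨hs, ht⟩)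
    simp only [zero_smul, add_zero] at this
    exact this.le
  -- The second difference of `V`, compared with `s t W`: the mean value inequality is used first in
  -- `s`, where only `W` appears, and then in `t`. The next step divides by `s` and lets `s ↓ 0`
  -- with `t` fixed.
  have h1 : ∀ s t : ℝ, |s| < δ → |t| < δ →
      |(V (x + s • u) (y + t • v) - V x (y + t • v)) - (V (x + s • u) y - V x y)
        - t * (s * W x y)| ≤ c * |s| * |t| := by
    intro s t hs ht
    have h2 : ∀ τ, |τ| ≤ |t| →
        |U (x + s • u) (y + τ • v) - U x (y + τ • v) - s * W x y| ≤ c * |s| := by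
      intro τ hτ
      have := abs_sub_le_of_hasDerivAt (t := s) (C := c)
        (f := fun s => U (x + s • u) (y + τ • v) - s * W x y)
        (f' := fun s => W (x + s • u) (y + τ • v) - W x y)
        (fun σ _ => (lineU x _ σ).sub (by simpa using (hasDerivAt_id σ).mul_const (W x y)))
        (fun σ hσ => hδ2 σ τ (hσ.trans_lt hs) (hτ.trans_lt ht))
      simp only [zero_smul, add_zero, zero_mul, sub_zero] at this
      refine le_trans (le_of_eq ?_) this
      congr 1; ring
    have := abs_sub_le_of_hasDerivAt (t := t) (C := c * |s|)
      (f := fun τ => V (x + s • u) (y + τ • v) - V x (y + τ • v) - τ * (s * W x y))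
      (f' := fun τ => U (x + s • u) (y + τ • v) - U x (y + τ • v) - s * W x y)
      (fun τ _ => ((lineV _ y τ).sub (lineV _ y τ)).sub
        (by simpa using (hasDerivAt_id τ).mul_const (s * W x y))) h2
    simp only [zero_smul, add_zero, zero_mul, sub_zero] at this
    refine le_trans (le_of_eq ?_) this
    congr 1; ring
  have hlim : ∀ t : ℝ, |t| < δ → |Z x (y + t • v) - Z x y - t * W x y| ≤ c * |t| := by
    intro t ht
    have hZ1 := (hZ x (y + t • v)).tendsto_slope_zero_right
    have hZ2 := (hZ x y).tendsto_slope_zero_right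
    have h3 := ((hZ1.sub hZ2).sub_const (t * W x y)).abs
    refine le_of_tendsto h3 ?_
    have : ∀ᶠ s : ℝ in 𝓝[>] 0, s ∈ Ioo 0 δ := Ioo_mem_nhdsGT hδ
    filter_upwards [this] with s hs
    have h4 := h1 s t (by rw [abs_of_pos hs.1]; exact hs.2) ht
    have h5 : s⁻¹ • (V (x + s • u) (y + t • v) - V x (y + t • v)) -
        s⁻¹ • (V (x + s • u) y - V x y) - t * W x y =
        s⁻¹ * ((V (x + s • u) (y + t • v) - V x (y + t • v)) - (V (x + s • u) y - V x y)
        - t * (s * W x y)) := by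
      have := hs.1.ne'
      simp only [smul_eq_mul]
      field_simp
    rw [h5, abs_mul, abs_of_pos (inv_pos.2 hs.1)]
    calc s⁻¹ * _ ≤ s⁻¹ * (c * |s| * |t|) :=
          mul_le_mul_of_nonneg_left h4 (inv_pos.2 hs.1).le
      _ = c * |t| := by
        rw [abs_of_pos hs.1]
        have := hs.1.ne'
        field_simp
  filter_upwards [Metric.ball_mem_nhds (0:ℝ) hδ] with t ht
  rw [mem_ball_zero_iff, Real.norm_eq_abs] at ht
  simpa using hlim t ht

/-- The class `C^{m,r}` takes the derivatives in the second variable first, so jets in the first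
variable are immediate. For jets in the second variable, induction on `k` moves one first-variable
derivative at a time across with `hasLineDerivAt_swap`. -/
theorem IsCmr.isBijet {m r : ℕ} {κ : Space d → Space d → ℝ} (h : IsCmr m r κ) :
    IsBijet m r fun k l x y => mderiv k (fun x' => mderiv l (κ x') y) x := by
  have hfst : ∀ l, deg l ≤ r → ∀ y,
      IsJet m fun k x => mderiv k (fun x' => mderiv l (κ x') y) x :=
    fun l hl y => isJet_mderiv (h.smooth_fst l hl y)
  refine ⟨h.cont, hfst, fun k hk => ?_⟩
  induction k using multiIndex_induction with
  | h0 => intro x; simpa using isJet_mderiv (h.smooth_snd x)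
  | h1 k j ih =>
    rw [deg_add_single] at hk
    intro x
    refine ⟨fun l hl => (h.cont _ l (by rw [deg_add_single]; omega) hl).comp
      (by fun_prop : Continuous fun y => (x, y)), fun l i hl y => ?_⟩
    exact hasLineDerivAt_swap (u := unitVec j) (v := unitVec i)
      (fun x y => (hfst l hl.le y).deriv k j (by omega) x)
      (fun x y => (ih (by omega) x).deriv l i hl y)
      (fun x y => (hfst _ (by rw [deg_add_single]; omega) y).deriv k j (by omega) x)
      (h.cont _ _ (by rw [deg_add_single]; omega) (by rw [deg_add_single]; omega)) x y

/-- Taylor's formula with the coefficients of the polynomial model. -/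
theorem sum_gammaPoly_mul (t : ℝ) (x y : Space d) (k : Fin d → ℕ) (f : (Fin d → ℕ) → ℝ) :
    ∑ l ∈ poly d t, gammaPoly x y k l * f l =
      ∑ p ∈ poly d (t - deg k), monomial p (x - y) / mfactorial p * f (k + p) := by
  symm
  refine Finset.sum_of_injOn (fun q => k + q) (add_right_injective _).injOn ?_ ?_ ?_
  · intro q hq
    rw [Finset.mem_coe, mem_poly] at hq ⊢
    rw [deg_add]; push_cast; linarith
  · intro l hl hl'
    rw [gammaPoly, if_neg, zero_mul]
    intro hkl
    refine hl' ⟨l - k, ?_, funext fun i => by simpa using Nat.add_sub_cancel' (hkl i)⟩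
    have h3 : k + (l - k) = l := funext fun i => Nat.add_sub_cancel' (hkl i)
    rw [mem_poly] at hl
    rw [Finset.mem_coe, mem_poly]
    have := deg_add k (l - k)
    rw [h3] at this
    rw [this] at hl
    push_cast at hl
    linarith
  · intro q _
    have h1 : (fun i => (k + q) i - k i) = q := by funext i; simp
    rw [gammaPoly, if_pos (fun i => by simp), h1]

/-! ### Integrals depending on a parameter -/

theorem integral_mul_eq_setIntegral {w : Space d → ℝ} {K : Set (Space d)} (hw0 : ∀ t, t ∉ K → w t = 0)
    (h : Space d → ℝ) : ∫ t, w t * h t = ∫ t in K, w t * h t := by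
  rw [setIntegral_eq_integral_of_forall_compl_eq_zero]
  intro t ht
  rw [hw0 t ht, zero_mul]

/-- Differentiation under the integral: all derivatives fall on `H`, and continuity on a compact set
provides the dominating constant. It serves both mollifications and the functions `K_n^* ψ`. -/
theorem isJet_integral_mul {r : ℕ} {w : Space d → ℝ} (hw : Continuous w) {K : Set (Space d)}
    (hK : IsCompact K) (hw0 : ∀ t, t ∉ K → w t = 0)
    {H : (Fin d → ℕ) → Space d → Space d → ℝ}
    (hH : ∀ t, IsJet r fun l y => H l t y)
    (hc : ∀ l, deg l ≤ r → Continuous fun p : Space d × Space d => H l p.1 p.2) :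
    IsJet r fun l y => ∫ t, w t * H l t y := by
  have hcont : ∀ l, deg l ≤ r → Continuous fun p : Space d × Space d => w p.2 * H l p.2 p.1 :=
    fun l hl => (hw.comp continuous_snd).mul ((hc l hl).comp continuous_swap)
  refine ⟨fun l hl => ?_, fun l i hl y => ?_⟩
  · simp only [integral_mul_eq_setIntegral hw0]
    exact continuous_parametric_integral_of_continuous (f := fun y t => w t * H l t y)
      (hcont l hl) hK
  · simp only [integral_mul_eq_setIntegral hw0]
    have hl' : deg (l + Pi.single i 1) ≤ r := by rw [deg_add_single]; omega
    have hc1 : Continuous fun p : ℝ × Space d =>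
        w p.2 * H (l + Pi.single i 1) p.2 (y + p.1 • unitVec i) :=
      (hcont _ hl').comp (by fun_prop : Continuous fun p : ℝ × Space d =>
        (y + p.1 • unitVec i, p.2))
    obtain ⟨C, hC⟩ := ((isCompact_Icc (a := (-1 : ℝ)) (b := 1)).prod hK).exists_bound_of_continuousOn
      hc1.continuousOn
    have := hasDerivAt_integral_of_dominated_loc_of_deriv_le (μ := volume.restrict K)
      (F := fun s t => w t * H l t (y + s • unitVec i))
      (F' := fun s t => w t * H (l + Pi.single i 1) t (y + s • unitVec i))
      (x₀ := (0:ℝ)) (s := Icc (-1) 1) (bound := fun _ => C)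
      (Icc_mem_nhds (by norm_num) (by norm_num)) ?_ ?_ ?_ ?_ ?_ ?_
    · simpa [HasLineDerivAt] using this.2
    · refine Eventually.of_forall fun s => ?_
      exact ((hcont l hl.le).comp (by fun_prop : Continuous fun t : Space d =>
        (y + s • unitVec i, t))).aestronglyMeasurable
    · exact ((hcont l hl.le).comp (by fun_prop : Continuous fun t : Space d =>
        (y + (0:ℝ) • unitVec i, t))).continuousOn.integrableOn_compact hK
    · exact (hc1.comp (by fun_prop : Continuous fun t : Space d => ((0:ℝ), t))).aestronglyMeasurable
    · refine (ae_restrict_iff' hK.measurableSet).2 (Eventually.of_forall fun t ht s hs => ?_)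
      exact hC (s, t) ⟨hs, ht⟩
    · have : IsFiniteMeasure (volume.restrict K) := ⟨by
        rw [Measure.restrict_apply_univ]; exact hK.measure_lt_top⟩
      exact integrable_const C
    · refine Eventually.of_forall fun t s _ => ?_
      refine (hasDerivAt_add_smul (f := H l t) ?_).const_mul (w t)
      exact (hH t).deriv l i hl _

/-! ### Mollification -/

/-- A bump function at scale `1 / (n + 1)`. -/
noncomputable def bumpSeq (d n : ℕ) : ContDiffBump (0 : Space d) :=
  ⟨1 / (2 * ((n : ℝ) + 1)), 1 / ((n : ℝ) + 1), by positivity, by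
    apply one_div_lt_one_div_of_lt <;> linarith [n.cast_nonneg (α := ℝ)]⟩

theorem bumpSeq_rOut (n : ℕ) : (bumpSeq d n).rOut = 1 / ((n : ℝ) + 1) := rfl

/-- Mollification at scale `1 / (n + 1)`. -/
noncomputable def moll (n : ℕ) (g : Space d → ℝ) : Space d → ℝ :=
  convolution ((bumpSeq d n).normed volume) g (ContinuousLinearMap.lsmul ℝ ℝ) volume

theorem moll_apply (n : ℕ) (g : Space d → ℝ) (y : Space d) :
    moll n g y = ∫ t, (bumpSeq d n).normed volume t * g (y - t) := rfl

theorem abs_moll_sub_le {g : Space d → ℝ} (hg : Continuous g) (n : ℕ) {y : Space d} {z ε : ℝ}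
    (hε : 0 ≤ ε) (h : ∀ x ∈ Metric.ball y (1 / ((n : ℝ) + 1)), |g x - z| ≤ ε) :
    |moll n g y - z| ≤ ε := by
  have := dist_convolution_le (μ := volume) (f := (bumpSeq d n).normed volume) (g := g)
    (x₀ := y) (R := 1 / ((n : ℝ) + 1)) (z₀ := z) hε
    (by rw [ContDiffBump.support_normed_eq, bumpSeq_rOut])
    (fun x => ContDiffBump.nonneg_normed _ x) (ContDiffBump.integral_normed _)
    hg.aestronglyMeasurable (fun x hx => by rw [Real.dist_eq]; exact h x hx)
  rwa [Real.dist_eq] at this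

theorem abs_moll_le {g : Space d → ℝ} (hg : Continuous g) (n : ℕ) (y : Space d) {M : ℝ}
    (h : ∀ x, |g x| ≤ M) : |moll n g y| ≤ M := by
  have := abs_moll_sub_le hg n (y := y) (z := 0) ((abs_nonneg _).trans (h 0))
    (fun x _ => by simpa using h x)
  simpa using this

theorem moll_eq_zero {g : Space d → ℝ} (hg : Continuous g) (n : ℕ) {x y : Space d} {s : ℝ}
    (h : ∀ z, z ∉ Metric.closedBall x s → g z = 0)
    (hy : y ∉ Metric.closedBall x (s + 1 / ((n : ℝ) + 1))) : moll n g y = 0 := by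
  have := abs_moll_sub_le hg n (y := y) (z := 0) le_rfl (fun z hz => by
    rw [h z, sub_zero, abs_zero]
    intro hz'
    apply hy
    rw [Metric.mem_closedBall] at hz' ⊢
    rw [Metric.mem_ball, dist_comm] at hz
    linarith [dist_triangle y z x])
  simpa using this

theorem IsJet.moll {r : ℕ} {J : (Fin d → ℕ) → Space d → ℝ} (hJ : IsJet r J) (n : ℕ) :
    IsJet r fun l => moll n (J l) := by
  refine isJet_integral_mul (w := (bumpSeq d n).normed volume)
    (H := fun l t y => J l (y - t)) (ContDiffBump.continuous_normed _)
    (ContDiffBump.hasCompactSupport_normed (bumpSeq d n) (μ := volume)).isCompact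
    (fun t ht => image_eq_zero_of_notMem_tsupport ht) (fun t => ?_) fun l hl => ?_
  · simpa using hJ.comp_smul_sub 1 t
  · have := hJ.cont l hl
    fun_prop

theorem contDiff_moll {g : Space d → ℝ} (hg : Continuous g) (n : ℕ) {N : ℕ∞} :
    ContDiff ℝ N (moll n g) :=
  HasCompactSupport.contDiff_convolution_left _ (ContDiffBump.hasCompactSupport_normed _)
    (ContDiffBump.contDiff_normed _) hg.locallyIntegrable

theorem hasCompactSupport_moll {g : Space d → ℝ} (hg : HasCompactSupport g) (n : ℕ) :
    HasCompactSupport (moll n g) :=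
  HasCompactSupport.convolution _ (ContDiffBump.hasCompactSupport_normed _) hg

/-- The mollification of a compactly supported function of finite regularity. -/
noncomputable def mollTest {r : ℕ} (n : ℕ) (g : TestOfOrder d r) : Test d :=
  ⟨moll n g, contDiff_moll g.continuous n, hasCompactSupport_moll g.hasCompactSupport n,
    fun _ _ => trivial⟩

@[simp] theorem coe_mollTest {r : ℕ} (n : ℕ) (g : TestOfOrder d r) :
    (mollTest n g : Space d → ℝ) = moll n g := rfl

theorem integrable_bump_mul {g : Space d → ℝ} (hg : Continuous g) (n : ℕ) (y : Space d) :
    Integrable fun t => (bumpSeq d n).normed volume t * g (y - t) := by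
  have h : Continuous fun t => (bumpSeq d n).normed volume t * g (y - t) :=
    (ContDiffBump.continuous_normed _).mul (by fun_prop)
  exact h.integrable_of_hasCompactSupport
    ((ContDiffBump.hasCompactSupport_normed (bumpSeq d n)).mul_right)

theorem mollTest_add {r : ℕ} (n : ℕ) (f g : TestOfOrder d r) :
    mollTest n (f + g) = mollTest n f + mollTest n g := by
  ext y
  change moll n (⇑(f + g)) y = moll n f y + moll n g y
  simp only [moll_apply]
  rw [← integral_add (integrable_bump_mul f.continuous n y)
    (integrable_bump_mul g.continuous n y)]
  refine integral_congr_ae (Eventually.of_forall fun t => ?_)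
  change _ * (f (y - t) + g (y - t)) = _
  ring

theorem mollTest_smul {r : ℕ} (n : ℕ) (c : ℝ) (g : TestOfOrder d r) :
    mollTest n (c • g) = c • mollTest n g := by
  ext y
  change moll n (⇑(c • g)) y = c * moll n g y
  simp only [moll_apply]
  rw [← integral_const_mul]
  refine integral_congr_ae (Eventually.of_forall fun t => ?_)
  change _ * (c * g (y - t)) = _
  ring

theorem exists_uniform_moll_close {r : ℕ} {J : (Fin d → ℕ) → Space d → ℝ} (hJ : IsJet r J)
    (hs : HasCompactSupport (J 0)) {ε : ℝ} (hε : 0 < ε) :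
    ∀ᶠ n in atTop, ∀ l, deg l ≤ r → ∀ y, |moll n (J l) y - J l y| ≤ ε := by
  have h1 : ∀ l : Fin d → ℕ, deg l ≤ r → ∀ᶠ n in atTop, ∀ y, |moll n (J l) y - J l y| ≤ ε := by
    intro l hl
    have hcs : HasCompactSupport (J l) := by
      refine HasCompactSupport.intro hs.isCompact fun y hy => ?_
      exact hJ.eq_zero_of_support (isClosed_tsupport _)
        (fun y hy => image_eq_zero_of_notMem_tsupport hy) hl hy
    have huc := (hJ.cont l hl).uniformContinuous_of_tendsto_cocompact
      (hcs.is_zero_at_infty)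
    obtain ⟨δ, hδ, hδ'⟩ := Metric.uniformContinuous_iff.1 huc ε hε
    obtain ⟨n₀, hn₀⟩ := exists_nat_one_div_lt hδ
    filter_upwards [eventually_ge_atTop n₀] with n hn y
    refine abs_moll_sub_le (hJ.cont l hl) n hε.le fun x hx => ?_
    rw [← Real.dist_eq]
    refine (hδ' ((Metric.mem_ball.1 hx).trans_le ?_)).le
    refine le_trans ?_ hn₀.le
    apply one_div_le_one_div_of_le (by positivity)
    have : (n₀ : ℝ) ≤ n := by exact_mod_cast hn
    linarith
  have hfin : {l : Fin d → ℕ | deg l ≤ r}.Finite := by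
    refine (poly d ((r + 1 : ℕ) : ℝ)).finite_toSet.subset fun l hl => ?_
    rw [Finset.mem_coe, mem_poly_nat]
    exact Nat.lt_succ_of_le hl
  have := (hfin.eventually_all (l := atTop) (p := fun l n => ∀ y, |moll n (J l) y - J l y| ≤ ε)).2
    fun l hl => h1 l hl
  filter_upwards [this] with n hn l hl
  exact hn l hl

/-! ### Functionals on compactly supported functions of finite regularity -/

theorem toTest_apply {r : ℕ} {g : Space d → ℝ} (h : ContDiff ℝ r g) (hc : HasCompactSupport g) :
    (toTest r g : Space d → ℝ) = g := by
  rw [toTest, dif_pos ⟨h, hc⟩]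
  rfl

theorem monoCLM_coe {r : ℕ} (φ : Test d) :
    ((TestFunction.monoCLM ℝ φ : TestOfOrder d r) : Space d → ℝ) = φ := by
  rw [TestFunction.monoCLM_apply, if_pos ⟨le_top, le_rfl⟩]

/-- Uniform convergence of all derivatives, with supports in a fixed compact set, implies
convergence of the values of a functional. -/
theorem tendsto_apply_of_uniform {r : ℕ} (T : DistrOfOrder d r) {ι : Type*} {u : Filter ι}
    (g : ι → TestOfOrder d r) (g₀ : TestOfOrder d r) {K : Set (Space d)} (hK : IsCompact K)
    (hg : ∀ᶠ n in u, ∀ y, y ∉ K → g n y = 0) (hg₀ : ∀ y, y ∉ K → g₀ y = 0)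
    (h : ∀ ε > 0, ∀ᶠ n in u, ∀ l, deg l ≤ r → ∀ y,
      |mderiv l (g n) y - mderiv l g₀ y| ≤ ε) :
    Tendsto (fun n => T (g n)) u (𝓝 (T g₀)) := by
  classical
  let KK : Compacts (Space d) := ⟨K, hK⟩
  have hKtop : (KK : Set (Space d)) ⊆ ((⊤ : Opens (Space d)) : Set (Space d)) := fun _ _ => trivial
  -- The value `0` for functions not supported in `K` is harmless, since the functions `g n` are
  -- eventually supported there. In the space attached to the fixed compact set `K`, convergence is
  -- governed by seminorms.
  let lift : TestOfOrder d r → ContDiffMapSupportedIn (Space d) ℝ (r : ℕ∞) KK := fun f =>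
    if hf : ∀ y, y ∉ K → f y = 0 then ⟨f, f.contDiff, fun y hy => hf y hy⟩ else 0
  have hlift : ∀ f : TestOfOrder d r, (∀ y, y ∉ K → f y = 0) →
      TestFunction.ofSupportedIn hKtop (lift f) = f := by
    intro f hf
    ext y
    simp only [lift, dif_pos hf]
    rfl
  have hliftc : ∀ f : TestOfOrder d r, (∀ y, y ∉ K → f y = 0) → (lift f : Space d → ℝ) = f := by
    intro f hf
    simp only [lift, dif_pos hf]
    rfl
  have hcont : Continuous fun f : ContDiffMapSupportedIn (Space d) ℝ (r : ℕ∞) KK =>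
      T (TestFunction.ofSupportedIn hKtop f) :=
    T.continuous.comp (TestFunction.continuous_ofSupportedIn hKtop)
  have hlim : Tendsto (fun n => lift (g n)) u (𝓝 (lift g₀)) := by
    rw [(ContDiffMapSupportedIn.withSeminorms ℝ (Space d) ℝ (r : ℕ∞) KK).tendsto_nhds]
    intro i ε hε
    have hpos : 0 < ε / (2 * ((d : ℝ) ^ i + 1)) := by positivity
    filter_upwards [hg, h _ hpos] with n hn hn'
    refine lt_of_le_of_lt ?_ (half_lt_self hε)
    rw [ContDiffMapSupportedIn.seminorm_le_iff ℝ (by positivity)]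
    intro hi x _
    have hi' : i ≤ r := by exact_mod_cast hi
    have hJ : IsJet r fun l y => mderiv l (g n) y - mderiv l g₀ y :=
      (isJet_mderiv (g n).contDiff).sub (isJet_mderiv g₀.contDiff)
    have h3 := hJ.norm_iteratedFDeriv_le (l := 0) (n := i) (by simpa using hi') x
      (fun k hk => hn' (0 + k) (by simpa [hk] using hi') x)
    have h4 : ((lift (g n) - lift g₀ : ContDiffMapSupportedIn (Space d) ℝ (r : ℕ∞) KK) :
        Space d → ℝ) = fun y => mderiv 0 (g n) y - mderiv 0 g₀ y := by
      funext y
      rw [mderiv_zero, mderiv_zero]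
      change lift (g n) y - lift g₀ y = _
      rw [hliftc _ hn, hliftc _ hg₀]
    rw [h4]
    refine h3.trans ?_
    have hd : (0:ℝ) < (d : ℝ) ^ i + 1 := by positivity
    calc (d : ℝ) ^ i * (ε / (2 * ((d : ℝ) ^ i + 1)))
        ≤ ((d : ℝ) ^ i + 1) * (ε / (2 * ((d : ℝ) ^ i + 1))) := by gcongr; linarith
      _ = ε / 2 := by field_simp
  have h5 := (hcont.tendsto (lift g₀)).comp hlim
  rw [hlift g₀ hg₀] at h5
  refine h5.congr' ?_
  filter_upwards [hg] with n hn
  simp only [Function.comp, hlift _ hn]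

theorem hasCompactSupport_of_closedBall {g : Space d → ℝ} {x : Space d} {s : ℝ}
    (h : ∀ y, y ∉ Metric.closedBall x s → g y = 0) : HasCompactSupport g :=
  HasCompactSupport.intro (isCompact_closedBall x s) fun y hy => h y hy

/-- A functional of finite order is determined by its values on mollifications. -/
theorem tendsto_extension_moll {r : ℕ} {T : Distr d} {T' : DistrOfOrder d r}
    (hT : IsExtension r T T') (g : TestOfOrder d r) :
    Tendsto (fun n => T (mollTest n g)) atTop (𝓝 (T' g)) := by
  have h1 : ∀ n, T (mollTest n g) = T' (TestFunction.monoCLM ℝ (mollTest n g)) :=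
    fun n => (hT _).symm
  simp only [h1]
  obtain ⟨s, hs⟩ := g.hasCompactSupport.isCompact.isBounded.subset_closedBall (0 : Space d)
  have hg : ∀ y, y ∉ Metric.closedBall (0 : Space d) s → g y = 0 := fun y hy =>
    image_eq_zero_of_notMem_tsupport fun h => hy (hs h)
  refine tendsto_apply_of_uniform T' _ g (isCompact_closedBall (0 : Space d) (s + 1)) ?_ ?_ ?_
  · refine Eventually.of_forall fun n y hy => ?_
    rw [monoCLM_coe, coe_mollTest]
    refine moll_eq_zero g.continuous n hg fun h => hy ?_
    refine Metric.closedBall_subset_closedBall ?_ h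
    gcongr
    rw [div_le_one (by positivity)]
    linarith [n.cast_nonneg (α := ℝ)]
  · intro y hy
    exact hg y fun h => hy (Metric.closedBall_subset_closedBall (by linarith) h)
  · intro ε hε
    have hJ := isJet_mderiv g.contDiff
    filter_upwards [exists_uniform_moll_close hJ (by simpa using g.hasCompactSupport) hε]
      with n hn l hl y
    rw [monoCLM_coe, coe_mollTest]
    have := (hJ.moll n).mderiv_zero_eq hl
    simp only [mderiv_zero] at this
    rw [this]
    exact hn l hl y

/-! ### Rescaled test functions -/

theorem coe_scale (φ : Test d) (x : Space d) {ε : ℝ} (hε : 0 < ε) :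
    (scale φ x ε : Space d → ℝ) = fun y => (ε⁻¹) ^ d * φ (ε⁻¹ • (y - x)) :=
  funext fun y => scale_apply φ x hε y

theorem mderiv_scale (φ : Test d) (x : Space d) {ε : ℝ} (hε : 0 < ε) (l : Fin d → ℕ)
    (y : Space d) :
    mderiv l (scale φ x ε) y = (ε⁻¹) ^ (d + deg l) * mderiv l φ (ε⁻¹ • (y - x)) := by
  have h := (((isJet_test φ (deg l)).comp_smul_sub ε⁻¹ x).const_mul (ε⁻¹ ^ d)).mderiv_zero_eq
    (k := l) le_rfl
  simp only [deg_zero, pow_zero, one_mul, mderiv_zero] at h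
  rw [coe_scale φ x hε, h, pow_add, mul_assoc]

theorem mderiv_const_smul (c : ℝ) (φ : Test d) (l : Fin d → ℕ) (y : Space d) :
    mderiv l (⇑(c • φ)) y = c * mderiv l φ y := by
  have h := ((isJet_test φ (deg l)).const_mul c).mderiv_zero_eq (k := l) le_rfl
  simp only [mderiv_zero] at h
  exact congrFun h y

theorem scale_add (φ ψ : Test d) (x : Space d) (ε : ℝ) :
    scale (φ + ψ) x ε = scale φ x ε + scale ψ x ε := by
  by_cases hε : 0 < ε
  · ext y
    change scale (φ + ψ) x ε y = scale φ x ε y + scale ψ x ε y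
    simp only [scale_apply _ x hε]
    change _ * (φ _ + ψ _) = _
    ring
  · simp [scale, hε]

theorem scale_smul (c : ℝ) (φ : Test d) (x : Space d) (ε : ℝ) :
    scale (c • φ) x ε = c • scale φ x ε := by
  by_cases hε : 0 < ε
  · ext y
    change scale (c • φ) x ε y = c * scale φ x ε y
    simp only [scale_apply _ x hε]
    change _ * (c * φ _) = _
    ring
  · simp [scale, hε]

/-- The rescaling that undoes `scale · x ε`. -/
noncomputable def unscale (φ : Test d) (x : Space d) (ε : ℝ) : Test d :=
  scale φ (-(ε⁻¹ • x)) ε⁻¹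

theorem unscale_apply (φ : Test d) (x : Space d) {ε : ℝ} (hε : 0 < ε) (w : Space d) :
    unscale φ x ε w = ε ^ d * φ (x + ε • w) := by
  rw [unscale, scale_apply _ _ (inv_pos.2 hε), inv_inv]
  congr 2
  rw [sub_neg_eq_add, smul_add, smul_smul, mul_inv_cancel₀ hε.ne', one_smul, add_comm]

theorem mderiv_unscale (φ : Test d) (x : Space d) {ε : ℝ} (hε : 0 < ε) (l : Fin d → ℕ)
    (w : Space d) : mderiv l (unscale φ x ε) w = ε ^ (d + deg l) * mderiv l φ (x + ε • w) := by
  rw [unscale, mderiv_scale _ _ (inv_pos.2 hε), inv_inv]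
  congr 2
  rw [sub_neg_eq_add, smul_add, smul_smul, mul_inv_cancel₀ hε.ne', one_smul, add_comm]

theorem scale_unscale (φ : Test d) (x : Space d) {ε : ℝ} (hε : 0 < ε) :
    scale (unscale φ x ε) x ε = φ := by
  ext y
  rw [scale_apply _ _ hε, unscale_apply _ _ hε, ← mul_assoc, ← mul_pow,
    inv_mul_cancel₀ hε.ne', one_pow, one_mul, smul_smul, mul_inv_cancel₀ hε.ne', one_smul]
  congr 1
  abel

theorem mem_unitTest_iff {r : ℕ} {φ : Test d} : φ ∈ unitTest d r ↔
    (∀ y, y ∉ Metric.closedBall (0 : Space d) 1 → φ y = 0) ∧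
      ∀ k, deg k ≤ r → ∀ z, |mderiv k φ z| ≤ 1 := by
  simp only [unitTest, mem_ofPred_eq, testDeriv_apply]
  refine and_congr_left' ⟨fun h y hy => image_eq_zero_of_notMem_tsupport fun h' => hy (h h'),
    fun h => closure_minimal (fun y hy => ?_) Metric.isClosed_closedBall⟩
  by_contra hc
  exact hy (h y hc)

theorem zero_mem_unitTest (r : ℕ) : (0 : Test d) ∈ unitTest d r := by
  rw [mem_unitTest_iff]
  refine ⟨fun _ _ => rfl, fun k _ z => ?_⟩
  have := mderiv_const_smul (0:ℝ) (0 : Test d) k z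
  rw [zero_smul, zero_mul] at this
  rw [this]; simp

/-- A bound on rescaled test functions at one scale gives a bound on all test functions supported
in the ball of that scale. -/
theorem abs_apply_le_of_scale {T : Distr d} {r : ℕ} {x : Space d} {lam B M : ℝ} (hlam : 0 < lam)
    (hM : 0 ≤ M) (hB : ∀ ψ ∈ unitTest d r, |T (scale ψ x lam)| ≤ B) (φ : Test d)
    (hs : ∀ y, y ∉ Metric.closedBall x lam → φ y = 0)
    (hφ : ∀ l, deg l ≤ r → ∀ y, |mderiv l φ y| ≤ M * (lam⁻¹) ^ (d + deg l)) :
    |T φ| ≤ M * B := by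
  have hB0 : 0 ≤ B := by
    simpa using (abs_nonneg _).trans (hB 0 (zero_mem_unitTest r))
  have key : ∀ M' : ℝ, 0 < M' → M ≤ M' → |T φ| ≤ M' * B := by
    intro M' hM' hMM'
    have hmem : M'⁻¹ • unscale φ x lam ∈ unitTest d r := by
      rw [mem_unitTest_iff]
      constructor
      · intro y hy
        change M'⁻¹ * unscale φ x lam y = 0
        rw [unscale_apply _ _ hlam, hs, mul_zero, mul_zero]
        rw [mem_closedBall_iff_norm, add_sub_cancel_left, norm_smul, Real.norm_eq_abs,
          abs_of_pos hlam]
        rw [mem_closedBall_zero_iff] at hy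
        push Not at hy ⊢
        nlinarith
      · intro k hk z
        rw [mderiv_const_smul, mderiv_unscale _ _ hlam, abs_mul, abs_mul, abs_of_pos
          (inv_pos.2 hM'), abs_of_pos (pow_pos hlam _)]
        calc M'⁻¹ * (lam ^ (d + deg k) * |mderiv k φ (x + lam • z)|)
            ≤ M'⁻¹ * (lam ^ (d + deg k) * (M' * (lam⁻¹) ^ (d + deg k))) := by
              gcongr
              exact (hφ k hk _).trans (by gcongr)
          _ = 1 := by
              rw [inv_pow]; field_simp
    have h := hB _ hmem
    rw [scale_smul, scale_unscale _ _ hlam, map_smul, smul_eq_mul, abs_mul,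
      abs_of_pos (inv_pos.2 hM')] at h
    rwa [inv_mul_le_iff₀ hM'] at h
  -- The test function cannot be normalised by `M = 0`; that case is the limit of arbitrarily small
  -- positive constants.
  rcases hM.eq_or_lt with rfl | hM
  · rw [zero_mul]
    refine le_of_forall_pos_le_add fun ε hε => ?_
    have h := key (ε / (B + 1)) (by positivity) (by positivity)
    refine h.trans ?_
    rw [zero_add, div_mul_eq_mul_div, div_le_iff₀ (by positivity)]
    nlinarith
  · exact key M hM le_rfl

/-- Bounds on rescaled test functions extend to functions of finite regularity. -/
theorem abs_extension_le {T : Distr d} {r s : ℕ} (hrs : r ≤ s) {T' : DistrOfOrder d s}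
    (hT : IsExtension s T T') {x : Space d} {σ lam B M : ℝ} (hσ : σ < lam) (hlam : 0 < lam)
    (hM : 0 ≤ M) (hB : ∀ ψ ∈ unitTest d r, |T (scale ψ x lam)| ≤ B)
    {J : (Fin d → ℕ) → Space d → ℝ} (hJ : IsJet s J)
    (hs : ∀ y, y ∉ Metric.closedBall x σ → J 0 y = 0)
    (hφ : ∀ l, deg l ≤ r → ∀ y, |J l y| ≤ M * (lam⁻¹) ^ (d + deg l)) :
    |T' (toTest s (J 0))| ≤ M * B := by
  have hcd : ContDiff ℝ s (J 0) := hJ.contDiff (by simp)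
  have hcs := hasCompactSupport_of_closedBall hs
  refine le_of_tendsto (tendsto_extension_moll hT _).abs ?_
  -- Mollification enlarges supports by `1 / (n + 1)`; the gap `lam - σ` leaves room for this.
  obtain ⟨n₀, hn₀⟩ := exists_nat_one_div_lt (sub_pos.2 hσ)
  filter_upwards [eventually_ge_atTop n₀] with n hn
  have hn1 : 1 / ((n : ℝ) + 1) ≤ lam - σ := by
    refine le_trans ?_ hn₀.le
    apply one_div_le_one_div_of_le (by positivity)
    have : (n₀ : ℝ) ≤ n := by exact_mod_cast hn
    linarith
  refine abs_apply_le_of_scale hlam hM hB _ ?_ ?_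
  · intro y hy
    rw [coe_mollTest, toTest_apply hcd hcs]
    exact moll_eq_zero (hJ.cont 0 (by simp)) n hs fun h =>
      hy (Metric.closedBall_subset_closedBall (by linarith) h)
  · intro l hl y
    rw [coe_mollTest, toTest_apply hcd hcs, (hJ.moll n).mderiv_zero_eq (hl.trans hrs)]
    exact abs_moll_le (hJ.cont l (hl.trans hrs)) n y (hφ l hl)

/-! ### Existence of extensions -/

theorem le_mul_pow_inv_pow {lam N : ℝ} (hlam : 1 ≤ lam) (hN : 0 ≤ N) {k l : ℕ} (h : l ≤ k) :
    N ≤ (N * lam ^ k) * (lam⁻¹) ^ l := by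
  have h0 : 0 < lam := by linarith
  rw [inv_pow, mul_assoc, ← div_eq_mul_inv]
  refine le_mul_of_one_le_right hN ?_
  rw [le_div_iff₀ (by positivity), one_mul]
  exact pow_le_pow_right₀ hlam h

theorem abs_sub_le_of_close {T : Distr d} {r : ℕ} {x : Space d} {lam B η : ℝ} (hlam : 1 ≤ lam)
    (hη : 0 ≤ η) (hB : ∀ ψ ∈ unitTest d r, |T (scale ψ x lam)| ≤ B) {φ ψ : Test d}
    (hφ : ∀ y, y ∉ Metric.closedBall x lam → φ y = 0)
    (hψ : ∀ y, y ∉ Metric.closedBall x lam → ψ y = 0)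
    (h : ∀ l, deg l ≤ r → ∀ y, |mderiv l φ y - mderiv l ψ y| ≤ η) :
    |T φ - T ψ| ≤ η * lam ^ (d + r) * B := by
  rw [← map_sub]
  refine abs_apply_le_of_scale (by linarith) (by positivity) hB _ ?_ ?_
  · intro y hy
    change φ y - ψ y = 0
    rw [hφ y hy, hψ y hy, sub_zero]
  · intro l hl y
    have h2 := ((isJet_test φ r).sub (isJet_test ψ r)).mderiv_zero_eq hl
    simp only [mderiv_zero] at h2
    have h1 : mderiv l (⇑(φ - ψ)) y = mderiv l φ y - mderiv l ψ y := congrFun h2 y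
    rw [h1]
    exact (h l hl y).trans (le_mul_pow_inv_pow hlam hη (by omega))

/-- Two late mollifications of `g` are `C^r`-close and supported in one fixed ball around `x`, where
the bound at a single scale `lam` controls `T`. The limit is the value of the extension of `T` at
`g`. -/
theorem cauchySeq_mollTest {T : Distr d} {r s : ℕ} (hrs : r ≤ s) {x : Space d}
    (hT : ∀ lam : ℝ, 1 ≤ lam → ∃ B, ∀ ψ ∈ unitTest d r, |T (scale ψ x lam)| ≤ B)
    (g : TestOfOrder d s) : CauchySeq fun n => T (mollTest n g) := by
  obtain ⟨σ, hσ⟩ := g.hasCompactSupport.isCompact.isBounded.subset_closedBall x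
  have hg : ∀ y, y ∉ Metric.closedBall x σ → g y = 0 := fun y hy =>
    image_eq_zero_of_notMem_tsupport fun h => hy (hσ h)
  set lam := max 1 (σ + 1) with hlam
  have hlam1 : 1 ≤ lam := le_max_left _ _
  obtain ⟨B, hB⟩ := hT lam hlam1
  have hB0 : 0 ≤ B := by
    simpa using (abs_nonneg _).trans (hB 0 (zero_mem_unitTest r))
  have hJ := isJet_mderiv g.contDiff
  rw [Metric.cauchySeq_iff]
  intro ε hε
  set η := ε / (4 * (lam ^ (d + r) * (B + 1))) with hη
  have hη0 : 0 < η := by positivity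
  obtain ⟨N, hN⟩ := eventually_atTop.1
    (exists_uniform_moll_close hJ (by simpa using g.hasCompactSupport) hη0)
  refine ⟨N, fun m hm n hn => ?_⟩
  rw [Real.dist_eq]
  have hz : ∀ n y, y ∉ Metric.closedBall x lam → moll n g y = 0 := by
    intro n y hy
    refine moll_eq_zero g.continuous n hg fun h => hy (Metric.closedBall_subset_closedBall ?_ h)
    refine le_trans ?_ (le_max_right _ _)
    gcongr
    rw [div_le_one (by positivity)]
    linarith [n.cast_nonneg (α := ℝ)]
  have hder : ∀ l, deg l ≤ r → ∀ n y, mderiv l (moll n g) y = moll n (mderiv l g) y := by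
    intro l hl n y
    have := (hJ.moll n).mderiv_zero_eq (hl.trans hrs)
    simp only [mderiv_zero] at this
    rw [this]
  have h := abs_sub_le_of_close (T := T) (r := r) (η := 2 * η) (φ := mollTest m g)
    (ψ := mollTest n g) hlam1 (by positivity) hB (hz m) (hz n) ?_
  · refine lt_of_le_of_lt h ?_
    have : 2 * η * lam ^ (d + r) * B < 2 * η * lam ^ (d + r) * (2 * (B + 1)) := by
      gcongr; linarith
    refine this.trans_eq ?_
    rw [hη]; field_simp; norm_num
  · intro l hl y
    rw [coe_mollTest, coe_mollTest, hder l hl, hder l hl]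
    have h3 := abs_sub_le (moll m (mderiv l g) y) (mderiv l g y) (moll n (mderiv l g) y)
    have h4 := hN m hm l (hl.trans hrs) y
    have h5 := hN n hn l (hl.trans hrs) y
    rw [abs_sub_comm (mderiv l g y)] at h3
    linarith

theorem abs_mollTest_le {T : Distr d} {r s : ℕ} (hrs : r ≤ s) {x : Space d} {σ lam B N : ℝ}
    (hlam : 1 ≤ lam) (hσ : σ + 1 ≤ lam) (hB : ∀ ψ ∈ unitTest d r, |T (scale ψ x lam)| ≤ B)
    (hN : 0 ≤ N) (g : TestOfOrder d s) (hg : ∀ y, y ∉ Metric.closedBall x σ → g y = 0)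
    (hgN : ∀ l, deg l ≤ r → ∀ y, |mderiv l g y| ≤ N) (n : ℕ) :
    |T (mollTest n g)| ≤ N * lam ^ (d + r) * B := by
  have hJ := isJet_mderiv g.contDiff
  refine abs_apply_le_of_scale (by linarith) (by positivity) hB _ ?_ ?_
  · intro y hy
    refine moll_eq_zero g.continuous n hg fun h => hy (Metric.closedBall_subset_closedBall ?_ h)
    refine le_trans ?_ hσ
    gcongr
    rw [div_le_one (by positivity)]
    linarith [n.cast_nonneg (α := ℝ)]
  · intro l hl y
    refine le_trans ?_ (le_mul_pow_inv_pow hlam hN (by omega))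
    have := (hJ.moll n).mderiv_zero_eq (hl.trans hrs)
    simp only [mderiv_zero] at this
    rw [coe_mollTest, this]
    exact abs_moll_le (hJ.cont l (hl.trans hrs)) n y (hgN l hl)

/-- A distribution that is bounded on rescaled test functions of order `r` around a point
extends to compactly supported functions of class `C^s`, for `s ≥ r`. -/
theorem exists_isExtension {T : Distr d} {r s : ℕ} (hrs : r ≤ s) {x : Space d}
    (hT : ∀ lam : ℝ, 1 ≤ lam → ∃ B, ∀ ψ ∈ unitTest d r, |T (scale ψ x lam)| ≤ B) :
    ∃ T' : DistrOfOrder d s, IsExtension s T T' := by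
  choose A hA using fun g : TestOfOrder d s =>
    cauchySeq_tendsto_of_complete (cauchySeq_mollTest hrs hT g)
  have hadd : ∀ f g, A (f + g) = A f + A g := fun f g =>
    tendsto_nhds_unique (hA (f + g)) (((hA f).add (hA g)).congr fun n => by
      rw [mollTest_add, map_add])
  have hsmul : ∀ (c : ℝ) f, A (c • f) = c * A f := fun c f =>
    tendsto_nhds_unique (hA (c • f)) (((hA f).const_mul c).congr fun n => by
      rw [mollTest_smul, map_smul, smul_eq_mul])
  -- Continuity on the inductive limit amounts to a seminorm bound on each space of functions
  -- supported in a fixed compact set; the bound is uniform in the mollification index and passes to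
  -- the limit.
  have hb : ∀ KK : Compacts (Space d), ∃ (t : Finset ℕ) (C : ℝ), 0 ≤ C ∧
      ∀ f : ContDiffMapSupportedIn (Space d) ℝ (s : ℕ∞) KK,
      ‖A (TestFunction.ofSupportedIn (Ω := ⊤) (fun _ _ => trivial) f)‖ ≤
        C * (t.sup fun i => ContDiffMapSupportedIn.seminorm ℝ (Space d) ℝ (s : ℕ∞) KK i) f := by
    intro KK
    obtain ⟨σ, hσ⟩ := KK.isCompact.isBounded.subset_closedBall x
    obtain ⟨B, hB⟩ := hT (max 1 (σ + 1)) (le_max_left _ _)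
    have hB0 : 0 ≤ B := by
      simpa using (abs_nonneg _).trans (hB 0 (zero_mem_unitTest r))
    refine ⟨Finset.range (s + 1), (max 1 (σ + 1)) ^ (d + r) * B, by positivity, fun f => ?_⟩
    refine le_of_tendsto (hA _).abs (Eventually.of_forall fun n => ?_)
    have h := abs_mollTest_le hrs (x := x) (σ := σ) (le_max_left 1 (σ + 1)) (le_max_right _ _) hB
      (N := (((Finset.range (s + 1)).sup fun i =>
        ContDiffMapSupportedIn.seminorm ℝ (Space d) ℝ (s : ℕ∞) KK i) f)) (apply_nonneg _ _)
      (TestFunction.ofSupportedIn (Ω := ⊤) (fun _ _ => trivial) f)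
      (fun y hy => f.zero_on_compl fun h => hy (hσ h)) ?_ n
    · refine h.trans_eq (by ring)
    · intro l hl y
      have h1 := (isJet_mderiv f.contDiff).abs_le_norm_iteratedFDeriv (l := 0) (k := l)
        (by simpa using hl.trans hrs) y
      rw [zero_add, mderiv_zero] at h1
      refine h1.trans ((ContDiffMapSupportedIn.norm_iteratedFDeriv_apply_le_seminorm ℝ
        (by exact_mod_cast hl.trans hrs)).trans ?_)
      have h2 : deg l ∈ Finset.range (s + 1) := Finset.mem_range.2 (by omega)
      exact Seminorm.le_def.1 (Finset.le_sup (f := fun i =>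
        ContDiffMapSupportedIn.seminorm ℝ (Space d) ℝ (s : ℕ∞) KK i) h2) f
  have hTK : ∀ KK : Compacts (Space d),
      ∃ L : ContDiffMapSupportedIn (Space d) ℝ (s : ℕ∞) KK →L[ℝ] ℝ,
        ∀ f, L f = A (TestFunction.ofSupportedIn (Ω := ⊤) (fun _ _ => trivial) f) := by
    intro KK
    let e : ContDiffMapSupportedIn (Space d) ℝ (s : ℕ∞) KK → TestOfOrder d s :=
      TestFunction.ofSupportedIn (Ω := ⊤) (fun _ _ => trivial)
    exact ⟨ContDiffMapSupportedIn.mkCLMtoNormedSpace ℝ (fun f => A (e f))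
      (fun f g => hadd (e f) (e g)) (fun c f => hsmul c (e f)) (hb KK), fun f => rfl⟩
  choose L hL using hTK
  refine ⟨TestFunction.limitCLM ℝ A (fun KK _ => L KK) (fun KK h f => (hL KK f).symm),
    fun φ => ?_⟩
  change A (TestFunction.monoCLM ℝ φ) = T φ
  refine tendsto_nhds_unique (hA _) ?_
  obtain ⟨σ, hσ⟩ := φ.hasCompactSupport.isCompact.isBounded.subset_closedBall x
  have hφ : ∀ y, y ∉ Metric.closedBall x σ → φ y = 0 := fun y hy =>
    image_eq_zero_of_notMem_tsupport fun h => hy (hσ h)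
  set lam := max 1 (σ + 1) with hlam
  have hlam1 : 1 ≤ lam := le_max_left _ _
  obtain ⟨B, hB⟩ := hT lam hlam1
  have hB0 : 0 ≤ B := by
    simpa using (abs_nonneg _).trans (hB 0 (zero_mem_unitTest r))
  rw [Metric.tendsto_atTop]
  intro ε hε
  have hη0 : 0 < ε / (lam ^ (d + r) * (B + 1)) := by positivity
  obtain ⟨N, hN⟩ := eventually_atTop.1
    (exists_uniform_moll_close (isJet_test φ r) (by simpa using φ.hasCompactSupport) hη0)
  refine ⟨N, fun n hn => ?_⟩
  rw [Real.dist_eq]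
  have hm : (mollTest n (TestFunction.monoCLM ℝ φ : TestOfOrder d s) : Space d → ℝ) = moll n φ := by
    rw [coe_mollTest, monoCLM_coe]
  refine (abs_sub_le_of_close hlam1 hη0.le hB ?_ ?_ ?_).trans_lt ?_
  · intro y hy
    rw [hm]
    refine moll_eq_zero φ.continuous n hφ fun h => hy (Metric.closedBall_subset_closedBall ?_ h)
    refine le_trans ?_ (le_max_right _ _)
    gcongr
    rw [div_le_one (by positivity)]
    linarith [n.cast_nonneg (α := ℝ)]
  · intro y hy
    refine hφ y fun h => hy (Metric.closedBall_subset_closedBall ?_ h)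
    exact le_trans (by linarith) (le_max_right _ _)
  · intro l hl y
    have := ((isJet_test φ r).moll n).mderiv_zero_eq hl
    simp only [mderiv_zero] at this
    rw [hm, this]
    exact hN n hn l hl y
  · calc _ < ε / (lam ^ (d + r) * (B + 1)) * lam ^ (d + r) * (B + 1) := by
          gcongr; linarith
      _ = ε := by field_simp

/-! ### Decomposition of test functions into test functions at a smaller scale -/

/-- The Leibniz rule for Fréchet derivatives. Only the derivatives of `f` up to the order of `l`
enter, so that one estimate serves the bound `1` up to order `r` and the bound `M` up to order `s`.
-/
theorem abs_mderiv_mul_le {f g : Space d → ℝ} (hf : ContDiff ℝ ∞ f) (hg : ContDiff ℝ ∞ g)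
    {n : ℕ} {w : Space d} {P Q : ℝ} (hP : ∀ l, deg l ≤ n → |mderiv l f w| ≤ P)
    (hQ : ∀ i ≤ n, ‖iteratedFDeriv ℝ i g w‖ ≤ Q) {l : Fin d → ℕ} (hl : deg l = n) :
    |mderiv l (fun y => f y * g y) w| ≤ (2 * (d + 1)) ^ n * P * Q := by
  have hP0 : 0 ≤ P := (abs_nonneg _).trans (hP 0 (by simp))
  have hQ0 : 0 ≤ Q := (norm_nonneg _).trans (hQ 0 (by simp))
  have h1 := (isJet_mderiv (r := n) (g := fun y => f y * g y)
    ((hf.mul hg).of_le (by exact_mod_cast le_top))).abs_le_norm_iteratedFDeriv (l := 0) (k := l)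
    (by simp [hl]) w
  rw [zero_add, mderiv_zero, hl] at h1
  refine h1.trans ((norm_iteratedFDeriv_mul_le hf hg w (by exact_mod_cast le_top)).trans ?_)
  have h2 : ∀ i ∈ Finset.range (n + 1), (n.choose i : ℝ) * ‖iteratedFDeriv ℝ i f w‖ *
      ‖iteratedFDeriv ℝ (n - i) g w‖ ≤ (n.choose i : ℝ) * ((d + 1) ^ n * P * Q) := by
    intro i hi
    have hi' : i ≤ n := Nat.lt_succ_iff.1 (Finset.mem_range.1 hi)
    have h3 := (isJet_mderiv (r := n) (g := f) (hf.of_le (by exact_mod_cast le_top))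
      ).norm_iteratedFDeriv_le (l := 0) (n := i) (by simpa using hi') w (M := P)
      (fun k hk => hP _ (by simpa [hk] using hi'))
    rw [mderiv_zero] at h3
    have h4 : (d : ℝ) ^ i ≤ (d + 1) ^ n := by
      calc (d : ℝ) ^ i ≤ (d + 1) ^ i := by gcongr; linarith
        _ ≤ _ := pow_le_pow_right₀ (by linarith [d.cast_nonneg (α := ℝ)]) hi'
    rw [mul_assoc]
    refine mul_le_mul_of_nonneg_left (mul_le_mul (h3.trans (by gcongr)) (hQ _ (by omega))
      (norm_nonneg _) (by positivity)) (by positivity)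
  refine (Finset.sum_le_sum h2).trans_eq ?_
  rw [← Finset.sum_mul]
  have : (∑ i ∈ Finset.range (n + 1), (n.choose i : ℝ)) = 2 ^ n := by
    exact_mod_cast Nat.sum_range_choose n
  rw [this, mul_pow]
  ring

/-- A smooth function on the line whose integer translates sum to one. -/
noncomputable def latticeBump₁ (t : ℝ) : ℝ := Real.smoothTransition (t + 1) - Real.smoothTransition t

/-- A smooth function whose translates by integer vectors sum to one. -/
noncomputable def latticeBump (z : Space d) : ℝ := ∏ i, latticeBump₁ (z i)

theorem latticeBump₁_eq_zero {t : ℝ} (ht : 1 < |t|) : latticeBump₁ t = 0 := by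
  rw [latticeBump₁]
  rcases lt_abs.1 ht with h | h
  · rw [Real.smoothTransition.one_of_one_le (by linarith),
      Real.smoothTransition.one_of_one_le h.le, sub_self]
  · rw [Real.smoothTransition.zero_of_nonpos (by linarith),
      Real.smoothTransition.zero_of_nonpos (by linarith), sub_self]

/-- The sum telescopes to the values of the smooth transition at `t + N + 1 ≥ 1` and at `t - N ≤ 0`.
-/
theorem sum_latticeBump₁ (N : ℕ) {t : ℝ} (ht : |t| ≤ N) :
    ∑ j ∈ Finset.range (2 * N + 1), latticeBump₁ (t - ((j : ℝ) - N)) = 1 := by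
  have h := Finset.sum_range_sub' (fun j : ℕ => Real.smoothTransition (t + N + 1 - j)) (2 * N + 1)
  have h2 : ∀ j : ℕ, latticeBump₁ (t - ((j : ℝ) - N)) = Real.smoothTransition (t + N + 1 - j) -
      Real.smoothTransition (t + N + 1 - (j + 1 : ℕ)) := by
    intro j
    rw [latticeBump₁]
    congr 2
    · ring
    · push_cast; ring
  rw [Finset.sum_congr rfl fun j _ => h2 j, h]
  rw [abs_le] at ht
  rw [Real.smoothTransition.one_of_one_le, Real.smoothTransition.zero_of_nonpos, sub_zero]
  · push_cast; linarith
  · push_cast; linarith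

theorem contDiff_latticeBump : ContDiff ℝ ∞ (latticeBump : Space d → ℝ) := by
  refine contDiff_prod fun i _ => ?_
  have h1 : ContDiff ℝ ∞ latticeBump₁ :=
    (Real.smoothTransition.contDiff.comp (contDiff_id.add contDiff_const)).sub
      Real.smoothTransition.contDiff
  exact h1.comp (coord i).contDiff

theorem norm_le_of_latticeBump_ne_zero {z : Space d} (h : latticeBump z ≠ 0) : ‖z‖ ≤ d + 1 := by
  have h1 : ∀ i, |z i| ≤ 1 := fun i => by
    by_contra! hc
    exact h (Finset.prod_eq_zero (Finset.mem_univ i) (latticeBump₁_eq_zero hc))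
  calc ‖z‖ = ‖∑ i, z i • unitVec i‖ := by rw [sum_smul_unitVec]
    _ ≤ ∑ i : Fin d, (1 : ℝ) := norm_sum_le_of_le _ fun i _ => by
        rw [norm_smul, norm_unitVec, mul_one]; exact h1 i
    _ ≤ d + 1 := by simp

/-- The rescaled lattice point `(k_i - N) / N`. -/
noncomputable def latticePoint (N : ℕ) (k : Fin d → ℕ) : Space d :=
  WithLp.toLp 2 fun i => ((k i : ℝ) - N) / N

theorem sum_latticeBump {N : ℕ} (hN : 0 < N) {y : Space d} (hy : ‖y‖ ≤ 1) :
    ∑ k ∈ Fintype.piFinset fun _ : Fin d => Finset.range (2 * N + 1),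
      latticeBump ((N : ℝ) • (y - latticePoint N k)) = 1 := by
  have hN' : (0:ℝ) < N := by exact_mod_cast hN
  have h := Finset.prod_univ_sum (fun _ : Fin d => Finset.range (2 * N + 1))
    (fun i j => latticeBump₁ (N * y i - ((j : ℝ) - N)))
  rw [Finset.prod_eq_one fun i _ => sum_latticeBump₁ N ?_] at h
  · rw [h]
    refine Finset.sum_congr rfl fun k _ => Finset.prod_congr rfl fun i _ => ?_
    congr 1
    simp [latticePoint]
    field_simp
  · rw [abs_mul, abs_of_pos hN']
    have := (abs_apply_le_norm y i).trans hy
    nlinarith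

/-- The product of a test function with a smooth function. -/
noncomputable def mulTest (g : Space d → ℝ) (hg : ContDiff ℝ ∞ g) (φ : Test d) : Test d :=
  ⟨fun y => φ y * g y, φ.contDiff.mul hg, φ.hasCompactSupport.mul_right, fun _ _ => trivial⟩

/-- Test functions supported in the unit ball, with derivatives of order at most `r` bounded by `1`
and derivatives of order at most `s` bounded by `M`. -/
def testClass (d r s : ℕ) (M : ℝ) : Set (Test d) :=
  {φ | φ ∈ unitTest d r ∧ ∀ k, deg k ≤ s → ∀ z, |mderiv k φ z| ≤ M}

theorem scale_scale (ψ : Test d) (q x : Space d) {mu lam : ℝ} (hmu : 0 < mu) (hlam : 0 < lam) :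
    scale (scale ψ q mu) x lam = scale ψ (x + lam • q) (mu * lam) := by
  ext y
  rw [scale_apply _ _ hlam, scale_apply _ _ hmu, scale_apply _ _ (by positivity)]
  rw [← mul_assoc, ← mul_pow, mul_inv, mul_comm lam⁻¹, mul_smul]
  congr 3
  rw [← sub_sub, smul_sub lam⁻¹ (y - x), smul_smul, inv_mul_cancel₀ hlam.ne', one_smul]

theorem scale_zero (x : Space d) (ε : ℝ) : scale (0 : Test d) x ε = 0 := by
  have := scale_smul (0:ℝ) (0 : Test d) x ε
  simpa using this

theorem scale_sum {ι : Type*} (s : Finset ι) (φ : ι → Test d) (x : Space d) (ε : ℝ) :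
    scale (∑ i ∈ s, φ i) x ε = ∑ i ∈ s, scale (φ i) x ε := by
  classical
  induction s using Finset.induction_on with
  | empty => simp [scale_zero]
  | insert a s ha ih => rw [Finset.sum_insert ha, Finset.sum_insert ha, scale_add, ih]

theorem test_sum_apply {ι : Type*} (s : Finset ι) (φ : ι → Test d) (y : Space d) :
    (∑ i ∈ s, φ i) y = ∑ i ∈ s, φ i y := by
  classical
  induction s using Finset.induction_on with
  | empty => rfl
  | insert a s ha ih =>
    rw [Finset.sum_insert ha, Finset.sum_insert ha, ← ih]
    rfl

/-- A smooth partition of unity on the lattice of mesh `1/N` cuts `φ` into pieces of radius `μ =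
(d+1)/N`. Rescaled to unit size and divided by `μ^d C₁`, every piece lies again in the same class.
The number `(3N)^d` of pieces and the weight `μ^d` compensate, so `C` depends neither on `N` nor on
`M`; both facts are essential for iterating. -/
theorem exists_decomposition_bound (d : ℕ) {r s : ℕ} (hrs : r ≤ s) : ∃ C : ℝ, 0 < C ∧
    ∀ N : ℕ, d + 1 ≤ N → ∀ M : ℝ, 1 ≤ M → ∀ (T : Distr d) (x : Space d) (lam X : ℝ), 0 < lam →
    0 ≤ X →
    (∀ c, ‖c - x‖ ≤ lam * (1 + (d + 1) / N) → ∀ ψ ∈ testClass d r s M,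
      |T (scale ψ c ((d + 1) / N * lam))| ≤ X) →
    ∀ φ ∈ testClass d r s M, |T (scale φ x lam)| ≤ C * X := by
  set χ : Space d → ℝ := fun w => latticeBump (((d : ℝ) + 1) • w) with hχ
  have hχc : ContDiff ℝ ∞ χ := contDiff_latticeBump.comp (contDiff_const_smul _)
  have hχs : HasCompactSupport χ := by
    refine hasCompactSupport_of_closedBall (x := 0) (s := 1) fun y hy => ?_
    by_contra hc
    have h1 := norm_le_of_latticeBump_ne_zero hc
    rw [norm_smul, Real.norm_eq_abs, abs_of_pos (by positivity)] at h1
    apply hy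
    rw [mem_closedBall_zero_iff]
    exact le_of_mul_le_mul_left (by linarith) (by positivity : (0:ℝ) < d + 1)
  obtain ⟨Q, hQ1, hQ⟩ : ∃ Q : ℝ, 1 ≤ Q ∧ ∀ i ≤ s, ∀ w, ‖iteratedFDeriv ℝ i χ w‖ ≤ Q := by
    have h1 : ∀ i, ∃ C, ∀ w, ‖iteratedFDeriv ℝ i χ w‖ ≤ C := fun i =>
      (hχc.continuous_iteratedFDeriv (m := i) (by exact_mod_cast le_top)
        ).bounded_above_of_compact_support (hχs.iteratedFDeriv i)
    choose C hC using h1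
    refine ⟨1 + ∑ i ∈ Finset.range (s + 1), |C i|, by
      linarith [Finset.sum_nonneg (s := Finset.range (s + 1)) fun i _ => abs_nonneg (C i)],
      fun i hi w => ?_⟩
    have := Finset.single_le_sum (f := fun i => |C i|) (fun i _ => abs_nonneg (C i))
      (Finset.mem_range.2 (Nat.lt_succ_of_le hi))
    linarith [hC i w, le_abs_self (C i)]
  set C₁ : ℝ := (2 * (d + 1)) ^ s * Q with hC₁
  have hC₁0 : 0 < C₁ := by positivity
  refine ⟨(3 * (d + 1)) ^ d * C₁, by positivity, ?_⟩
  intro N hN M hM T x lam X hlam hX hT φ hφ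
  have hN0 : (0:ℝ) < N := by
    have : 0 < N := by omega
    exact_mod_cast this
  set mu : ℝ := (d + 1) / N with hmu
  have hmu0 : 0 < mu := by positivity
  have hmu1 : mu ≤ 1 := by
    rw [hmu, div_le_one hN0]; exact_mod_cast hN
  have hNmu : (N : ℝ) * mu = d + 1 := by rw [hmu]; field_simp
  have hφ1 := mem_unitTest_iff.1 hφ.1
  let g : (Fin d → ℕ) → Space d → ℝ := fun k y =>
    latticeBump ((N : ℝ) • (y - latticePoint N k))
  have hg : ∀ k, ContDiff ℝ ∞ (g k) := fun k =>
    contDiff_latticeBump.comp ((contDiff_id.sub contDiff_const).const_smul (N : ℝ))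
  set K := Fintype.piFinset fun _ : Fin d => Finset.range (2 * N + 1) with hK
  have hdec : φ = ∑ k ∈ K, mulTest (g k) (hg k) φ := by
    ext y
    rw [test_sum_apply]
    change φ y = ∑ k ∈ K, φ y * g k y
    rw [← Finset.mul_sum]
    by_cases hy : ‖y‖ ≤ 1
    · rw [sum_latticeBump (by omega) hy, mul_one]
    · rw [hφ1.1 y (by rwa [mem_closedBall_zero_iff]), zero_mul]
  have hpiece : ∀ k, |T (scale (mulTest (g k) (hg k) φ) x lam)| ≤ mu ^ d * C₁ * X := by
    intro k
    by_cases hk : ‖latticePoint N k‖ ≤ 1 + mu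
    swap
    · have : mulTest (g k) (hg k) φ = 0 := by
        ext y
        change φ y * g k y = 0
        by_cases hy : ‖y‖ ≤ 1
        · have : g k y = 0 := by
            by_contra hc
            have h1 := norm_le_of_latticeBump_ne_zero hc
            rw [norm_smul, Real.norm_eq_abs, abs_of_pos hN0, ← hNmu] at h1
            have h2 := le_of_mul_le_mul_left h1 hN0
            have h3 := norm_sub_norm_le (latticePoint N k) y
            rw [norm_sub_rev] at h3
            apply hk; linarith
          rw [this, mul_zero]
        · rw [hφ1.1 y (by rwa [mem_closedBall_zero_iff]), zero_mul]
      rw [this, scale_zero, map_zero, abs_zero]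
      positivity
    set p := mulTest (g k) (hg k) φ with hp
    set q := latticePoint N k with hq
    have hu : ∀ w, p (q + mu • w) = φ (q + mu • w) * χ w := by
      intro w
      change φ (q + mu • w) * g k (q + mu • w) = _
      congr 1
      simp only [g, hχ]
      rw [← hq, add_sub_cancel_left, smul_smul, hNmu]
    -- Kept general in `P` and `n` because it is applied twice: with `P = 1` up to order `r` and
    -- with `P = M` up to order `s`. Zooming in by `μ ≤ 1` does not increase derivatives of `φ`, and
    -- the cutoff contributes `C₁`.
    have hder : ∀ (P : ℝ) (n : ℕ), n ≤ s → (∀ l, deg l ≤ n → ∀ z, |mderiv l φ z| ≤ P) →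
        ∀ l, deg l = n → ∀ w, |mderiv l (unscale p q mu) w| ≤ mu ^ d * C₁ * P := by
      intro P n hn hP l hl w
      have hP0 : 0 ≤ P := (abs_nonneg _).trans (hP 0 (by simp) 0)
      have hj := (isJet_test φ n).comp_smul_sub mu (-(mu⁻¹ • q))
      have hsub : ∀ w, mu • (w - -(mu⁻¹ • q)) = q + mu • w := by
        intro w
        rw [sub_neg_eq_add, smul_add, smul_smul, mul_inv_cancel₀ hmu0.ne', one_smul, add_comm]
      simp only [hsub] at hj
      have h1 := abs_mderiv_mul_le (f := fun w => φ (q + mu • w)) (g := χ) (w := w)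
        (n := n) (P := P) (Q := Q)
        (φ.contDiff.comp (contDiff_const.add (contDiff_const_smul _))) hχc ?_
        (fun i hi => hQ i (hi.trans hn) w) hl
      · have h2 := ((isJet_mderiv (r := n) (g := fun w => φ (q + mu • w) * χ w)
          (((φ.contDiff.comp (contDiff_const.add (contDiff_const_smul _))).mul hχc).of_le
            (by exact_mod_cast le_top))).const_mul (mu ^ d)).mderiv_zero_eq hl.le
        simp only [mderiv_zero] at h2
        have h3 : (unscale p q mu : Space d → ℝ) = fun w => mu ^ d * (φ (q + mu • w) * χ w) := by
          funext w
          rw [unscale_apply _ _ hmu0, hu]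
        rw [h3, h2, abs_mul, abs_of_pos (by positivity), mul_assoc]
        gcongr
        refine h1.trans ?_
        rw [hC₁, mul_right_comm]
        have : (2 * ((d:ℝ) + 1)) ^ n ≤ (2 * (d + 1)) ^ s :=
          pow_le_pow_right₀ (by linarith [d.cast_nonneg (α := ℝ)]) hn
        gcongr
      · intro l' hl'
        have h4 := hj.mderiv_zero_eq hl'
        simp only [deg_zero, pow_zero, one_mul, mderiv_zero] at h4
        rw [h4, abs_mul, abs_of_pos (pow_pos hmu0 _)]
        calc _ ≤ 1 * P := by
              gcongr
              · exact pow_le_one₀ hmu0.le hmu1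
              · exact hP l' hl' _
          _ = P := one_mul P
    set ψ := (mu ^ d * C₁)⁻¹ • unscale p q mu with hψ
    have hc0 : 0 < mu ^ d * C₁ := by positivity
    have hψmem : ψ ∈ testClass d r s M := by
      have hb : ∀ (P : ℝ) (n : ℕ), n ≤ s → (∀ l, deg l ≤ n → ∀ z, |mderiv l φ z| ≤ P) →
        ∀ l, deg l = n → ∀ w, |mderiv l ψ w| ≤ P := by
        intro P n hn hP l hl w
        rw [hψ, mderiv_const_smul, abs_mul, abs_of_pos (inv_pos.2 hc0), inv_mul_le_iff₀ hc0]
        exact hder P n hn hP l hl w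
      refine ⟨mem_unitTest_iff.2 ⟨fun w hw => ?_, fun l hl w => ?_⟩, fun l hl w => ?_⟩
      · change (mu ^ d * C₁)⁻¹ * unscale p q mu w = 0
        rw [unscale_apply _ _ hmu0, hu]
        have : χ w = 0 := by
          by_contra hc
          have h1 := norm_le_of_latticeBump_ne_zero hc
          rw [norm_smul, Real.norm_eq_abs, abs_of_pos (by positivity)] at h1
          apply hw
          rw [mem_closedBall_zero_iff]
          exact le_of_mul_le_mul_left (by linarith) (by positivity : (0:ℝ) < d + 1)
        rw [this]; ring
      · exact hb 1 (deg l) (hl.trans hrs) (fun l' hl' => hφ1.2 l' (hl'.trans hl)) l rfl w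
      · exact hb M (deg l) hl (fun l' hl' => hφ.2 l' (hl'.trans hl)) l rfl w
    have hp2 : scale p x lam = (mu ^ d * C₁) • scale ψ (x + lam • q) (mu * lam) := by
      rw [← scale_scale _ _ _ hmu0 hlam, ← scale_smul, ← scale_smul, hψ, smul_smul,
        mul_inv_cancel₀ hc0.ne', one_smul, scale_unscale _ _ hmu0]
    rw [hp2, map_smul, smul_eq_mul, abs_mul, abs_of_pos hc0]
    gcongr
    refine hT _ ?_ ψ hψmem
    rw [add_sub_cancel_left, norm_smul, Real.norm_eq_abs, abs_of_pos hlam]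
    gcongr
  rw [hdec, scale_sum, map_sum]
  refine (Finset.abs_sum_le_sum_abs _ _).trans ((Finset.sum_le_sum fun k _ => hpiece k).trans ?_)
  have hcard : (K.card : ℝ) ≤ (3 * N) ^ d := by
    rw [hK, Fintype.card_piFinset]
    simp only [Finset.card_range, Finset.prod_const, Finset.card_univ, Fintype.card_fin]
    push_cast
    gcongr
    have : (1:ℝ) ≤ N := by
      have : 1 ≤ N := by omega
      exact_mod_cast this
    linarith
  rw [Finset.sum_const, nsmul_eq_mul]
  calc (K.card : ℝ) * (mu ^ d * C₁ * X) ≤ (3 * N) ^ d * (mu ^ d * C₁ * X) := by gcongr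
    _ = (3 * (N * mu)) ^ d * C₁ * X := by rw [← mul_assoc, ← mul_assoc, ← mul_pow, mul_assoc 3]
    _ = _ := by rw [hNmu]

/-! ### Homogeneity of reconstruction errors -/

/-- A bound on the scale-invariant part of the cone with vertex `x₀`. -/
def ConeBound (G : Space d → Distr d) (γ : ℝ) (𝓕 : Set (Test d)) (Λ τ₁ : ℝ) (x₀ : Space d)
    (D : ℝ) : Prop :=
  ∀ y τ, 0 < τ → τ ≤ τ₁ → ‖y - x₀‖ ≤ (Λ + 1) * (1 - τ / Λ) → ∀ φ ∈ 𝓕,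
    |G y (scale φ y τ)| ≤ D * τ ^ γ

/-- Coherence bounds for differences of a family of distributions. -/
def CohBound (G : Space d → Distr d) (a γ : ℝ) (r : ℕ) (S : Set (Space d)) (Λ B : ℝ) : Prop :=
  ∀ x ∈ S, ∀ y ∈ S, ∀ ε, 0 < ε → ε ≤ Λ → ∀ φ ∈ unitTest d r,
    |G y (scale φ x ε) - G x (scale φ x ε)| ≤ B * (ε ^ a * (‖y - x‖ + ε) ^ (γ - a))

/-- Homogeneity bounds for a family of distributions. -/
def HomBound (G : Space d → Distr d) (γ : ℝ) (r : ℕ) (S : Set (Space d)) (Λ D : ℝ) : Prop :=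
  ∀ x ∈ S, ∀ ε, 0 < ε → ε ≤ Λ → ∀ φ ∈ unitTest d r, |G x (scale φ x ε)| ≤ D * ε ^ γ

/-- One step of the contraction. Each piece, at scale `μτ` around `c`, is tested against `G_c` (the
assumed cone bound) and against `G_y - G_c` (coherence). The admissible base points shrink linearly
as the scale grows, which leaves room for moving from `y` to `c`. In the assumption scales up to `1`
suffice, in the conclusion they reach `Λ`, because `μΛ ≤ 1`. -/
theorem coneBound_step {r s : ℕ} {C₀ : ℝ} {N : ℕ} (hN : d + 1 ≤ N) {M : ℝ}
    (hdec : ∀ (T : Distr d) (x : Space d) (lam X : ℝ), 0 < lam → 0 ≤ X →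
      (∀ c, ‖c - x‖ ≤ lam * (1 + (d + 1) / N) → ∀ ψ ∈ testClass d r s M,
        |T (scale ψ c ((d + 1) / N * lam))| ≤ X) →
      ∀ φ ∈ testClass d r s M, |T (scale φ x lam)| ≤ C₀ * X)
    {a γ Λ B D : ℝ} (haγ : a < γ) (hΛ : 1 ≤ Λ) (hB : 0 ≤ B) (hD : 0 ≤ D)
    (hN1 : ((d : ℝ) + 1) / N * (2 * Λ + 1) ≤ 1) {G : Space d → Distr d} {x₀ : Space d}
    (hcoh : CohBound G a γ r (Metric.closedBall x₀ (Λ + 1)) Λ B)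
    (h : ConeBound G γ (testClass d r s M) Λ 1 x₀ D) :
    ConeBound G γ (testClass d r s M) Λ Λ x₀
      (C₀ * (D * (((d : ℝ) + 1) / N) ^ γ + B * ((((d : ℝ) + 1) / N) ^ a * 3 ^ (γ - a)))) := by
  have hN0 : (0:ℝ) < N := by
    have : 0 < N := by omega
    exact_mod_cast this
  set mu : ℝ := (d + 1) / N with hmu
  have hmu0 : 0 < mu := by positivity
  have hmu1 : mu ≤ 1 := by nlinarith
  have hmuΛ : mu * Λ ≤ 1 := by nlinarith
  have hΛ0 : 0 < Λ := by linarith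
  intro y τ hτ hτΛ hy φ hφ
  have hcone : ∀ {z : Space d} {t : ℝ}, 0 < t → ‖z - x₀‖ ≤ (Λ + 1) * (1 - t / Λ) →
      z ∈ Metric.closedBall x₀ (Λ + 1) := by
    intro z t ht hz
    rw [mem_closedBall_iff_norm]
    refine hz.trans ?_
    have : 0 < t / Λ := by positivity
    nlinarith
  rw [mul_assoc]
  refine hdec (G y) y τ _ hτ (by positivity) (fun c hc ψ hψ => ?_) φ hφ
  have hmt : 0 < mu * τ := by positivity
  have hc0 : ‖c - x₀‖ ≤ (Λ + 1) * (1 - mu * τ / Λ) := by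
    have h1 := norm_add_le (c - y) (y - x₀)
    rw [sub_add_sub_cancel] at h1
    -- The displacement of the base point fits into the widening of the cone between the scales `τ`
    -- and `μτ`; this is equivalent to `μ (2Λ + 1) ≤ 1`.
    have h2 : τ * (1 + mu) ≤ (Λ + 1) * (τ / Λ) * (1 - mu) := by
      rw [mul_div_assoc', div_mul_eq_mul_div, le_div_iff₀ hΛ0]
      nlinarith
    have h3 : mu * τ / Λ = mu * (τ / Λ) := by ring
    rw [h3]
    nlinarith
  have h1 := h c (mu * τ) hmt (by nlinarith) hc0 ψ hψ
  have h2 := hcoh c (hcone hmt hc0) y (hcone hτ hy) (mu * τ) hmt (by nlinarith) ψ hψ.1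
  have h3 : ‖y - c‖ + mu * τ ≤ 3 * τ := by
    rw [norm_sub_rev]; nlinarith
  have h4 : (‖y - c‖ + mu * τ) ^ (γ - a) ≤ (3 * τ) ^ (γ - a) :=
    Real.rpow_le_rpow (by positivity) h3 (by linarith)
  have h5 : |G y (scale ψ c (mu * τ))| ≤
      D * (mu * τ) ^ γ + B * ((mu * τ) ^ a * (3 * τ) ^ (γ - a)) := by
    have h6 : |G y (scale ψ c (mu * τ))| ≤ |G c (scale ψ c (mu * τ))| +
        |G y (scale ψ c (mu * τ)) - G c (scale ψ c (mu * τ))| := by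
      have := abs_add_le (G c (scale ψ c (mu * τ)))
        (G y (scale ψ c (mu * τ)) - G c (scale ψ c (mu * τ)))
      rwa [add_sub_cancel] at this
    refine h6.trans (add_le_add h1 (h2.trans ?_))
    gcongr
  refine h5.trans_eq ?_
  rw [Real.mul_rpow hmu0.le hτ.le, Real.mul_rpow hmu0.le hτ.le,
    Real.mul_rpow (by norm_num) hτ.le]
  have : τ ^ γ = τ ^ a * τ ^ (γ - a) := by rw [← Real.rpow_add hτ]; congr 1; ring
  rw [this]; ring

theorem exists_lattice_scale (d : ℕ) {δ : ℝ} (hδ : 0 < δ) :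
    ∃ N : ℕ, d + 1 ≤ N ∧ ((d : ℝ) + 1) / N ≤ δ := by
  obtain ⟨N, hN⟩ := exists_nat_ge (((d : ℝ) + 1) / δ)
  refine ⟨N + (d + 1), by omega, ?_⟩
  rw [div_le_iff₀ (by positivity)]
  rw [div_le_iff₀ hδ] at hN
  push_cast
  nlinarith [d.cast_nonneg (α := ℝ)]

theorem exists_mem_testClass {r s : ℕ} {φ : Test d} (hφ : φ ∈ unitTest d r) :
    ∃ M : ℝ, 1 ≤ M ∧ φ ∈ testClass d r s M := by
  have h1 : ∀ k : Fin d → ℕ, ∃ C, ∀ z, |mderiv k φ z| ≤ C := by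
    intro k
    rw [← coe_testDeriv]
    obtain ⟨C, hC⟩ := (testDeriv k φ).continuous.bounded_above_of_compact_support
      (testDeriv k φ).hasCompactSupport
    exact ⟨C, hC⟩
  choose C hC using h1
  refine ⟨1 + ∑ k ∈ poly d ((s + 1 : ℕ) : ℝ), |C k|, ?_, hφ, fun k hk z => ?_⟩
  · linarith [Finset.sum_nonneg (s := poly d ((s + 1 : ℕ) : ℝ)) fun k _ => abs_nonneg (C k)]
  · have := Finset.single_le_sum (f := fun k => |C k|) (fun k _ => abs_nonneg (C k))
      ((mem_poly_nat (s + 1) k).2 (by omega))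
    linarith [hC k z, le_abs_self (C k)]

/-- A family of distributions that is coherent with exponent `γ > 0` and `γ`-homogeneous is
`γ`-homogeneous with a bound by the coherence constant. -/
theorem exists_homBound_of_coh (d : ℕ) {r s : ℕ} (hrs : r ≤ s) {a γ Λ : ℝ} (haγ : a < γ)
    (hγ : 0 < γ) (hΛ : 1 ≤ Λ) : ∃ C : ℝ, 0 < C ∧ ∀ (S : Set (Space d)) (G : Space d → Distr d)
      (B D : ℝ), 0 ≤ B → CohBound G a γ r (S + Metric.closedBall 0 (Λ + 1)) Λ B →
      HomBound G γ s (S + Metric.closedBall 0 (Λ + 1)) 1 D → HomBound G γ r S Λ (C * B) := by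
  obtain ⟨C₀, hC₀, hdec⟩ := exists_decomposition_bound d hrs
  -- The positivity of `γ` makes small `μ` contracting.
  obtain ⟨δ, hδ, hδ'⟩ : ∃ δ : ℝ, 0 < δ ∧ C₀ * δ ^ γ ≤ 1 / 2 := by
    refine ⟨(1 / (2 * C₀)) ^ (γ⁻¹), by positivity, ?_⟩
    rw [← Real.rpow_mul (by positivity), inv_mul_cancel₀ hγ.ne', Real.rpow_one]
    apply le_of_eq; field_simp
  obtain ⟨N, hN, hNδ⟩ := exists_lattice_scale d (δ := min δ (1 / (2 * Λ + 1)))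
    (lt_min hδ (by positivity))
  have hN0 : (0:ℝ) < N := by
    have : 0 < N := by omega
    exact_mod_cast this
  set mu : ℝ := (d + 1) / N with hmu
  have hmu0 : 0 < mu := by positivity
  have hN1 : mu * (2 * Λ + 1) ≤ 1 := by
    have := hNδ.trans (min_le_right _ _)
    rwa [le_div_iff₀ (by positivity)] at this
  have hmuγ : C₀ * mu ^ γ ≤ 1 / 2 := by
    refine le_trans ?_ hδ'
    gcongr
    exact hNδ.trans (min_le_left _ _)
  set C₁ := C₀ * (mu ^ a * 3 ^ (γ - a)) with hC₁
  have hC₁0 : 0 < C₁ := by positivity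
  refine ⟨2 * C₁, by positivity, fun S G B D hB hcoh hhom x hx ε hε hεΛ φ hφ => ?_⟩
  -- The a priori bound has order `s`, possibly larger than `r`. The constant `M` depends on `φ`,
  -- but it occurs only in the term that tends to zero under iteration.
  obtain ⟨M, hM1, hφM⟩ := exists_mem_testClass (s := s) hφ
  have hsub : Metric.closedBall x (Λ + 1) ⊆ S + Metric.closedBall 0 (Λ + 1) := by
    intro y hy
    refine ⟨x, hx, y - x, ?_, by simp⟩
    rwa [mem_closedBall_zero_iff, ← mem_closedBall_iff_norm]
  have hcoh' : CohBound G a γ r (Metric.closedBall x (Λ + 1)) Λ B :=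
    fun z hz y hy => hcoh z (hsub hz) y (hsub hy)
  have hΛ0 : 0 < Λ := by linarith
  have hbase : ConeBound G γ (testClass d r s M) Λ 1 x (|D| * M) := by
    intro y τ hτ hτ1 hy ψ hψ
    have hys : y ∈ S + Metric.closedBall 0 (Λ + 1) := by
      refine hsub ?_
      rw [mem_closedBall_iff_norm]
      refine hy.trans ?_
      have : 0 < τ / Λ := by positivity
      nlinarith
    have hM0 : 0 < M := by linarith
    have hmem : M⁻¹ • ψ ∈ unitTest d s := by
      rw [mem_unitTest_iff]
      refine ⟨fun w hw => ?_, fun k hk z => ?_⟩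
      · change M⁻¹ * ψ w = 0
        rw [(mem_unitTest_iff.1 hψ.1).1 w hw, mul_zero]
      · rw [mderiv_const_smul, abs_mul, abs_of_pos (inv_pos.2 hM0), inv_mul_le_iff₀ hM0, mul_one]
        exact hψ.2 k hk z
    have := hhom y hys τ hτ hτ1 _ hmem
    rw [scale_smul, map_smul, smul_eq_mul, abs_mul, abs_of_pos (inv_pos.2 hM0),
      inv_mul_le_iff₀ hM0] at this
    refine this.trans ?_
    have h1 : D * τ ^ γ ≤ |D| * τ ^ γ := by gcongr; exact le_abs_self D
    nlinarith
  have hstep : ∀ D' : ℝ, 0 ≤ D' → ConeBound G γ (testClass d r s M) Λ 1 x D' →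
      ConeBound G γ (testClass d r s M) Λ Λ x (D' / 2 + C₁ * B) := by
    intro D' hD' h y τ hτ hτΛ hy ψ hψ
    refine (coneBound_step hN (fun T x lam X h1 h2 h3 => hdec N hN M hM1 T x lam X h1 h2 h3)
      haγ hΛ hB hD' hN1 hcoh' h y τ hτ hτΛ hy ψ hψ).trans ?_
    gcongr
    rw [mul_add, ← mul_assoc, hC₁]
    nlinarith
  have hiter : ∀ n : ℕ, ConeBound G γ (testClass d r s M) Λ 1 x
      (|D| * M / 2 ^ n + 2 * C₁ * B) := by
    intro n
    induction n with
    | zero =>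
      intro y τ hτ hτ1 hy ψ hψ
      refine (hbase y τ hτ hτ1 hy ψ hψ).trans ?_
      gcongr
      rw [pow_zero, div_one]
      have : 0 ≤ 2 * C₁ * B := by positivity
      linarith
    | succ n ih =>
      intro y τ hτ hτ1 hy ψ hψ
      have := hstep _ (by positivity) ih y τ hτ (hτ1.trans hΛ) hy ψ hψ
      refine this.trans_eq ?_
      congr 1
      rw [pow_succ]; field_simp; ring
  -- The map `D' ↦ D'/2 + C₁ B` has the fixed point `2 C₁ B`; the a priori part is halved at each
  -- step.
  have hfin : ∀ n : ℕ, |G x (scale φ x ε)| ≤ (|D| * M / 2 ^ n + 2 * C₁ * B) * ε ^ γ := by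
    intro n
    refine (hstep _ (by positivity) (hiter n) x ε hε hεΛ ?_ φ hφM).trans ?_
    · rw [sub_self, norm_zero]
      have : ε / Λ ≤ 1 := (div_le_one hΛ0).2 hεΛ
      nlinarith
    · refine mul_le_mul_of_nonneg_right ?_ (by positivity)
      have : 0 ≤ |D| * M / 2 ^ n := by positivity
      linarith
  have hlim : Tendsto (fun n : ℕ => (|D| * M / 2 ^ n + 2 * C₁ * B) * ε ^ γ) atTop
      (𝓝 ((0 + 2 * C₁ * B) * ε ^ γ)) := by
    refine Tendsto.mul_const _ (Tendsto.add_const _ ?_)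
    exact tendsto_const_nhds.div_atTop (tendsto_pow_atTop_atTop_of_one_lt (by norm_num))
  rw [zero_add] at hlim
  exact ge_of_tendsto' hlim hfin

/-- A coherent family of distributions that is `γ`-homogeneous up to scale one is `γ`-homogeneous
up to any scale. -/
theorem exists_homBound_extend {r : ℕ} {a γ Λ : ℝ} (haγ : a < γ)
    (hΛ : 1 ≤ Λ) {S : Set (Space d)} {G : Space d → Distr d}
    {B D : ℝ} (hB : 0 ≤ B) (hcoh : CohBound G a γ r (S + Metric.closedBall 0 (Λ + 1)) Λ B)
    (hhom : HomBound G γ r (S + Metric.closedBall 0 (Λ + 1)) 1 D) :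
    ∃ D', HomBound G γ r S Λ D' := by
  obtain ⟨C₀, hC₀, hdec⟩ := exists_decomposition_bound d (le_refl r)
  obtain ⟨N, hN, hNδ⟩ := exists_lattice_scale d (δ := 1 / (2 * Λ + 1)) (by positivity)
  rw [le_div_iff₀ (by positivity)] at hNδ
  refine ⟨C₀ * (|D| * (((d : ℝ) + 1) / N) ^ γ +
    B * ((((d : ℝ) + 1) / N) ^ a * 3 ^ (γ - a))), fun x hx ε hε hεΛ φ hφ => ?_⟩
  have hsub : Metric.closedBall x (Λ + 1) ⊆ S + Metric.closedBall 0 (Λ + 1) := by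
    intro y hy
    refine ⟨x, hx, y - x, ?_, by simp⟩
    rwa [mem_closedBall_zero_iff, ← mem_closedBall_iff_norm]
  have hΛ0 : 0 < Λ := by linarith
  refine coneBound_step (D := |D|) hN (fun T x lam X h1 h2 h3 =>
    hdec N hN 1 le_rfl T x lam X h1 h2 h3) haγ hΛ hB (abs_nonneg D) hNδ
    (fun z hz y hy => hcoh z (hsub hz) y (hsub hy)) ?_ x ε hε hεΛ ?_ φ ⟨hφ, fun k hk z =>
      (mem_unitTest_iff.1 hφ).2 k hk z⟩
  · intro y τ hτ hτ1 hy ψ hψ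
    have hys : y ∈ S + Metric.closedBall 0 (Λ + 1) := by
      refine hsub ?_
      rw [mem_closedBall_iff_norm]
      refine hy.trans ?_
      have : 0 < τ / Λ := by positivity
      nlinarith
    refine (hhom y hys τ hτ hτ1 ψ hψ.1).trans ?_
    gcongr
    exact le_abs_self D
  · rw [sub_self, norm_zero]
    have : ε / Λ ≤ 1 := (div_le_one hΛ0).2 hεΛ
    nlinarith

/-! ### Estimates for a single kernel -/

/-- Bounds of a homogeneous distribution at a point. -/
def HomAt (T : Distr d) (x : Space d) (a : ℝ) (r : ℕ) (Λ A : ℝ) : Prop :=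
  ∀ ε, 0 < ε → ε ≤ Λ → ∀ φ ∈ unitTest d r, |T (scale φ x ε)| ≤ A * ε ^ a

theorem HomAt.nonneg {T : Distr d} {x : Space d} {a : ℝ} {r : ℕ} {Λ A : ℝ}
    (h : HomAt T x a r Λ A) (hΛ : 0 < Λ) : 0 ≤ A := by
  have h1 := (abs_nonneg _).trans (h Λ hΛ le_rfl 0 (zero_mem_unitTest r))
  exact nonneg_of_mul_nonneg_left h1 (Real.rpow_pos_of_pos hΛ a)

/-- The derivatives `V` of a kernel localised at scale `t`, of order `β`, with bounds on `S₀`. -/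
structure KernelBounds (m s : ℕ) (β c ρ t : ℝ) (S₀ : Set (Space d))
    (V : (Fin d → ℕ) → (Fin d → ℕ) → Space d → Space d → ℝ) : Prop where
  bijet : IsBijet m s V
  supp : ∀ x y, ρ * t < ‖x - y‖ → V 0 0 x y = 0
  bound : ∀ k l, deg k ≤ m → deg l ≤ s → ∀ x ∈ S₀, ∀ y ∈ S₀,
    |V k l x y| ≤ c * t ^ (β - d - deg k - deg l)
  moment : ∀ l p, deg l ≤ s → deg p ≤ s → ∀ y ∈ S₀,
    |∫ x, monomial p (y - x) * V 0 l x y| ≤ c * t ^ β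

/-! ### Linearity of the passage from functions to test functions of finite order -/

section toTest

variable {s : ℕ}

theorem toTest_add {f g : Space d → ℝ} (hf : ContDiff ℝ s f) (hfc : HasCompactSupport f)
    (hg : ContDiff ℝ s g) (hgc : HasCompactSupport g) :
    toTest s (fun y => f y + g y) = toTest s f + toTest s g := by
  ext y
  rw [FunLike.coe_add, Pi.add_apply, toTest_apply hf hfc, toTest_apply hg hgc,
    toTest_apply (hf.add hg) (hfc.add hgc)]

theorem toTest_const_mul (a : ℝ) {f : Space d → ℝ} (hf : ContDiff ℝ s f)
    (hfc : HasCompactSupport f) : toTest s (fun y => a * f y) = a • toTest s f := by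
  ext y
  rw [FunLike.coe_smul, Pi.smul_apply, toTest_apply hf hfc,
    toTest_apply (contDiff_const.mul hf) hfc.mul_left, smul_eq_mul]

theorem toTest_zero : toTest s (fun _ : Space d => 0) = 0 := by
  ext y
  have h := toTest_apply (r := s) (g := fun _ : Space d => (0 : ℝ)) contDiff_const
    HasCompactSupport.zero
  exact congrFun h y

theorem toTest_sum {ι : Type*} (A : Finset ι) {f : ι → Space d → ℝ}
    (hf : ∀ i ∈ A, ContDiff ℝ s (f i)) (hfc : ∀ i ∈ A, HasCompactSupport (f i)) :
    toTest s (fun y => ∑ i ∈ A, f i y) = ∑ i ∈ A, toTest s (f i) := by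
  classical
  have : ContDiff ℝ s (fun y => ∑ i ∈ A, f i y) ∧ HasCompactSupport (fun y => ∑ i ∈ A, f i y) ∧
      toTest s (fun y => ∑ i ∈ A, f i y) = ∑ i ∈ A, toTest s (f i) := by
    induction A using Finset.induction_on with
    | empty =>
      simp only [Finset.sum_empty]
      exact ⟨contDiff_const, HasCompactSupport.zero, toTest_zero⟩
    | insert i A hi ih =>
      obtain ⟨h1, h2, h3⟩ := ih (fun j hj => hf j (Finset.mem_insert_of_mem hj))
        (fun j hj => hfc j (Finset.mem_insert_of_mem hj))
      have h4 := hf i (Finset.mem_insert_self _ _)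
      have h5 := hfc i (Finset.mem_insert_self _ _)
      simp only [Finset.sum_insert hi]
      exact ⟨h4.add h1, h5.add h2, by rw [toTest_add h4 h5 h1 h2, h3]⟩
  exact this.2.2

theorem toTest_sub {f g : Space d → ℝ} (hf : ContDiff ℝ s f) (hfc : HasCompactSupport f)
    (hg : ContDiff ℝ s g) (hgc : HasCompactSupport g) :
    toTest s (fun y => f y - g y) = toTest s f - toTest s g := by
  ext y
  rw [FunLike.coe_sub, Pi.sub_apply, toTest_apply hf hfc, toTest_apply hg hgc,
    toTest_apply (hf.sub hg) (hfc.sub hgc)]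

end toTest

/-- The basic estimate for a function concentrated at scale `t`. -/
theorem abs_extension_le_rpow {T : Distr d} {r s : ℕ} (hrs : r ≤ s) {T' : DistrOfOrder d s}
    (hT : IsExtension s T T') {x : Space d} {σ' σ t a e A c₀ Λ : ℝ} (hσ : σ' < σ) (hσ0 : 0 < σ)
    (ht : 0 < t) (htΛ : σ * t ≤ Λ) (hA : HomAt T x a r Λ A) (hc₀ : 0 ≤ c₀)
    {J : (Fin d → ℕ) → Space d → ℝ} (hJ : IsJet s J)
    (hs : ∀ y, y ∉ Metric.closedBall x (σ' * t) → J 0 y = 0)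
    (hφ : ∀ l, deg l ≤ r → ∀ y, |J l y| ≤ c₀ * t ^ (e - d - deg l)) :
    |T' (toTest s (J 0))| ≤ max 1 σ ^ (d + r) * σ ^ a * (c₀ * A * t ^ (e + a)) := by
  have h := abs_extension_le hrs hT (x := x) (lam := σ * t) (σ := σ' * t)
    (M := c₀ * max 1 σ ^ (d + r) * t ^ e) (B := A * (σ * t) ^ a)
    (by gcongr) (by positivity) (by positivity)
    (fun ψ hψ => hA _ (by positivity) htΛ ψ hψ) hJ hs ?_
  · refine h.trans (le_of_eq ?_)
    rw [Real.mul_rpow hσ0.le ht.le, Real.rpow_add ht]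
    ring
  · intro l hl y
    refine (hφ l hl y).trans ?_
    have h1 : t ^ (e - d - deg l) = t ^ e * (t⁻¹) ^ (d + deg l) := by
      rw [sub_sub, Real.rpow_sub ht, inv_pow, ← div_eq_mul_inv]
      congr 1
      exact_mod_cast Real.rpow_natCast t (d + deg l)
    -- The support radius is `σt`, whereas the derivative bounds are stated at scale `t`; the factor
    -- `max 1 σ ^ (d + r)` pays for the change of scale.
    have h2 : 1 ≤ max 1 σ ^ (d + r) * (σ⁻¹) ^ (d + deg l) := by
      rw [inv_pow, ← div_eq_mul_inv, one_le_div (by positivity)]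
      calc σ ^ (d + deg l) ≤ max 1 σ ^ (d + deg l) := by gcongr; exact le_max_right _ _
        _ ≤ _ := pow_le_pow_right₀ (le_max_left _ _) (by omega)
    calc c₀ * t ^ (e - d - deg l) = c₀ * (t ^ e * (t⁻¹) ^ (d + deg l)) * 1 := by rw [h1, mul_one]
      _ ≤ c₀ * (t ^ e * (t⁻¹) ^ (d + deg l)) *
          (max 1 σ ^ (d + r) * (σ⁻¹) ^ (d + deg l)) := by gcongr
      _ = _ := by rw [mul_inv, mul_pow]; ring

/-! ### Support, size and Taylor expansion of a single kernel -/

namespace KernelBounds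

variable {m s : ℕ} {β c ρ t : ℝ} {S₀ : Set (Space d)}
  {V : (Fin d → ℕ) → (Fin d → ℕ) → Space d → Space d → ℝ}

/-- Derivatives vanish on the open set where the function vanishes, first in `y` with `x` fixed and
then in `x` with `y` fixed. -/
theorem eq_zero (hV : KernelBounds m s β c ρ t S₀ V) {k l : Fin d → ℕ} (hk : deg k ≤ m)
    (hl : deg l ≤ s) {x y : Space d} (h : ρ * t < ‖x - y‖) : V k l x y = 0 := by
  have h1 : ∀ l, deg l ≤ s → ∀ x y, ρ * t < ‖x - y‖ → V 0 l x y = 0 := fun l hl x y h =>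
    (hV.bijet.snd 0 (by simp) x).eq_zero_of_support (K := Metric.closedBall x (ρ * t))
      Metric.isClosed_closedBall (fun y hy => hV.supp x y (by
        rw [mem_closedBall_iff_norm', not_le] at hy; exact hy)) hl
        (by rw [mem_closedBall_iff_norm', not_le]; exact h)
  exact (hV.bijet.fst l hl y).eq_zero_of_support (K := Metric.closedBall y (ρ * t))
      Metric.isClosed_closedBall (fun x hx => h1 l hl x y (by
        rw [mem_closedBall_iff_norm, not_le] at hx; exact hx)) hk
        (by rw [mem_closedBall_iff_norm, not_le]; exact h)

/-- The kernel bounds hold on `S₀ × S₀` only. If the ball around `x` lies in `S₀`, every other `y`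
is outside the support, so the bound is global in `y`. -/
theorem abs_le (hV : KernelBounds m s β c ρ t S₀ V) (hc : 0 ≤ c) (hρ : 0 ≤ ρ) (ht : 0 ≤ t)
    {k l : Fin d → ℕ} (hk : deg k ≤ m) (hl : deg l ≤ s) {x : Space d}
    (hx : Metric.closedBall x (ρ * t) ⊆ S₀) (y : Space d) :
    |V k l x y| ≤ c * t ^ (β - d - deg k - deg l) := by
  by_cases h : ‖x - y‖ ≤ ρ * t
  · exact hV.bound k l hk hl x (hx (Metric.mem_closedBall_self (by positivity))) y
      (hx (by rwa [mem_closedBall_iff_norm']))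
  · rw [hV.eq_zero hk hl (not_le.1 h), abs_zero]
    positivity

theorem jet_eq_zero (hV : KernelBounds m s β c ρ t S₀ V) {k : Fin d → ℕ} (hk : deg k ≤ m)
    {x y : Space d} (hy : y ∉ Metric.closedBall x (ρ * t)) : V k 0 x y = 0 :=
  hV.eq_zero hk (by simp) (by rwa [mem_closedBall_iff_norm', not_le] at hy)

theorem contDiff (hV : KernelBounds m s β c ρ t S₀ V) {k : Fin d → ℕ} (hk : deg k ≤ m)
    (x : Space d) : ContDiff ℝ s (V k 0 x) :=
  (hV.bijet.snd k hk x).contDiff (by simp)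

theorem hasCompactSupport (hV : KernelBounds m s β c ρ t S₀ V) {k : Fin d → ℕ} (hk : deg k ≤ m)
    (x : Space d) : HasCompactSupport (V k 0 x) :=
  hasCompactSupport_of_closedBall fun _ hy => hV.jet_eq_zero hk hy

variable {T : Distr d} {r : ℕ} {T' : DistrOfOrder d s} {a A : ℝ}

/-- Size of the derivatives of `K T`. -/
theorem abs_kcoef_le (hV : KernelBounds m s β c ρ t S₀ V) (hc : 0 ≤ c) (hρ : 0 < ρ) (ht : 0 < t)
    (hrs : r ≤ s) (hT : IsExtension s T T') {x : Space d} {Λ : ℝ} (hΛ : 2 * ρ * t ≤ Λ)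
    (hA : HomAt T x a r Λ A) (hx : Metric.closedBall x (ρ * t) ⊆ S₀)
    {k : Fin d → ℕ} (hk : deg k ≤ m) :
    |T' (toTest s (V k 0 x))| ≤
      max 1 (2 * ρ) ^ (d + r) * (2 * ρ) ^ a * (c * A * t ^ (β - deg k + a)) := by
  refine abs_extension_le_rpow hrs hT (σ' := ρ) (by linarith) (by positivity) ht hΛ hA hc
    (hV.bijet.snd k hk x) (fun y hy => hV.jet_eq_zero hk hy) fun l hl y => ?_
  refine (hV.abs_le hc hρ.le ht.le hk (hl.trans hrs) hx y).trans (le_of_eq ?_)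
  ring_nf

/-- Taylor expansion of the derivatives of `K T`. -/
theorem abs_taylor_le (hV : KernelBounds m s β c ρ t S₀ V) (hc : 0 ≤ c) (hρ : 0 < ρ) (ht : 0 < t)
    (hrs : r ≤ s) (hT : IsExtension s T T') {x y : Space d} {Λ : ℝ} (hΛ : 2 * ρ * t ≤ Λ)
    (hA : HomAt T y a r Λ A) (hy : Metric.closedBall y (2 * ρ * t) ⊆ S₀)
    (hxy : 2 * ‖x - y‖ ≤ ρ * t)
    {k : Fin d → ℕ} {n : ℕ} (hk : deg k + n ≤ m) :
    |T' (toTest s (V k 0 x)) - ∑ p ∈ poly d (n : ℝ),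
        monomial p (x - y) / mfactorial p * T' (toTest s (V (k + p) 0 y))| ≤
      max 1 (2 * ρ) ^ (d + r) * (2 * ρ) ^ a * ((d * ‖x - y‖) ^ n * c * A *
        t ^ (β - deg k - n + a)) := by
  have hρt : 0 < ρ * t := by positivity
  have hp : ∀ p ∈ poly d (n : ℝ), deg (k + p) ≤ m := fun p hp => by
    rw [mem_poly_nat] at hp; rw [deg_add]; omega
  have hk' : deg k ≤ m := by omega
  have hlin : T' (toTest s (V k 0 x)) - ∑ p ∈ poly d (n : ℝ),
        monomial p (x - y) / mfactorial p * T' (toTest s (V (k + p) 0 y)) =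
      T' (toTest s fun y' => V k 0 x y' - ∑ p ∈ poly d (n : ℝ),
        monomial p (x - y) / mfactorial p * V (k + p) 0 y y') := by
    rw [toTest_sub (hV.contDiff hk' x) (hV.hasCompactSupport hk' x)
      (ContDiff.sum fun p h => contDiff_const.mul (hV.contDiff (hp p h) y)), map_sub,
      toTest_sum, map_sum]
    · congr 1
      refine Finset.sum_congr rfl fun p h => ?_
      rw [toTest_const_mul _ (hV.contDiff (hp p h) y) (hV.hasCompactSupport (hp p h) y), map_smul,
        smul_eq_mul]
    · exact fun p h => contDiff_const.mul (hV.contDiff (hp p h) y)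
    · exact fun p h => (hV.hasCompactSupport (hp p h) y).mul_left
    · refine hasCompactSupport_of_closedBall (x := y) (s := ρ * t) fun y' hy' => ?_
      exact Finset.sum_eq_zero fun p h => by rw [hV.jet_eq_zero (hp p h) hy', mul_zero]
  rw [hlin]
  -- Homogeneity is available at `y`. Since `|x - y| ≤ ρt/2`, the kernel based at `x` is also
  -- supported within `3ρt/2` of `y`.
  refine abs_extension_le_rpow hrs hT (x := y) (σ' := 3 / 2 * ρ) (by linarith) (by positivity) ht
    hΛ hA (by positivity)
    (J := fun l y' => V k l x y' - ∑ p ∈ poly d (n : ℝ),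
        monomial p (x - y) / mfactorial p * V (k + p) l y y')
    ((hV.bijet.snd k hk' x).sub (IsJet.sum _ fun p h =>
      (hV.bijet.snd _ (hp p h) y).const_mul _)) (fun y' hy' => ?_) fun l hl y' => ?_
  · rw [mem_closedBall_iff_norm', not_le] at hy'
    have h1 : ρ * t < ‖x - y'‖ := by
      have := norm_sub_le_norm_sub_add_norm_sub y x y'
      rw [norm_sub_rev y x] at this
      linarith
    rw [hV.eq_zero hk' (by simp) h1, Finset.sum_eq_zero, sub_zero]
    intro p h
    rw [hV.eq_zero (hp p h) (by simp) (by linarith), mul_zero]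
  -- Taylor's formula in the first variable, after `l` derivatives in the second, gains the factor
  -- `(|x - y| / t)^n`.
  · have h1 := (((hV.bijet.fst l (hl.trans hrs) y').shift k hk)).taylor x y
      (M := c * t ^ (β - d - (deg k + n : ℕ) - deg l)) (by positivity) fun p hpn τ hτ => ?_
    · simp only [add_zero] at h1
      refine h1.trans (le_of_eq ?_)
      rw [mul_assoc (_ ^ n)]
      push_cast
      ring_nf
    · rw [← hpn, ← deg_add]
      refine hV.abs_le hc hρ.le ht.le (by rw [deg_add]; omega) (hl.trans hrs) ?_ y'
      refine (Metric.closedBall_subset_closedBall' ?_).trans hy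
      have : dist (y + τ • (x - y)) y ≤ ‖x - y‖ := by
        rw [dist_eq_norm, add_sub_cancel_left, norm_smul, Real.norm_eq_abs, abs_of_nonneg hτ.1]
        exact mul_le_of_le_one_left (norm_nonneg _) hτ.2
      linarith

end KernelBounds

/-! ### Integration of kernels against rescaled test functions -/

/-- Integration by parts for jets. -/
theorem IsJet.integral_mul_eq {n : ℕ} {P g : (Fin d → ℕ) → Space d → ℝ} (hP : IsJet n P)
    (hg : IsJet n g) {K : Set (Space d)} (hK : IsCompact K) (h0 : ∀ x, x ∉ K → P 0 x = 0)
    {k : Fin d → ℕ} (hk : deg k ≤ n) :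
    ∫ x, P k x * g 0 x = (-1) ^ deg k * ∫ x, P 0 x * g k x := by
  have hint : ∀ {l : Fin d → ℕ}, deg l ≤ n → ∀ {h : Space d → ℝ}, Continuous h →
      Integrable fun x => P l x * h x := fun {l} hl {h} hh =>
    ((hP.cont l hl).mul hh).integrable_of_hasCompactSupport
      (HasCompactSupport.intro hK fun x hx => hP.eq_zero_of_support hK.isClosed h0 hl hx).mul_right
  induction k using multiIndex_induction generalizing n g with
  | h0 => simp
  | h1 k i ih =>
    rw [deg_add_single] at hk
    have h1 : ∫ x, P k x * g (Pi.single i 1) x = - ∫ x, P (k + Pi.single i 1) x * g 0 x := by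
      have := integral_bilinear_hasLineDerivAt_right_eq_neg_left_of_integrable
        (μ := (volume : Measure (Space d))) (f := P k) (f' := P (k + Pi.single i 1)) (g := g 0)
        (g' := g (Pi.single i 1)) (v := unitVec i) (B := ContinuousLinearMap.mul ℝ ℝ)
        (hint (by rw [deg_add_single]; omega) (hg.cont 0 (by simp)))
        (hint (by omega) (hg.cont _ (by rw [deg_single]; omega)))
        (hint (by omega) (hg.cont 0 (by simp)))
        (fun x _ => hP.deriv k i (by omega) x)
        (fun x _ => by simpa using hg.deriv 0 i (by simp; omega) x)
      simpa using this
    have h2 := ih (n := n - 1) (g := fun l => g (Pi.single i 1 + l)) (hP.mono (by omega))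
      (hg.shift (Pi.single i 1) (by rw [deg_single]; omega)) (by omega)
      (fun {l} hl {h} hh => hint (by omega) hh)
    simp only [add_zero] at h2
    rw [← neg_eq_iff_eq_neg] at h1
    rw [← h1, h2, deg_add_single, pow_succ, add_comm (Pi.single i 1) k]
    ring

theorem IsJet.abs_sub_le {J : (Fin d → ℕ) → Space d → ℝ} (hJ : IsJet 1 J) (x y : Space d) {M : ℝ}
    (hM0 : 0 ≤ M)
    (hM : ∀ p, deg p = 1 → ∀ t ∈ Icc (0 : ℝ) 1, |J p (y + t • (x - y))| ≤ M) :
    |J 0 x - J 0 y| ≤ d * ‖x - y‖ * M := by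
  have h := hJ.taylor x y hM0 hM
  have h1 : poly d ((1 : ℕ) : ℝ) = {0} := by
    ext p
    rw [mem_poly_nat, Finset.mem_singleton, Nat.lt_one_iff]
    exact ⟨deg_eq_zero, fun h => by simp [h]⟩
  rw [h1, Finset.sum_singleton, monomial_zero_left, mfactorial_zero] at h
  simpa using h

theorem abs_integral_le_of_closedBall {f : Space d → ℝ} {z : Space d} {R M : ℝ} (hR : 0 ≤ R)
    (h0 : ∀ x, x ∉ Metric.closedBall z R → f x = 0)
    (hb : ∀ x ∈ Metric.closedBall z R, |f x| ≤ M) :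
    |∫ x, f x| ≤ M * (R ^ d * volume.real (Metric.ball (0 : Space d) 1)) := by
  rw [← setIntegral_eq_integral_of_forall_compl_eq_zero h0]
  have h := norm_setIntegral_le_of_norm_le_const (μ := (volume : Measure (Space d))) (f := f)
    (s := Metric.closedBall z R) (C := M) measure_closedBall_lt_top hb
  rwa [Measure.addHaar_real_closedBall _ _ hR, finrank_euclideanSpace_fin] at h

theorem integral_scale (η : Test d) (x : Space d) {ε : ℝ} (hε : 0 < ε) :
    ∫ y, scale η x ε y = ∫ y, η y := by
  simp only [scale_apply η x hε]
  rw [integral_const_mul, integral_sub_right_eq_self (fun y => η (ε⁻¹ • y)) x,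
    Measure.integral_comp_inv_smul_of_nonneg _ _ hε.le, finrank_euclideanSpace_fin, smul_eq_mul,
    ← mul_assoc, ← mul_pow, inv_mul_cancel₀ hε.ne', one_pow, one_mul]

/-- Bounds on a test function `η` supported in the ball of radius `R`. -/
structure TestBounds (η : Test d) (R D : ℝ) (N : ℕ) : Prop where
  supp : ∀ z, z ∉ Metric.closedBall 0 R → η z = 0
  bound : ∀ k, deg k ≤ N → ∀ z, |mderiv k η z| ≤ D

theorem exists_testBounds (η : Test d) (N : ℕ) {R : ℝ} (hη : ∀ z, z ∉ Metric.closedBall 0 R → η z = 0) :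
    ∃ D, 0 ≤ D ∧ TestBounds η R D N := by
  have h : ∀ k : Fin d → ℕ, ∃ D, 0 ≤ D ∧ ∀ z, |mderiv k η z| ≤ D := fun k => by
    have hc : HasCompactSupport (mderiv k η) := by
      rw [← coe_testDeriv]; exact (testDeriv k η).hasCompactSupport
    obtain ⟨C, hC⟩ := hc.exists_bound_of_continuous ((isJet_test η (deg k)).cont k le_rfl)
    simp only [Real.norm_eq_abs] at hC
    exact ⟨C, (abs_nonneg _).trans (hC 0), hC⟩
  choose D hD0 hD using h
  refine ⟨∑ k ∈ poly d ((N + 1 : ℕ) : ℝ), D k, Finset.sum_nonneg fun k _ => hD0 k, hη,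
    fun k hk z => (hD k z).trans ?_⟩
  have hk' : k ∈ poly d ((N + 1 : ℕ) : ℝ) := (mem_poly_nat (N + 1) k).2 (by omega)
  exact Finset.single_le_sum (f := D) (fun k _ => hD0 k) hk'

namespace TestBounds

variable {η : Test d} {R D : ℝ} {N : ℕ}

theorem scale_eq_zero (h : TestBounds η R D N) {x : Space d} {ε : ℝ} (hε : 0 < ε) {k : Fin d → ℕ}
    {y : Space d} (hy : y ∉ Metric.closedBall x (R * ε)) : mderiv k (scale η x ε) y = 0 := by
  have h1 : ∀ z, z ∉ Metric.closedBall 0 R → mderiv k η z = 0 := fun z hz =>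
    (isJet_test η (deg k)).eq_zero_of_support (K := Metric.closedBall 0 R)
      Metric.isClosed_closedBall (fun z hz => by rw [mderiv_zero]; exact h.supp z hz) le_rfl hz
  rw [mderiv_scale η x hε, h1, mul_zero]
  rw [mem_closedBall_iff_norm, not_le] at hy ⊢
  rw [sub_zero, norm_smul, norm_inv, Real.norm_eq_abs, abs_of_pos hε, ← div_eq_inv_mul,
    lt_div_iff₀ hε]
  exact hy

theorem abs_scale_le (h : TestBounds η R D N) (x : Space d) {ε : ℝ} (hε : 0 < ε) {k : Fin d → ℕ}
    (hk : deg k ≤ N) (y : Space d) :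
    |mderiv k (scale η x ε) y| ≤ D * (ε⁻¹) ^ (d + deg k) := by
  rw [mderiv_scale η x hε, abs_mul, mul_comm, abs_of_nonneg (by positivity : 0 ≤ (ε⁻¹) ^ (d + deg k))]
  gcongr
  exact h.bound k hk _

theorem nonneg (h : TestBounds η R D N) : 0 ≤ D :=
  (abs_nonneg _).trans (h.bound 0 (by simp) 0)

end TestBounds

/-! ### Smoothed kernels below, near and above the kernel scale -/

namespace KernelBounds

variable {m s : ℕ} {β c ρ t : ℝ} {S₀ : Set (Space d)}
  {V : (Fin d → ℕ) → (Fin d → ℕ) → Space d → Space d → ℝ}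
  {T : Distr d} {r : ℕ} {T' : DistrOfOrder d s} {a A : ℝ} {η : Test d} {R D : ℝ}

/-- The jet of an integral of the kernel against a function with compact support. -/
theorem isJet_integral (hV : KernelBounds m s β c ρ t S₀ V) {w : Space d → ℝ} (hw : Continuous w)
    (hw' : HasCompactSupport w) {k : Fin d → ℕ} (hk : deg k ≤ m) :
    IsJet s fun l y => ∫ x, w x * V k l x y :=
  isJet_integral_mul hw hw' (fun _ hx => image_eq_zero_of_notMem_tsupport hx)
    (fun x => hV.bijet.snd k hk x) fun l hl => hV.bijet.cont k l hk hl

theorem integral_testDeriv_mul (hV : KernelBounds m s β c ρ t S₀ V) (φ : Test d) {k l : Fin d → ℕ}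
    (hk : deg k ≤ m) (hl : deg l ≤ s) (y : Space d) :
    ∫ x, testDeriv k φ x * V 0 l x y = (-1) ^ deg k * ∫ x, φ x * V k l x y := by
  have h := (isJet_test φ m).integral_mul_eq (hV.bijet.fst l hl y) φ.hasCompactSupport
    (fun x hx => by rw [mderiv_zero]; exact image_eq_zero_of_notMem_tsupport hx) hk
  rw [mderiv_zero] at h
  simpa only [testDeriv_apply] using h

theorem integral_scale_eq_zero (hV : KernelBounds m s β c ρ t S₀ V) {w : Space d → ℝ}
    {x : Space d} {ε : ℝ} (hw : ∀ z, z ∉ Metric.closedBall x (R * ε) → w z = 0)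
    {k l : Fin d → ℕ} (hk : deg k ≤ m) (hl : deg l ≤ s) {y : Space d}
    (hy : y ∉ Metric.closedBall x (R * ε + ρ * t)) :
    ∫ z, w z * V k l z y = 0 := by
  refine integral_eq_zero_of_ae (Eventually.of_forall fun z => ?_)
  by_cases hz : z ∈ Metric.closedBall x (R * ε)
  · rw [mem_closedBall_iff_norm] at hz hy
    simp only [Pi.zero_apply]
    rw [hV.eq_zero hk hl, mul_zero]
    have := norm_sub_le_norm_sub_add_norm_sub y z x
    rw [norm_sub_rev y z] at this
    linarith
  · simp [hw z hz]

/-- Smoothing below the scale of the kernel. -/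
theorem abs_smooth_le_of_le (hV : KernelBounds m s β c ρ t S₀ V) (hc : 0 ≤ c) (hρ : 0 < ρ)
    (ht : 0 < t) (ht1 : t ≤ 1) (hrs : r ≤ s) (hT : IsExtension s T T') {x : Space d} {Λ σ : ℝ}
    (hR : 0 < R) (hσ : R + ρ < σ) (hΛ : σ * t ≤ Λ) (hA : HomAt T x a r Λ A)
    (hx : Metric.closedBall x (R + 2 * ρ) ⊆ S₀) {N : ℕ} (hη : TestBounds η R D N)
    {k : Fin d → ℕ} (hk : deg k ≤ m) {ε : ℝ} (hε : 0 < ε) (hεt : ε ≤ t) :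
    |T' (toTest s (dualInt (V 0 0) (testDeriv k (scale η x ε))))| ≤
      max 1 σ ^ (d + r) * σ ^ a *
        (D * (R ^ d * volume.real (Metric.ball (0 : Space d) 1)) * c * A * t ^ (β - deg k + a)) := by
  have hD := hη.nonneg
  have hRε : R * ε ≤ R := by nlinarith
  have hRt : R * ε ≤ R * t := by gcongr
  have hw : ∀ z, z ∉ Metric.closedBall x (R * ε) → scale η x ε z = 0 := fun z hz => by
    have := hη.scale_eq_zero (k := 0) hε hz
    rwa [mderiv_zero] at this
  have hw' : ∀ z, z ∉ Metric.closedBall x (R * ε) → testDeriv k (scale η x ε) z = 0 := fun z hz => by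
    rw [testDeriv_apply]; exact hη.scale_eq_zero hε hz
  refine abs_extension_le_rpow hrs hT (σ' := R + ρ) hσ (by linarith) ht hΛ hA (by positivity)
    (J := fun l y => ∫ z, testDeriv k (scale η x ε) z * V 0 l z y)
    (hV.isJet_integral (testDeriv k (scale η x ε)).contDiff.continuous
      (testDeriv k (scale η x ε)).hasCompactSupport (by simp))
    (fun y hy => hV.integral_scale_eq_zero hw' (by simp) (by simp) fun h => hy
      (Metric.closedBall_subset_closedBall (by linarith) h)) fun l hl y => ?_
  -- With `∂^k` moved to the kernel, only the `L¹` size of the rescaled test function enters: its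
  -- height `ε^{-d}` cancels the volume of its support.
  rw [hV.integral_testDeriv_mul _ hk (hl.trans hrs), abs_mul, abs_pow, abs_neg, abs_one, one_pow,
    one_mul]
  have h := abs_integral_le_of_closedBall (z := x) (R := R * ε)
    (f := fun z => scale η x ε z * V k l z y)
    (M := D * (ε⁻¹) ^ d * (c * t ^ (β - d - deg k - deg l))) (by positivity)
    (fun z hz => by simp only [hw z hz, zero_mul]) fun z hz => by
      rw [abs_mul]
      have h1 := hη.abs_scale_le x hε (k := 0) (by simp) z
      rw [mderiv_zero, deg_zero, add_zero] at h1
      refine mul_le_mul h1 (hV.abs_le hc hρ.le ht.le hk (hl.trans hrs) ?_ y) (abs_nonneg _)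
        (by positivity)
      refine (Metric.closedBall_subset_closedBall' ?_).trans hx
      rw [Metric.mem_closedBall] at hz
      nlinarith
  refine h.trans (le_of_eq ?_)
  have h2 : (ε⁻¹) ^ d * (R * ε) ^ d = R ^ d := by
    rw [← mul_pow, mul_comm R, ← mul_assoc, inv_mul_cancel₀ hε.ne', one_mul]
  rw [show β - d - deg k - deg l = β - deg k - d - deg l by ring, ← h2]
  ring

/-- The error made by smoothing below the scale of the kernel. -/
theorem abs_smooth_sub_le (hV : KernelBounds m s β c ρ t S₀ V) (hc : 0 ≤ c) (hρ : 0 < ρ)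
    (ht : 0 < t) (ht1 : t ≤ 1) (hrs : r ≤ s) (hT : IsExtension s T T') {x : Space d} {Λ σ : ℝ}
    (hR : 0 < R) (hσ : R + ρ < σ) (hΛ : σ * t ≤ Λ) (hA : HomAt T x a r Λ A)
    (hx : Metric.closedBall x (R + 2 * ρ) ⊆ S₀) {N : ℕ} (hη : TestBounds η R D N)
    (hη1 : ∫ z, η z = 1)
    {k : Fin d → ℕ} (hk : deg k + 1 ≤ m) {ε : ℝ} (hε : 0 < ε) (hεt : ε ≤ t) :
    |(-1) ^ deg k * T' (toTest s (dualInt (V 0 0) (testDeriv k (scale η x ε)))) -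
        T' (toTest s (V k 0 x))| ≤
      max 1 σ ^ (d + r) * σ ^ a *
        (D * (R ^ d * volume.real (Metric.ball (0 : Space d) 1)) * (d * R * ε) * c * A *
          t ^ (β - deg k - 1 + a)) := by
  have hD := hη.nonneg
  have hk' : deg k ≤ m := by omega
  have hRε : R * ε ≤ R := by nlinarith
  have hRt : R * ε ≤ R * t := by gcongr
  have hw : ∀ z, z ∉ Metric.closedBall x (R * ε) → scale η x ε z = 0 := fun z hz => by
    have := hη.scale_eq_zero (k := 0) hε hz
    rwa [mderiv_zero] at this
  have hw' : ∀ z, z ∉ Metric.closedBall x (R * ε) → testDeriv k (scale η x ε) z = 0 := fun z hz => by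
    rw [testDeriv_apply]; exact hη.scale_eq_zero hε hz
  have hwc : Continuous (scale η x ε) := (scale η x ε).contDiff.continuous
  have hJ0 := hV.isJet_integral (testDeriv k (scale η x ε)).contDiff.continuous
      (testDeriv k (scale η x ε)).hasCompactSupport (k := 0) (by simp)
  have hJ := isJet_integral_mul hwc (scale η x ε).hasCompactSupport
    (fun _ hx => image_eq_zero_of_notMem_tsupport hx)
    (H := fun l z y => V k l z y - V k l x y)
    (fun z => (hV.bijet.snd k hk' z).sub (hV.bijet.snd k hk' x))
    (fun l hl => (hV.bijet.cont k l hk' hl).sub ((hV.bijet.cont k l hk' hl).comp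
      (by fun_prop : Continuous fun p : Space d × Space d => (x, p.2))))
  -- As `∫ η = 1`, the error is an average of differences of the kernel over `|z - x| ≤ Rε`; the
  -- mean value inequality then gains `ε / t`.
  have hsub : ∀ y, ∫ z, scale η x ε z * (V k 0 z y - V k 0 x y) =
      (-1) ^ deg k * dualInt (V 0 0) (testDeriv k (scale η x ε)) y - V k 0 x y := fun y => by
    rw [dualInt, hV.integral_testDeriv_mul _ hk' (by simp), ← mul_assoc, ← mul_pow]
    simp only [mul_neg, mul_one, neg_neg, one_pow, one_mul, mul_sub]
    rw [integral_sub, integral_mul_const, integral_scale η x hε, hη1, one_mul]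
    · exact (hwc.mul ((hV.bijet.fst 0 (by simp) y).cont k hk')).integrable_of_hasCompactSupport
        (scale η x ε).hasCompactSupport.mul_right
    · exact (hwc.mul continuous_const).integrable_of_hasCompactSupport
        (scale η x ε).hasCompactSupport.mul_right
  have hd1 : ContDiff ℝ s (dualInt (V 0 0) (testDeriv k (scale η x ε))) := hJ0.contDiff (by simp)
  have hd2 : HasCompactSupport (dualInt (V 0 0) (testDeriv k (scale η x ε))) :=
    hasCompactSupport_of_closedBall (x := x) fun y hy =>
      hV.integral_scale_eq_zero hw' (by simp) (by simp) hy
  have hlin : (-1) ^ deg k * T' (toTest s (dualInt (V 0 0) (testDeriv k (scale η x ε)))) -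
        T' (toTest s (V k 0 x)) =
      T' (toTest s fun y => ∫ z, scale η x ε z * (V k 0 z y - V k 0 x y)) := by
    simp only [hsub]
    rw [toTest_sub (contDiff_const.mul hd1) hd2.mul_left (hV.contDiff hk' x)
      (hV.hasCompactSupport hk' x), map_sub, toTest_const_mul _ hd1 hd2, map_smul, smul_eq_mul]
  rw [hlin]
  refine abs_extension_le_rpow hrs hT (σ' := R + ρ) hσ (by linarith) ht hΛ hA (by positivity)
    (J := fun l y => ∫ z, scale η x ε z * (V k l z y - V k l x y)) hJ
    (fun y hy => ?_) fun l hl y => ?_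
  · have hy' : y ∉ Metric.closedBall x (R * ε + ρ * t) := fun h => hy
      (Metric.closedBall_subset_closedBall (by linarith) h)
    have h1 : V k 0 x y = 0 := hV.eq_zero hk' (by simp) (by
      rw [mem_closedBall_iff_norm', not_le] at hy'
      have : 0 < R * ε := by positivity
      linarith)
    simp only [h1, sub_zero]
    exact hV.integral_scale_eq_zero hw hk' (by simp) hy'
  · have h := abs_integral_le_of_closedBall (z := x) (R := R * ε)
      (f := fun z => scale η x ε z * (V k l z y - V k l x y))
      (M := D * (ε⁻¹) ^ d * (d * (R * ε) * (c * t ^ (β - d - (deg k + 1 : ℕ) - deg l))))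
      (by positivity)
      (fun z hz => by simp only [hw z hz, zero_mul]) fun z hz => by
        rw [abs_mul]
        have h1 := hη.abs_scale_le x hε (k := 0) (by simp) z
        rw [mderiv_zero, deg_zero, add_zero] at h1
        rw [mem_closedBall_iff_norm] at hz
        refine mul_le_mul h1 ?_ (abs_nonneg _) (by positivity)
        have h2 := ((hV.bijet.fst l (hl.trans hrs) y).shift k hk).abs_sub_le z x
          (M := c * t ^ (β - d - (deg k + 1 : ℕ) - deg l)) (by positivity) fun p hp τ hτ => ?_
        · simp only [add_zero] at h2
          refine h2.trans ?_
          gcongr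
        · rw [← hp, ← deg_add]
          refine hV.abs_le hc hρ.le ht.le (by rw [deg_add]; omega) (hl.trans hrs) ?_ y
          refine (Metric.closedBall_subset_closedBall' ?_).trans hx
          have : dist (x + τ • (z - x)) x ≤ ‖z - x‖ := by
            rw [dist_eq_norm, add_sub_cancel_left, norm_smul, Real.norm_eq_abs, abs_of_nonneg hτ.1]
            exact mul_le_of_le_one_left (norm_nonneg _) hτ.2
          nlinarith
    refine h.trans (le_of_eq ?_)
    have h2 : (ε⁻¹) ^ d * (R * ε) ^ d = R ^ d := by
      rw [← mul_pow, mul_comm R, ← mul_assoc, inv_mul_cancel₀ hε.ne', one_mul]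
    rw [show β - d - (deg k + 1 : ℕ) - deg l = β - deg k - 1 - d - deg l by push_cast; ring, ← h2]
    ring

/-- Smoothing above the scale of the kernel. -/
theorem abs_smooth_le_of_ge (hV : KernelBounds m s β c ρ t S₀ V) (hc : 0 ≤ c) (hρ : 0 < ρ)
    (ht : 0 < t) (hrs : r ≤ s) (hT : IsExtension s T T') {x : Space d} {Λ σ : ℝ}
    (hR : 0 < R) (hσ : R + ρ < σ) {ε : ℝ} (hΛ : σ * ε ≤ Λ) (hA : HomAt T x a r Λ A)
    (hx : Metric.closedBall x (R + 2 * ρ) ⊆ S₀) {N : ℕ} (hη : TestBounds η R D N)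
    {k : Fin d → ℕ} (hk : deg k + r ≤ N) (hε : 0 < ε) (hε1 : ε ≤ 1) (hεt : t ≤ ε) :
    |T' (toTest s (dualInt (V 0 0) (testDeriv k (scale η x ε))))| ≤
      max 1 σ ^ (d + r) * σ ^ a *
        (c * D * (max 1 (d * ρ) ^ r * (ρ ^ d * volume.real (Metric.ball (0 : Space d) 1)) +
          (poly d (r : ℝ)).card) * t ^ β * A * ε ^ (-deg k + a)) := by
  have hD := hη.nonneg
  have hρt : ρ * t ≤ ρ * ε := by gcongr
  have hw' : ∀ z, z ∉ Metric.closedBall x (R * ε) → testDeriv k (scale η x ε) z = 0 := fun z hz => by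
    rw [testDeriv_apply]; exact hη.scale_eq_zero hε hz
  refine abs_extension_le_rpow hrs hT (σ' := R + ρ) hσ (by linarith) hε hΛ hA (by positivity)
    (J := fun l y => ∫ z, testDeriv k (scale η x ε) z * V 0 l z y)
    (hV.isJet_integral (testDeriv k (scale η x ε)).contDiff.continuous
      (testDeriv k (scale η x ε)).hasCompactSupport (by simp))
    (fun y hy => hV.integral_scale_eq_zero hw' (by simp) (by simp) fun h => hy
      (Metric.closedBall_subset_closedBall (by linarith) h)) fun l hl y => ?_
  have hls := hl.trans hrs
  have hE : ε ^ (-(deg k : ℝ) - d - deg l) = (ε⁻¹) ^ (d + deg k + deg l) := by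
    rw [inv_pow, ← Real.rpow_natCast, ← Real.rpow_neg hε.le]
    congr 1
    push_cast; ring
  rw [hE]
  by_cases hy : y ∈ Metric.closedBall x (R * ε + ρ * t)
  swap
  · rw [hV.integral_scale_eq_zero hw' (by simp) hls hy, abs_zero]
    positivity
  have hyS : Metric.closedBall y (ρ * t) ⊆ S₀ := by
    refine (Metric.closedBall_subset_closedBall' ?_).trans hx
    rw [Metric.mem_closedBall] at hy
    nlinarith
  have hyS' : y ∈ S₀ := hyS (Metric.mem_closedBall_self (by positivity))
  have hVc : Continuous fun z => V 0 l z y := (hV.bijet.fst l hls y).cont 0 (by simp)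
  have hV0 : ∀ z, z ∉ Metric.closedBall y (ρ * t) → V 0 l z y = 0 := fun z hz =>
    hV.eq_zero (by simp) hls (by rwa [mem_closedBall_iff_norm, not_le] at hz)
  have hVs : HasCompactSupport fun z => V 0 l z y := hasCompactSupport_of_closedBall hV0
  -- The test function is smoother than the kernel is concentrated. Subtracting its Taylor
  -- polynomial at `y` gains `t^{|l|}`, which offsets the loss from `∂_2^l`; on the polynomial
  -- itself the moment bounds give `t^β` without loss.
  set P : Space d → ℝ := fun z => ∑ p ∈ poly d ((deg l : ℕ) : ℝ),
    monomial p (z - y) / mfactorial p * mderiv (k + p) (scale η x ε) y with hP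
  have hmc : ∀ p : Fin d → ℕ, Continuous fun z : Space d => monomial p (z - y) := fun p => by
    unfold monomial; fun_prop
  have hPc : Continuous P := by
    refine continuous_finsetSum _ fun p _ => ((hmc p).div_const _).mul_const _
  have hwc : Continuous (testDeriv k (scale η x ε)) := (testDeriv k (scale η x ε)).contDiff.continuous
  have hsplit : ∫ z, testDeriv k (scale η x ε) z * V 0 l z y =
      (∫ z, (testDeriv k (scale η x ε) z - P z) * V 0 l z y) + ∫ z, P z * V 0 l z y := by
    rw [← integral_add]
    · congr 1; funext z; ring
    · exact ((hwc.sub hPc).mul hVc).integrable_of_hasCompactSupport hVs.mul_left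
    · exact (hPc.mul hVc).integrable_of_hasCompactSupport hVs.mul_left
  have hrem : |∫ z, (testDeriv k (scale η x ε) z - P z) * V 0 l z y| ≤
      (d * (ρ * t)) ^ deg l * (D * (ε⁻¹) ^ (d + deg k + deg l)) * (c * t ^ (β - d - deg l)) *
        ((ρ * t) ^ d * volume.real (Metric.ball (0 : Space d) 1)) := by
    refine abs_integral_le_of_closedBall (z := y) (by positivity)
      (fun z hz => by rw [hV0 z hz, mul_zero]) fun z hz => ?_
    rw [abs_mul]
    rw [mem_closedBall_iff_norm] at hz
    refine mul_le_mul ?_ ?_ (abs_nonneg _) (by positivity)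
    · have h1 := ((isJet_test (scale η x ε) (deg k + deg l)).shift k le_rfl).taylor z y
        (M := D * (ε⁻¹) ^ (d + deg k + deg l)) (by positivity) fun p hp τ _ => by
          have := hη.abs_scale_le x hε (k := k + p) (by rw [deg_add]; omega) (y + τ • (z - y))
          rwa [deg_add, hp, ← add_assoc] at this
      simp only [add_zero] at h1
      rw [testDeriv_apply]
      refine h1.trans ?_
      gcongr
    · have := hV.bound 0 l (by simp) hls z (hyS (by rwa [mem_closedBall_iff_norm])) y hyS'
      simpa using this
  have hmain : |∫ z, P z * V 0 l z y| ≤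
      (poly d (r : ℝ)).card * (D * (ε⁻¹) ^ (d + deg k + deg l) * (c * t ^ β)) := by
    have h1 : ∫ z, P z * V 0 l z y = ∑ p ∈ poly d ((deg l : ℕ) : ℝ),
        (-1) ^ deg p / mfactorial p * mderiv (k + p) (scale η x ε) y *
          ∫ z, monomial p (y - z) * V 0 l z y := by
      simp only [hP, Finset.sum_mul]
      rw [integral_finsetSum]
      · refine Finset.sum_congr rfl fun p _ => ?_
        rw [← integral_const_mul]
        congr 1; funext z
        rw [← neg_sub y z, ← neg_one_smul ℝ (y - z), monomial_smul]
        ring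
      · exact fun p _ => ((((hmc p).div_const _).mul_const _).mul hVc).integrable_of_hasCompactSupport
          hVs.mul_left
    rw [h1]
    have hsub : poly d ((deg l : ℕ) : ℝ) ⊆ poly d (r : ℝ) := fun p hp => by
      rw [mem_poly_nat] at hp ⊢; omega
    calc _ ≤ ∑ p ∈ poly d ((deg l : ℕ) : ℝ), D * (ε⁻¹) ^ (d + deg k + deg l) * (c * t ^ β) := by
          refine (Finset.abs_sum_le_sum_abs _ _).trans (Finset.sum_le_sum fun p hp => ?_)
          rw [mem_poly_nat] at hp
          rw [abs_mul, abs_mul, abs_div, abs_pow, abs_neg, abs_one, one_pow]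
          have h2 : 1 / |(mfactorial p : ℝ)| ≤ 1 := by
            rw [Nat.abs_cast, div_le_one (by exact_mod_cast mfactorial_pos p)]
            exact_mod_cast mfactorial_pos p
          have h3 : |mderiv (k + p) (scale η x ε) y| ≤ D * (ε⁻¹) ^ (d + deg k + deg l) := by
            refine (hη.abs_scale_le x hε (by rw [deg_add]; omega) y).trans ?_
            rw [deg_add]
            gcongr D * ?_
            -- For `ε ≤ 1`, the lower Taylor coefficients obey the bound of the highest one.
            exact pow_le_pow_right₀ ((one_le_inv₀ hε).2 hε1) (by omega)
          refine mul_le_mul ?_ (hV.moment l p hls (by omega) y hyS') (abs_nonneg _) (by positivity)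
          calc _ ≤ 1 * (D * (ε⁻¹) ^ (d + deg k + deg l)) := by gcongr
            _ = _ := one_mul _
      _ = (poly d ((deg l : ℕ) : ℝ)).card * (D * (ε⁻¹) ^ (d + deg k + deg l) * (c * t ^ β)) := by
          rw [Finset.sum_const, nsmul_eq_mul]
      _ ≤ _ := by gcongr
  have hrem' : (d * (ρ * t)) ^ deg l * (D * (ε⁻¹) ^ (d + deg k + deg l)) * (c * t ^ (β - d - deg l)) *
        ((ρ * t) ^ d * volume.real (Metric.ball (0 : Space d) 1)) ≤
      max 1 (d * ρ) ^ r * (ρ ^ d * volume.real (Metric.ball (0 : Space d) 1)) *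
        (D * (ε⁻¹) ^ (d + deg k + deg l) * (c * t ^ β)) := by
    have h1 : (t : ℝ) ^ (β - d - deg l) * (t ^ deg l * t ^ d) = t ^ β := by
      rw [← Real.rpow_natCast, ← Real.rpow_natCast, ← Real.rpow_add ht, ← Real.rpow_add ht]
      congr 1; ring
    have h2 : (d * ρ : ℝ) ^ deg l ≤ max 1 (d * ρ) ^ r :=
      (pow_le_pow_left₀ (by positivity) (le_max_right _ _) _).trans
        (pow_le_pow_right₀ (le_max_left _ _) hl)
    calc _ = (d * ρ : ℝ) ^ deg l * (ρ ^ d * volume.real (Metric.ball (0 : Space d) 1)) *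
        (D * (ε⁻¹) ^ (d + deg k + deg l) * (c * (t ^ (β - d - deg l) * (t ^ deg l * t ^ d)))) := by
          rw [mul_pow, mul_pow, mul_pow, mul_pow]; ring
      _ ≤ _ := by rw [h1]; gcongr
  rw [hsplit]
  refine (abs_add_le _ _).trans ((add_le_add (hrem.trans hrem') hmain).trans (le_of_eq ?_))
  ring

end KernelBounds

/-! ### Dyadic scales -/

/-- The dyadic scale `2^{-n}`. -/
noncomputable def dyad (n : ℕ) : ℝ := (2 : ℝ)⁻¹ ^ n

theorem dyad_pos (n : ℕ) : 0 < dyad n := by unfold dyad; positivity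

theorem dyad_le_one (n : ℕ) : dyad n ≤ 1 := pow_le_one₀ (by norm_num) (by norm_num)

theorem dyad_add (n k : ℕ) : dyad (n + k) = dyad n * dyad k := pow_add _ _ _

theorem dyad_antitone : Antitone dyad := fun _ _ h =>
  pow_le_pow_of_le_one (by norm_num) (by norm_num) h

theorem dyad_rpow (n : ℕ) (v : ℝ) : dyad n ^ v = ((2 : ℝ) ^ (-v)) ^ n := by
  rw [dyad, ← Real.rpow_natCast, ← Real.rpow_natCast, Real.inv_rpow (by norm_num),
    Real.inv_rpow (by positivity), ← Real.rpow_mul (by norm_num), ← Real.rpow_mul (by norm_num),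
    ← Real.rpow_neg (by norm_num)]
  congr 1
  ring

theorem two_rpow_neg_lt_one {v : ℝ} (hv : 0 < v) : (2 : ℝ) ^ (-v) < 1 :=
  Real.rpow_lt_one_of_one_lt_of_neg (by norm_num) (by linarith)

theorem hasSum_dyad_rpow {v : ℝ} (hv : 0 < v) :
    HasSum (fun n => dyad n ^ v) (1 - (2 : ℝ) ^ (-v))⁻¹ := by
  simp only [dyad_rpow]
  exact hasSum_geometric_of_lt_one (by positivity) (two_rpow_neg_lt_one hv)

theorem exists_dyad_lt {κ : ℝ} (hκ : 0 < κ) : ∃ n₁, dyad n₁ < κ ∧ ∀ n < n₁, κ ≤ dyad n := by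
  classical
  have h : ∃ n, dyad n < κ := exists_pow_lt_of_lt_one hκ (by norm_num)
  exact ⟨Nat.find h, Nat.find_spec h, fun n hn => not_lt.1 (Nat.find_min h hn)⟩

/-- For a positive exponent the largest remaining scale dominates, and it is at most `κ`. -/
theorem abs_tsum_le_of_small {a : ℕ → ℝ} {v M κ : ℝ} (hv : 0 < v) (hM : 0 ≤ M) {n₁ : ℕ}
    (h : ∀ n, n₁ ≤ n → |a n| ≤ M * dyad n ^ v) (hκ : dyad n₁ ≤ κ) :
    |∑' n, a (n + n₁)| ≤ M * (κ ^ v * (1 - (2 : ℝ) ^ (-v))⁻¹) := by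
  have h1 := ((hasSum_dyad_rpow hv).mul_left (κ ^ v)).mul_left M
  rw [← Real.norm_eq_abs]
  refine tsum_of_norm_bounded (f := fun n => a (n + n₁)) h1 fun n => ?_
  refine (h (n + n₁) (Nat.le_add_left _ _)).trans ?_
  rw [dyad_add, Real.mul_rpow (dyad_pos _).le (dyad_pos _).le, mul_comm (dyad n ^ v)]
  have := dyad_pos n
  have := dyad_pos n₁
  gcongr

/-- For a negative exponent the smallest scale, that of `n₁ - 1`, dominates; summing backwards from
it gives a convergent geometric series. -/
theorem abs_sum_range_le_of_large {a : ℕ → ℝ} {v M κ : ℝ} (hv : v < 0) (hM : 0 ≤ M) (hκ0 : 0 < κ)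
    {n₁ : ℕ} (h : ∀ n < n₁, |a n| ≤ M * dyad n ^ v) (hκ : ∀ n < n₁, κ ≤ dyad n) :
    |∑ n ∈ Finset.range n₁, a n| ≤ M * (κ ^ v * (1 - (2 : ℝ) ^ v)⁻¹) := by
  have hv' : (2 : ℝ) ^ v < 1 := by simpa using two_rpow_neg_lt_one (neg_pos.2 hv)
  have hb : ∀ n < n₁, |a n| ≤ M * (κ ^ v * ((2 : ℝ) ^ v) ^ (n₁ - 1 - n)) := fun n hn => by
    refine (h n hn).trans ?_
    have h1 : dyad (n₁ - 1) = dyad n * dyad (n₁ - 1 - n) := by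
      rw [← dyad_add]; congr 1; omega
    have h2 : dyad n ^ v = dyad (n₁ - 1) ^ v * ((2 : ℝ) ^ v) ^ (n₁ - 1 - n) := by
      rw [h1, Real.mul_rpow (dyad_pos _).le (dyad_pos _).le, dyad_rpow (n₁ - 1 - n), mul_assoc,
        ← mul_pow, ← Real.rpow_add (by norm_num), neg_add_cancel, Real.rpow_zero, one_pow, mul_one]
    rw [h2]
    gcongr M * (?_ * _)
    exact Real.rpow_le_rpow_of_nonpos hκ0 (hκ _ (by omega)) hv.le
  calc |∑ n ∈ Finset.range n₁, a n| ≤ ∑ n ∈ Finset.range n₁, |a n| := Finset.abs_sum_le_sum_abs _ _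
    _ ≤ ∑ n ∈ Finset.range n₁, M * (κ ^ v * ((2 : ℝ) ^ v) ^ (n₁ - 1 - n)) :=
        Finset.sum_le_sum fun n hn => hb n (Finset.mem_range.1 hn)
    _ = M * (κ ^ v * ∑ n ∈ Finset.range n₁, ((2 : ℝ) ^ v) ^ n) := by
        rw [← Finset.mul_sum, ← Finset.mul_sum, Finset.sum_range_reflect (fun n => ((2 : ℝ) ^ v) ^ n)]
    _ ≤ _ := by
        gcongr
        rw [← tsum_geometric_of_lt_one (by positivity) hv']
        exact (summable_geometric_of_lt_one (by positivity) hv').sum_le_tsum _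
          fun _ _ => by positivity

/-! ### The kernels in the decomposition of a regularising kernel -/

/-- The mixed derivatives `∂_1^k ∂_2^l κ`. -/
noncomputable def kjet (κ : Space d → Space d → ℝ) (k l : Fin d → ℕ) (x y : Space d) : ℝ :=
  mderiv k (fun x' => mderiv l (κ x') y) x

theorem kjet_zero_zero (κ : Space d → Space d → ℝ) : kjet κ 0 0 = κ := by
  funext x y; simp [kjet]

theorem IsRegularisingKernel.exists_kernelBounds {β ρ : ℝ} {m s : ℕ} {K : Space d → Space d → ℝ}
    {Kn : ℕ → Space d → Space d → ℝ} (hK : IsRegularisingKernel β m s ρ K Kn)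
    {S₀ : Set (Space d)} (hS₀ : IsCompact S₀) :
    ∃ c, 0 < c ∧ ∀ n, KernelBounds m s β c ρ (dyad n) S₀ (kjet (Kn n)) := by
  obtain ⟨c, hc, h1, h2⟩ := hK.bound S₀ hS₀
  have e1 : ∀ (n : ℕ) (v : ℝ), dyad n ^ v = 2 ^ (-v * n) := fun n v => by
    rw [dyad_rpow, ← Real.rpow_natCast, ← Real.rpow_mul (by norm_num)]
  have e2 : ∀ n : ℕ, dyad n = 2 ^ (-(n : ℝ)) := fun n => by
    simpa using e1 n 1
  refine ⟨c, hc, fun n => ⟨(hK.smooth n).isBijet, fun x y h => ?_, fun k l hk hl x hx y hy => ?_,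
    fun l p hl hp y hy => ?_⟩⟩
  · rw [kjet_zero_zero]
    by_contra hne
    have := hK.support n x y hne
    rw [e2] at h
    linarith
  · rw [e1, show -(β - d - deg k - deg l) = d - β + deg l + deg k by ring]
    exact h1 n k l hk hl x hx y hy
  · rw [e1]
    simpa [kjet] using h2 n l p hl hp y hy

/-! ### Test functions with vanishing moments -/

/-- A normalised smooth bump function supported in the ball of radius `R`. -/
theorem exists_test_integral_eq_one (d : ℕ) {R : ℝ} (hR : 0 < R) :
    ∃ η : Test d, ∫ z, η z = 1 ∧ ∀ z, z ∉ Metric.closedBall (0 : Space d) R → η z = 0 := by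
  let b : ContDiffBump (0 : Space d) := ⟨R / 2, R, by positivity, by linarith⟩
  refine ⟨{ toFun := b.normed volume
            contDiff' := b.contDiff_normed
            hasCompactSupport' := b.hasCompactSupport_normed
            tsupport_subset' := fun _ _ => trivial }, b.integral_normed, fun z hz => ?_⟩
  change b.normed volume z = 0
  refine image_eq_zero_of_notMem_tsupport ?_
  rw [b.tsupport_normed_eq]
  exact hz

theorem continuous_monomial (p : Fin d → ℕ) : Continuous (monomial p : Space d → ℝ) := by
  unfold monomial; fun_prop

theorem integral_scale_mul_monomial (η : Test d) {ε : ℝ} (hε : 0 < ε) (l : Fin d → ℕ) :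
    ∫ z, scale η 0 ε z * monomial l z = ε ^ deg l * ∫ z, η z * monomial l z := by
  have h : ∀ z : Space d, scale η 0 ε z * monomial l z =
      (ε⁻¹) ^ d * (ε ^ deg l * (fun w => η w * monomial l w) (ε⁻¹ • z)) := fun z => by
    rw [scale_apply η 0 hε, sub_zero]
    simp only
    rw [monomial_smul]
    have : ε ^ deg l * (ε⁻¹) ^ deg l = 1 := by
      rw [← mul_pow, mul_inv_cancel₀ hε.ne', one_pow]
    linear_combination -(ε⁻¹) ^ d * η (ε⁻¹ • z) * monomial l z * this
  have h' : ∫ z, scale η 0 ε z * monomial l z =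
      ∫ z, (ε⁻¹) ^ d * (ε ^ deg l * (fun w => η w * monomial l w) (ε⁻¹ • z)) :=
    integral_congr_ae (Eventually.of_forall h)
  rw [h', integral_const_mul, integral_const_mul,
    Measure.integral_comp_inv_smul_of_nonneg volume (fun w => η w * monomial l w) hε.le,
    finrank_euclideanSpace_fin, smul_eq_mul, mul_left_comm (ε ^ deg l), ← mul_assoc ((ε⁻¹) ^ d), ← mul_pow, inv_mul_cancel₀ hε.ne', one_pow, one_mul]

theorem integrable_test_mul (η : Test d) {g : Space d → ℝ} (hg : Continuous g) :
    Integrable fun z => η z * g z :=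
  (η.contDiff.continuous.mul hg).integrable_of_hasCompactSupport η.hasCompactSupport.mul_right

/-- Richardson extrapolation: dilation by `2` multiplies moments of degree `l` by `2^l`, so an
affine combination of `η` and its dilate removes the next degree, while the moments already zero
stay zero. -/
theorem exists_test_moments (d N : ℕ) : ∃ η : Test d, ∫ z, η z = 1 ∧
    ∀ l : Fin d → ℕ, 1 ≤ deg l → deg l ≤ N → ∫ z, η z * monomial l z = 0 := by
  induction N with
  | zero =>
    obtain ⟨η, h, -⟩ := exists_test_integral_eq_one d one_pos
    exact ⟨η, h, fun l h1 h2 => by omega⟩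
  | succ N ih =>
    obtain ⟨η, h1, h2⟩ := ih
    have hne : (2 : ℝ) ^ (N + 1) - 1 ≠ 0 := by
      exact sub_ne_zero.2 (one_lt_pow₀ (one_lt_two (α := ℝ)) N.succ_ne_zero).ne'
    set a : ℝ := 2 ^ (N + 1) / (2 ^ (N + 1) - 1)
    set b : ℝ := -1 / (2 ^ (N + 1) - 1)
    have hab : a + b = 1 := by simp only [a, b]; field_simp; ring
    have key : ∀ g : Space d → ℝ, Continuous g → ∫ z, (a • η + b • scale η 0 2) z * g z =
        a * (∫ z, η z * g z) + b * (∫ z, scale η 0 2 z * g z) := fun g hg => by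
      rw [← integral_const_mul, ← integral_const_mul, ← integral_add
        ((integrable_test_mul η hg).const_mul _) ((integrable_test_mul _ hg).const_mul _)]
      congr 1; funext z
      simp only [FunLike.coe_add, FunLike.coe_smul, Pi.add_apply, Pi.smul_apply, smul_eq_mul]
      ring
    refine ⟨a • η + b • scale η 0 2, ?_, fun l hl hl' => ?_⟩
    · have := key (fun _ => 1) continuous_const
      simp only [mul_one] at this
      rw [this, integral_scale η 0 two_pos, h1, mul_one, mul_one, hab]
    · rw [key _ (continuous_monomial l), integral_scale_mul_monomial η two_pos]
      rcases hl'.lt_or_eq with h | h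
      · rw [h2 l hl (by omega)]; simp
      · rw [h]
        have : a + b * 2 ^ (N + 1) = 0 := by simp only [a, b]; field_simp; ring
        clear_value a b
        linear_combination (∫ z, η z * monomial l z) * this

/-! ### Pointwise derivatives of kernel integrals -/

theorem isExtension_extension {T : Distr d} {s : ℕ} (h : ∃ T' : DistrOfOrder d s, IsExtension s T T') :
    IsExtension s T (extension s T) := by
  rw [extension, dif_pos h]
  exact h.choose_spec

theorem HomAt.exists_isExtension {T : Distr d} {x : Space d} {a : ℝ} {r s : ℕ} (hrs : r ≤ s)
    (h : ∀ Λ, 1 ≤ Λ → ∃ A, HomAt T x a r Λ A) : ∃ T' : DistrOfOrder d s, IsExtension s T T' := by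
  refine MultilevelSchauder.exists_isExtension hrs (x := x) fun lam hlam => ?_
  obtain ⟨A, hA⟩ := h lam hlam
  exact ⟨A * lam ^ a, fun ψ hψ => hA lam (by linarith) le_rfl ψ hψ⟩

/-- The pointwise derivative is a choice among admissible values. It is unique because some test
function with the required moments exists, so that the defining condition is not vacuous. -/
theorem pointwiseDeriv_eq {δ : ℝ} {k : Fin d → ℕ} {f : Test d → ℝ} {x : Space d} {v : ℝ}
    (h : HasPointwiseDeriv δ k f x v) : pointwiseDeriv δ k f x = v := by
  have hex : ∃ v, HasPointwiseDeriv δ k f x v := ⟨v, h⟩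
  rw [pointwiseDeriv, dif_pos hex]
  obtain ⟨η, h1, h2⟩ := exists_test_moments d ⌈δ⌉₊
  have h3 : ∀ l : Fin d → ℕ, 1 ≤ deg l → (deg l : ℝ) < δ → ∫ z, η z * monomial l z = 0 :=
    fun l hl hl' => h2 l hl (by exact_mod_cast (Nat.lt_ceil.2 hl').le)
  exact tendsto_nhds_unique (hex.choose_spec η h1 h3) (h η h1 h3)

/-- Dominated convergence for the series over `n`: for fixed `n` the smoothed term tends to `T(∂_1^k
K_n(x, ·))`, and its size is controlled uniformly in `ε` whether `ε` lies below or above the kernel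
scale. The threshold `δ` is free, as both `α_j + β` and `γ + β` are needed. -/
theorem hasPointwiseDeriv_kernelInt {β ρ : ℝ} {m s r : ℕ} {K : Space d → Space d → ℝ}
    {Kn : ℕ → Space d → Space d → ℝ} (hK : IsRegularisingKernel β m s ρ K Kn) (hrs : r ≤ s)
    {T : Distr d} {x : Space d} {a : ℝ} (hT : ∀ Λ, 1 ≤ Λ → ∃ A, HomAt T x a r Λ A)
    {k : Fin d → ℕ} (hk : (deg k : ℝ) < a + β) (hkm : deg k + 1 ≤ m) (δ : ℝ) :
    HasPointwiseDeriv δ k (kernelInt Kn s T) x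
      (∑' n, extension s T (toTest s (kjet (Kn n) k 0 x))) := by
  intro η hη1 _
  have hρ := hK.range_pos
  obtain ⟨R, hR0, hR⟩ : ∃ R : ℝ, 0 < R ∧ ∀ z, z ∉ Metric.closedBall (0 : Space d) R → η z = 0 := by
    obtain ⟨R, hR⟩ := η.hasCompactSupport.isCompact.isBounded.subset_closedBall (0 : Space d)
    refine ⟨max R 1, by positivity, fun z hz => image_eq_zero_of_notMem_tsupport fun h => hz ?_⟩
    exact Metric.closedBall_subset_closedBall (le_max_left _ _) (hR h)
  obtain ⟨D, hD, hηD⟩ := exists_testBounds η (deg k + r) hR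
  obtain ⟨c, hc, hV⟩ := hK.exists_kernelBounds (isCompact_closedBall x (R + 2 * ρ))
  have hT' := isExtension_extension (HomAt.exists_isExtension hrs hT)
  set T' := extension s T
  set σ := R + ρ + 1
  obtain ⟨A, hA⟩ := hT σ (by simp only [σ]; linarith)
  have hA0 := hA.nonneg (by positivity)
  have hσ : R + ρ < σ := by simp only [σ]; linarith
  have hσ0 : 0 < σ := by positivity
  set ϖ := volume.real (Metric.ball (0 : Space d) 1)
  set f : ℝ → ℕ → ℝ := fun ε n =>
    (-1) ^ deg k * T' (toTest s (dualInt (Kn n) (testDeriv k (scale η x ε)))) with hf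
  have hfe : ∀ ε, distDeriv k (kernelInt Kn s T) (scale η x ε) = ∑' n, f ε n := fun ε => by
    rw [distDeriv, kernelInt, ← tsum_mul_left]
  simp only [hfe]
  set C₁ := max 1 σ ^ (d + r) * σ ^ a * (D * (R ^ d * ϖ) * c * A) with hC₁
  set C₂ := max 1 σ ^ (d + r) * σ ^ a *
        (c * D * (max 1 (d * ρ) ^ r * (ρ ^ d * ϖ) + (poly d (r : ℝ)).card) * A) with hC₂
  have hC₁0 : 0 ≤ C₁ := by positivity
  have hC₂0 : 0 ≤ C₂ := by positivity
  have habs : ∀ ε n, |f ε n| = |T' (toTest s (dualInt (Kn n) (testDeriv k (scale η x ε))))| :=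
    fun ε n => by simp only [hf]; rw [abs_mul, abs_pow, abs_neg, abs_one, one_pow, one_mul]
  have hexp : 0 < β - deg k + a := by linarith
  refine tendsto_tsum_of_dominated_convergence
    -- The second summand covers `ε ≤ 2^{-n}`. For `ε ≥ 2^{-n}` the bound `2^{-nβ} ε^{a-|k|}` is at
    -- most the first or the second summand, according to the sign of `a - |k|`.
    (bound := fun n => (C₁ + C₂) * (dyad n ^ β + dyad n ^ (β - deg k + a)))
    (((hasSum_dyad_rpow hK.beta_pos).summable.add (hasSum_dyad_rpow hexp).summable).mul_left _)
    (fun n => ?_) ?_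
  · rw [tendsto_iff_norm_sub_tendsto_zero]
    set B := max 1 σ ^ (d + r) * σ ^ a * (D * (R ^ d * ϖ) * (d * R) * c * A *
      dyad n ^ (β - deg k - 1 + a))
    have hB : Tendsto (fun ε : ℝ => B * ε) (𝓝[>] 0) (𝓝 0) := by
      have : Tendsto (fun ε : ℝ => B * ε) (𝓝 0) (𝓝 (B * 0)) := by
        exact (continuous_const.mul continuous_id).tendsto 0
      rw [mul_zero] at this
      exact this.mono_left nhdsWithin_le_nhds
    refine squeeze_zero' (Eventually.of_forall fun _ => norm_nonneg _) ?_ hB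
    filter_upwards [Ioc_mem_nhdsGT (dyad_pos n)] with ε hε
    have := (hV n).abs_smooth_sub_le hc.le hρ (dyad_pos n) (dyad_le_one n) hrs hT' hR0 hσ
      (mul_le_of_le_one_right hσ0.le (dyad_le_one n)) hA subset_rfl hηD hη1 hkm hε.1 hε.2
    rw [kjet_zero_zero] at this
    refine this.trans (le_of_eq ?_)
    simp only [B]
    ring
  · filter_upwards [Ioc_mem_nhdsGT one_pos] with ε hε n
    rw [Real.norm_eq_abs, habs]
    have hp1 := Real.rpow_pos_of_pos (dyad_pos n) β
    have hp2 := Real.rpow_pos_of_pos (dyad_pos n) (β - deg k + a)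
    rcases le_total ε (dyad n) with h | h
    · have := (hV n).abs_smooth_le_of_le hc.le hρ (dyad_pos n) (dyad_le_one n) hrs hT' hR0 hσ
        (mul_le_of_le_one_right hσ0.le (dyad_le_one n)) hA subset_rfl hηD (by omega : deg k ≤ m)
        hε.1 h
      rw [kjet_zero_zero] at this
      refine this.trans ?_
      rw [← mul_assoc, ← hC₁]
      nlinarith
    · have := (hV n).abs_smooth_le_of_ge hc.le hρ (dyad_pos n) hrs hT' hR0 hσ
        (mul_le_of_le_one_right hσ0.le hε.2) hA subset_rfl hηD le_rfl hε.1 hε.2 h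
      rw [kjet_zero_zero] at this
      have h1 : dyad n ^ β * ε ^ (-deg k + a) ≤ dyad n ^ β + dyad n ^ (β - deg k + a) := by
        rcases le_or_gt 0 (-deg k + a) with h0 | h0
        · have := Real.rpow_le_one hε.1.le hε.2 h0
          nlinarith
        · have h2 := Real.rpow_le_rpow_of_nonpos (dyad_pos n) h h0.le
          have h3 : dyad n ^ (β - deg k + a) = dyad n ^ β * dyad n ^ (-deg k + a) := by
            rw [← Real.rpow_add (dyad_pos n)]; congr 1; ring
          rw [h3]
          nlinarith
      calc _ ≤ _ := this
        _ = C₂ * (dyad n ^ β * ε ^ (-deg k + a)) := by rw [hC₂]; ring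
        _ ≤ C₂ * (dyad n ^ β + dyad n ^ (β - deg k + a)) := by gcongr
        _ ≤ _ := by nlinarith

/-! ### Multilevel Schauder estimate for linear data -/

/-- The contribution of the `n`-th kernel to the `k`-th derivative of `K T` at `x`. -/
noncomputable def kcoef (Kn : ℕ → Space d → Space d → ℝ) {s : ℕ} (T' : DistrOfOrder d s)
    (k : Fin d → ℕ) (x : Space d) (n : ℕ) : ℝ :=
  T' (toTest s (kjet (Kn n) k 0 x))

/-- The `n`-th kernel, integrated against the `k`-th derivative of a rescaled test function. -/
noncomputable def smoothCoef (Kn : ℕ → Space d → Space d → ℝ) {s : ℕ} (T' : DistrOfOrder d s)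
    (k : Fin d → ℕ) (φ : Test d) (n : ℕ) : ℝ :=
  T' (toTest s (dualInt (Kn n) (testDeriv k φ)))

/-! ### Summation over the scales below and above a threshold -/

section Pieces

variable {m s r : ℕ} {β c ρ Λ : ℝ} {S₀ : Set (Space d)} {Kn : ℕ → Space d → Space d → ℝ}

theorem abs_kcoef_le (hV : ∀ n, KernelBounds m s β c ρ (dyad n) S₀ (kjet (Kn n))) (hc : 0 ≤ c)
    (hρ : 0 < ρ) (hrs : r ≤ s) (hΛ : 2 * ρ ≤ Λ) {k : Fin d → ℕ} (hk : deg k ≤ m) {a A : ℝ}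
    {T : Distr d} {T' : DistrOfOrder d s} {x : Space d} (hT : IsExtension s T T')
    (hA : HomAt T x a r Λ A) (hx : Metric.closedBall x ρ ⊆ S₀) (n : ℕ) :
    |kcoef Kn T' k x n| ≤
      max 1 (2 * ρ) ^ (d + r) * (2 * ρ) ^ a * c * A * dyad n ^ (β - deg k + a) := by
  have h := (hV n).abs_kcoef_le hc hρ (dyad_pos n) hrs hT
    ((mul_le_of_le_one_right (by positivity) (dyad_le_one n)).trans hΛ) hA
    ((Metric.closedBall_subset_closedBall (mul_le_of_le_one_right hρ.le (dyad_le_one n))).trans hx) hk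
  refine h.trans (le_of_eq ?_)
  ring

theorem summable_kcoef (hV : ∀ n, KernelBounds m s β c ρ (dyad n) S₀ (kjet (Kn n))) (hc : 0 ≤ c)
    (hρ : 0 < ρ) (hrs : r ≤ s) (hΛ : 2 * ρ ≤ Λ) {k : Fin d → ℕ} (hk : deg k ≤ m) {a A : ℝ}
    (hv : 0 < β - deg k + a)
    {T : Distr d} {T' : DistrOfOrder d s} {x : Space d} (hT : IsExtension s T T')
    (hA : HomAt T x a r Λ A) (hx : Metric.closedBall x ρ ⊆ S₀) :
    Summable (kcoef Kn T' k x) :=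
  Summable.of_norm_bounded ((hasSum_dyad_rpow hv).summable.mul_left _)
    (abs_kcoef_le hV hc hρ hrs hΛ hk hT hA hx)

theorem mul_div_rpow {ρ h v : ℝ} (hρ : 0 < ρ) (hh : 0 < h) :
    (2 / ρ * h) ^ v = (2 / ρ) ^ v * h ^ v := Real.mul_rpow (by positivity) hh.le

theorem exists_tail_bound (hV : ∀ n, KernelBounds m s β c ρ (dyad n) S₀ (kjet (Kn n)))
    (hc : 0 ≤ c) (hρ : 0 < ρ) (hrs : r ≤ s) (hΛ : 2 * ρ ≤ Λ) {k : Fin d → ℕ} (hk : deg k ≤ m)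
    {a : ℝ} (hv : 0 < β - deg k + a) :
    ∃ C, 0 ≤ C ∧ ∀ (T : Distr d) (T' : DistrOfOrder d s) (x : Space d) (A h : ℝ) (n₁ : ℕ),
      IsExtension s T T' → HomAt T x a r Λ A → Metric.closedBall x ρ ⊆ S₀ → 0 < h →
      dyad n₁ ≤ 2 / ρ * h →
      |∑' n, kcoef Kn T' k x (n + n₁)| ≤ C * (A * h ^ (β - deg k + a)) := by
  have h1 := two_rpow_neg_lt_one hv
  refine ⟨max 1 (2 * ρ) ^ (d + r) * (2 * ρ) ^ a * c *
    ((2 / ρ) ^ (β - deg k + a) * (1 - (2 : ℝ) ^ (-(β - deg k + a)))⁻¹), ?_, ?_⟩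
  · have : 0 ≤ (1 - (2 : ℝ) ^ (-(β - deg k + a)))⁻¹ := inv_nonneg.2 (by linarith)
    positivity
  · intro T T' x A h n₁ hT hA hx hh hn₁
    have hA0 := hA.nonneg (by linarith)
    refine (abs_tsum_le_of_small hv (by positivity)
      (fun n _ => abs_kcoef_le hV hc hρ hrs hΛ hk hT hA hx n) hn₁).trans (le_of_eq ?_)
    rw [mul_div_rpow hρ hh]
    ring

theorem exists_large_bound (hV : ∀ n, KernelBounds m s β c ρ (dyad n) S₀ (kjet (Kn n)))
    (hc : 0 ≤ c) (hρ : 0 < ρ) (hrs : r ≤ s) (hΛ : 2 * ρ ≤ Λ) {k : Fin d → ℕ} (hk : deg k ≤ m)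
    {a : ℝ} (hv : β - deg k + a < 0) :
    ∃ C, 0 ≤ C ∧ ∀ (T : Distr d) (T' : DistrOfOrder d s) (x : Space d) (A h : ℝ) (n₁ : ℕ),
      IsExtension s T T' → HomAt T x a r Λ A → Metric.closedBall x ρ ⊆ S₀ → 0 < h →
      (∀ n < n₁, 2 / ρ * h ≤ dyad n) →
      |∑ n ∈ Finset.range n₁, kcoef Kn T' k x n| ≤ C * (A * h ^ (β - deg k + a)) := by
  have h1 := two_rpow_neg_lt_one (neg_pos.2 hv)
  rw [neg_neg] at h1
  refine ⟨max 1 (2 * ρ) ^ (d + r) * (2 * ρ) ^ a * c *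
    ((2 / ρ) ^ (β - deg k + a) * (1 - (2 : ℝ) ^ (β - deg k + a))⁻¹), ?_, ?_⟩
  · have : 0 ≤ (1 - (2 : ℝ) ^ (β - deg k + a))⁻¹ := inv_nonneg.2 (by linarith)
    positivity
  · intro T T' x A h n₁ hT hA hx hh hn₁
    have hA0 := hA.nonneg (by linarith)
    refine (abs_sum_range_le_of_large hv (by positivity) (by positivity)
      (fun n _ => abs_kcoef_le hV hc hρ hrs hΛ hk hT hA hx n) hn₁).trans (le_of_eq ?_)
    rw [mul_div_rpow hρ hh]
    ring

/-- At scales above `2|x - y|/ρ` the Taylor remainder turns the exponent negative, so the sum is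
dominated by the scales comparable to `|x - y|`. -/
theorem exists_taylor_bound (hV : ∀ n, KernelBounds m s β c ρ (dyad n) S₀ (kjet (Kn n)))
    (hc : 0 ≤ c) (hρ : 0 < ρ) (hrs : r ≤ s) (hΛ : 2 * ρ ≤ Λ) {k : Fin d → ℕ} {N : ℕ}
    (hk : deg k + N ≤ m) {a : ℝ} (hv : β - deg k - N + a < 0) :
    ∃ C, 0 ≤ C ∧ ∀ (T : Distr d) (T' : DistrOfOrder d s) (x y : Space d) (A : ℝ) (n₁ : ℕ),
      IsExtension s T T' → HomAt T y a r Λ A → Metric.closedBall y (2 * ρ) ⊆ S₀ → 0 < ‖x - y‖ →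
      (∀ n < n₁, 2 / ρ * ‖x - y‖ ≤ dyad n) →
      |∑ n ∈ Finset.range n₁, (kcoef Kn T' k x n - ∑ p ∈ poly d (N : ℝ),
        monomial p (x - y) / mfactorial p * kcoef Kn T' (k + p) y n)| ≤
          C * (A * ‖x - y‖ ^ (β - deg k + a)) := by
  have h1 := two_rpow_neg_lt_one (neg_pos.2 hv)
  rw [neg_neg] at h1
  refine ⟨max 1 (2 * ρ) ^ (d + r) * (2 * ρ) ^ a * (d : ℝ) ^ N * c *
    ((2 / ρ) ^ (β - deg k - N + a) * (1 - (2 : ℝ) ^ (β - deg k - N + a))⁻¹), ?_, ?_⟩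
  · have : 0 ≤ (1 - (2 : ℝ) ^ (β - deg k - N + a))⁻¹ := inv_nonneg.2 (by linarith)
    positivity
  · intro T T' x y A n₁ hT hA hy hh hn₁
    have hA0 := hA.nonneg (by linarith)
    refine (abs_sum_range_le_of_large
      (M := max 1 (2 * ρ) ^ (d + r) * (2 * ρ) ^ a * ((d * ‖x - y‖) ^ N * c * A))
      hv (by positivity) (by positivity : 0 < 2 / ρ * ‖x - y‖) (fun n hn => ?_) hn₁).trans
        (le_of_eq ?_)
    · have hd1 := dyad_le_one n
      have h2 := (hV n).abs_taylor_le hc hρ (dyad_pos n) hrs hT (x := x) (y := y)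
        ((mul_le_of_le_one_right (by positivity) hd1).trans hΛ) hA
        ((Metric.closedBall_subset_closedBall (mul_le_of_le_one_right (by positivity) hd1)).trans hy)
        (by have := hn₁ n hn
            rw [div_mul_eq_mul_div, div_le_iff₀ hρ] at this
            linarith) hk
      refine h2.trans (le_of_eq ?_)
      ring
    · have h3 : ‖x - y‖ ^ (β - deg k + a) = ‖x - y‖ ^ N * ‖x - y‖ ^ (β - deg k - N + a) := by
        rw [← Real.rpow_natCast, ← Real.rpow_add hh]; congr 1; ring
      rw [mul_div_rpow hρ hh, h3, mul_pow]
      ring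

theorem summable_smoothCoef (hV : ∀ n, KernelBounds m s β c ρ (dyad n) S₀ (kjet (Kn n)))
    (hβ : 0 < β) (hc : 0 ≤ c) (hρ : 0 < ρ) (hrs : r ≤ s) (hΛ : 2 * ρ ≤ Λ) {k : Fin d → ℕ}
    {a A R D : ℝ} {T : Distr d} {T' : DistrOfOrder d s} {x : Space d} (hT : IsExtension s T T')
    (hA : HomAt T x a r Λ A) (hR : 0 < R) (hRρ : R < ρ) (hx : Metric.closedBall x (3 * ρ) ⊆ S₀)
    {η : Test d} {N : ℕ} (hη : TestBounds η R D N) (hk : deg k + r ≤ N) {ε : ℝ} (hε : 0 < ε)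
    (hε1 : ε ≤ 1) : Summable (smoothCoef Kn T' k (scale η x ε)) := by
  obtain ⟨n₁, hn₁, -⟩ := exists_dyad_lt hε
  refine Summable.of_norm_bounded_eventually_nat
    ((hasSum_dyad_rpow hβ).summable.mul_left (max 1 (2 * ρ) ^ (d + r) * (2 * ρ) ^ a *
        (c * D * (max 1 (d * ρ) ^ r * (ρ ^ d * volume.real (Metric.ball (0 : Space d) 1)) +
          (poly d (r : ℝ)).card) * A * ε ^ (-deg k + a)))) ?_
  filter_upwards [eventually_ge_atTop n₁] with n hn
  have := (hV n).abs_smooth_le_of_ge hc hρ (dyad_pos n) hrs hT (σ := 2 * ρ) hR (by linarith)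
    ((mul_le_of_le_one_right (by positivity) hε1).trans hΛ) hA
    ((Metric.closedBall_subset_closedBall (by linarith)).trans hx) hη hk hε hε1
    ((dyad_antitone hn).trans hn₁.le)
  rw [kjet_zero_zero] at this
  refine this.trans (le_of_eq ?_)
  ring

/-- Bound in the borderline case `|k| = a + β`. -/
theorem exists_borderline_bound (hV : ∀ n, KernelBounds m s β c ρ (dyad n) S₀ (kjet (Kn n)))
    (hβ : 0 < β) (hc : 0 ≤ c) (hρ : 0 < ρ) (hrs : r ≤ s) (hΛ : 2 * ρ ≤ Λ) {k : Fin d → ℕ}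
    (hk : deg k + 1 ≤ m) {a : ℝ} (hv : (deg k : ℝ) = a + β)
    {R D : ℝ} (hR : 0 < R) (hRρ : R < ρ)
    {η : Test d} {N : ℕ} (hη : TestBounds η R D N) (hkN : deg k + r ≤ N) (hη1 : ∫ z, η z = 1) :
    ∃ C, 0 ≤ C ∧ ∀ (T : Distr d) (T' : DistrOfOrder d s) (x : Space d) (A : ℝ) (n₁ : ℕ),
      IsExtension s T T' → HomAt T x a r Λ A → Metric.closedBall x (3 * ρ) ⊆ S₀ →
      (∀ ε, 0 < ε → ε ≤ 1 → HasSum (smoothCoef Kn T' k (scale η x ε)) 0) →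
      |∑ n ∈ Finset.range n₁, kcoef Kn T' k x n| ≤ C * A := by
  set ϖ := volume.real (Metric.ball (0 : Space d) 1) with hϖ
  have hD := hη.nonneg
  have hβ1 := two_rpow_neg_lt_one hβ
  set C₁ := max 1 (2 * ρ) ^ (d + r) * (2 * ρ) ^ a * (D * (R ^ d * ϖ) * (d * R) * c) with hC₁
  set C₂ := max 1 (2 * ρ) ^ (d + r) * (2 * ρ) ^ a *
        (c * D * (max 1 (d * ρ) ^ r * (ρ ^ d * ϖ) + (poly d (r : ℝ)).card)) with hC₂
  have hC₁0 : 0 ≤ C₁ := by positivity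
  have hC₂0 : 0 ≤ C₂ := by positivity
  have hi1 : 0 ≤ (1 - (2 : ℝ) ^ (-β))⁻¹ := inv_nonneg.2 (by linarith)
  have hi2 : 0 ≤ (1 - (2 : ℝ) ^ (-1 : ℝ))⁻¹ := inv_nonneg.2 (by
    have := two_rpow_neg_lt_one one_pos; linarith)
  refine ⟨C₁ * (1 - (2 : ℝ) ^ (-1 : ℝ))⁻¹ + C₂ * (1 - (2 : ℝ) ^ (-β))⁻¹, by positivity, ?_⟩
  intro T T' x A n₁ hT hA hx hsum
  have hA0 := hA.nonneg (by linarith)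
  rcases n₁ with - | n₀
  · simp only [Finset.range_zero, Finset.sum_empty, abs_zero]; positivity
  -- The smallest scale in the sum. With `|k| = a + β`, smoothing at `ε` changes the `n`-th term by
  -- `O(ε 2^n)` for `n ≤ n₀` and leaves `O((2^{-n}/ε)^β)` for `n > n₀`; both are geometric.
  set ε := dyad n₀ with hε
  have hε0 := dyad_pos n₀
  have hε1 := dyad_le_one n₀
  have hx' := (Metric.closedBall_subset_closedBall (by linarith : R + 2 * ρ ≤ 3 * ρ)).trans hx
  have hs := hsum ε hε0 hε1
  set f := smoothCoef Kn T' k (scale η x ε) with hf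
  -- The full smoothed series is zero, so its part over `n ≤ n₀` is minus its tail.
  have h1 : ∑ n ∈ Finset.range (n₀ + 1), kcoef Kn T' k x n =
      -(∑ n ∈ Finset.range (n₀ + 1), ((-1) ^ deg k * f n - kcoef Kn T' k x n)) -
        (-1) ^ deg k * ∑' n, f (n + (n₀ + 1)) := by
    have := hs.summable.sum_add_tsum_nat_add (n₀ + 1)
    rw [hs.tsum_eq] at this
    rw [Finset.sum_sub_distrib, ← Finset.mul_sum]
    linear_combination (-1) ^ deg k * this
  have h2 : |∑ n ∈ Finset.range (n₀ + 1), ((-1) ^ deg k * f n - kcoef Kn T' k x n)| ≤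
      C₁ * A * ε * (ε ^ (-1 : ℝ) * (1 - (2 : ℝ) ^ (-1 : ℝ))⁻¹) := by
    refine abs_sum_range_le_of_large (by norm_num) (by positivity) hε0 (fun n hn => ?_)
      fun n hn => dyad_antitone (by omega)
    have := (hV n).abs_smooth_sub_le hc hρ (dyad_pos n) (dyad_le_one n) hrs hT (σ := 2 * ρ) hR
      (by linarith) ((mul_le_of_le_one_right (by positivity) (dyad_le_one n)).trans hΛ) hA hx'
      hη hη1 hk hε0 (dyad_antitone (by omega))
    rw [kjet_zero_zero, show β - deg k - 1 + a = -1 by linarith] at this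
    refine this.trans (le_of_eq ?_)
    rw [hC₁]; ring
  have h3 : |∑' n, f (n + (n₀ + 1))| ≤ C₂ * A * ε ^ (-β) * (ε ^ β * (1 - (2 : ℝ) ^ (-β))⁻¹) := by
    refine abs_tsum_le_of_small hβ (by positivity) (fun n hn => ?_) (dyad_antitone n₀.le_succ)
    have := (hV n).abs_smooth_le_of_ge hc hρ (dyad_pos n) hrs hT (σ := 2 * ρ) hR
      (by linarith) ((mul_le_of_le_one_right (by positivity) hε1).trans hΛ) hA hx'
      hη hkN hε0 hε1 (dyad_antitone (by omega))
    rw [kjet_zero_zero, show -(deg k : ℝ) + a = -β by linarith] at this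
    refine this.trans (le_of_eq ?_)
    rw [hC₂]; ring
  have h4 : ε * ε ^ (-1 : ℝ) = 1 := by rw [Real.rpow_neg_one, mul_inv_cancel₀ hε0.ne']
  have h5 : ε ^ (-β) * ε ^ β = 1 := by rw [← Real.rpow_add hε0, neg_add_cancel, Real.rpow_zero]
  rw [h1]
  refine (abs_sub _ _).trans ?_
  rw [abs_neg, abs_mul, abs_pow, abs_neg, abs_one, one_pow, one_mul]
  refine (add_le_add h2 h3).trans (le_of_eq ?_)
  linear_combination C₁ * A * (1 - (2 : ℝ) ^ (-1 : ℝ))⁻¹ * h4 + C₂ * A * (1 - (2 : ℝ) ^ (-β))⁻¹ * h5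

/-- Turns the real threshold into the integer order of Taylor's formula. The truncated subtraction
is harmless: if `⌈t⌉₊ ≤ |k|`, both sets are empty. -/
theorem poly_sub_deg (t : ℝ) {k : Fin d → ℕ} :
    poly d (t - deg k) = poly d ((⌈t⌉₊ - deg k : ℕ) : ℝ) := by
  ext p
  rw [mem_poly, mem_poly_nat, lt_sub_iff_add_lt, ← Nat.cast_add, ← Nat.lt_ceil]
  omega

variable {I : Type*} [Fintype I]

/-- The multilevel Schauder estimate for a single derivative. -/
theorem exists_schauder_bound (hV : ∀ n, KernelBounds m s β c ρ (dyad n) S₀ (kjet (Kn n)))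
    (hβ : 0 < β) (hc : 0 ≤ c) (hρ : 0 < ρ) (hrs : r ≤ s) (hΛ : 2 * ρ ≤ Λ) (α : I → ℝ) {γ : ℝ}
    (hγβ : ∀ n : ℕ, γ + β ≠ n) (hm : γ + β < m)
    {k : Fin d → ℕ} (hk : (deg k : ℝ) < γ + β)
    {R D : ℝ} (hR : 0 < R) (hRρ : R < ρ)
    {η : Test d} {N : ℕ} (hη : TestBounds η R D N) (hkN : deg k + r ≤ N) (hη1 : ∫ z, η z = 1) :
    ∃ C, 0 ≤ C ∧ ∀ (Q : I → Distr d) (Q' : I → DistrOfOrder d s) (Gx Gy : Distr d)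
      (Gx' Gy' : DistrOfOrder d s) (x y : Space d) (E : ℝ),
      (∀ j, IsExtension s (Q j) (Q' j)) → IsExtension s Gx Gx' → IsExtension s Gy Gy' →
      (∀ j, HomAt (Q j) x (α j) r Λ (E * ‖x - y‖ ^ (γ - α j))) →
      HomAt Gx x γ r Λ E → HomAt Gy y γ r Λ E → Gy' = Gx' + ∑ j, Q' j →
      Metric.closedBall x (3 * ρ) ⊆ S₀ → Metric.closedBall y (3 * ρ) ⊆ S₀ → 0 < ‖x - y‖ →
      (∀ j, (deg k : ℝ) = α j + β → ∀ ε, 0 < ε → ε ≤ 1 →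
        HasSum (smoothCoef Kn (Q' j) k (scale η x ε)) 0) →
      |∑ j ∈ Finset.univ.filter (fun j => (deg k : ℝ) < α j + β), ∑' n, kcoef Kn (Q' j) k x n +
        ∑' n, kcoef Kn Gx' k x n -
        ∑ p ∈ poly d (γ + β - deg k), monomial p (x - y) / mfactorial p *
          ∑' n, kcoef Kn Gy' (k + p) y n| ≤ C * (E * ‖x - y‖ ^ (γ + β - deg k)) := by
  have hkm : deg k + 1 ≤ m := by
    have : (deg k : ℝ) < m := hk.trans hm
    exact_mod_cast this
  -- Strict because `γ + β` is not an integer: the Taylor order exceeds `γ + β - |k|`, as the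
  -- summation over large scales requires.
  have hN1 : γ + β < (⌈γ + β⌉₊ : ℕ) := lt_of_le_of_ne (Nat.le_ceil _) (hγβ _)
  have hN2 : ⌈γ + β⌉₊ ≤ m := Nat.ceil_le.2 hm.le
  have hN3 : deg k < ⌈γ + β⌉₊ := Nat.lt_ceil.2 hk
  have hN4 : ((⌈γ + β⌉₊ - deg k : ℕ) : ℝ) = ⌈γ + β⌉₊ - deg k := Nat.cast_sub hN3.le
  have hp : ∀ p ∈ poly d (γ + β - deg k), deg (k + p) ≤ m ∧ 0 < β - deg (k + p) + γ := by
    intro p hp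
    rw [mem_poly] at hp
    have h1 : (deg (k + p) : ℝ) < γ + β := by rw [deg_add]; push_cast; linarith
    have h2 : (deg (k + p) : ℝ) < m := h1.trans hm
    exact ⟨by exact_mod_cast h2.le, by linarith⟩
  have ha : ∀ j, ∃ C, 0 ≤ C ∧ ((deg k : ℝ) < α j + β →
      ∀ (T : Distr d) (T' : DistrOfOrder d s) (x : Space d) (A h : ℝ) (n₁ : ℕ),
      IsExtension s T T' → HomAt T x (α j) r Λ A → Metric.closedBall x ρ ⊆ S₀ → 0 < h →
      dyad n₁ ≤ 2 / ρ * h →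
      |∑' n, kcoef Kn T' k x (n + n₁)| ≤ C * (A * h ^ (β - deg k + α j))) := fun j => by
    by_cases hj : (deg k : ℝ) < α j + β
    · obtain ⟨C, hC, h⟩ := exists_tail_bound hV hc hρ hrs hΛ (by omega : deg k ≤ m) (a := α j)
        (by linarith)
      exact ⟨C, hC, fun _ => h⟩
    · exact ⟨0, le_rfl, fun h => absurd h hj⟩
  have hb : ∀ j, ∃ C, 0 ≤ C ∧ (¬ (deg k : ℝ) < α j + β →
      ∀ (T : Distr d) (T' : DistrOfOrder d s) (x : Space d) (A h : ℝ) (n₁ : ℕ),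
      IsExtension s T T' → HomAt T x (α j) r Λ A → Metric.closedBall x (3 * ρ) ⊆ S₀ → 0 < h →
      (∀ n < n₁, 2 / ρ * h ≤ dyad n) →
      ((deg k : ℝ) = α j + β → ∀ ε, 0 < ε → ε ≤ 1 →
        HasSum (smoothCoef Kn T' k (scale η x ε)) 0) →
      |∑ n ∈ Finset.range n₁, kcoef Kn T' k x n| ≤ C * (A * h ^ (β - deg k + α j))) := fun j => by
    rcases lt_trichotomy (deg k : ℝ) (α j + β) with hj | hj | hj
    · exact ⟨0, le_rfl, fun h => absurd hj h⟩
    · obtain ⟨C, hC, h⟩ := exists_borderline_bound hV hβ hc hρ hrs hΛ hkm hj hR hRρ hη hkN hη1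
      refine ⟨C, hC, fun _ T T' x A h' n₁ hT hA hx _ _ hsum => ?_⟩
      rw [show β - deg k + α j = 0 by linarith, Real.rpow_zero, mul_one]
      exact h T T' x A n₁ hT hA hx (hsum hj)
    · obtain ⟨C, hC, h⟩ := exists_large_bound hV hc hρ hrs hΛ (by omega : deg k ≤ m) (a := α j)
        (by linarith)
      exact ⟨C, hC, fun _ T T' x A h' n₁ hT hA hx hh hn₁ _ => h T T' x A h' n₁ hT hA
        ((Metric.closedBall_subset_closedBall (by linarith)).trans hx) hh hn₁⟩
  obtain ⟨Cg, hCg0, hCg⟩ := exists_tail_bound hV hc hρ hrs hΛ (by omega : deg k ≤ m) (a := γ)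
    (by linarith)
  have hq : ∀ p, ∃ C, 0 ≤ C ∧ (p ∈ poly d (γ + β - deg k) →
      ∀ (T : Distr d) (T' : DistrOfOrder d s) (x : Space d) (A h : ℝ) (n₁ : ℕ),
      IsExtension s T T' → HomAt T x γ r Λ A → Metric.closedBall x ρ ⊆ S₀ → 0 < h →
      dyad n₁ ≤ 2 / ρ * h →
      |∑' n, kcoef Kn T' (k + p) x (n + n₁)| ≤ C * (A * h ^ (β - deg (k + p) + γ))) := fun p => by
    by_cases h : p ∈ poly d (γ + β - deg k)
    · obtain ⟨C, hC, h⟩ := exists_tail_bound hV hc hρ hrs hΛ (hp p h).1 (hp p h).2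
      exact ⟨C, hC, fun _ => h⟩
    · exact ⟨0, le_rfl, fun h' => absurd h' h⟩
  obtain ⟨Ct, hCt0, hCt⟩ := exists_taylor_bound hV hc hρ hrs hΛ (k := k) (N := ⌈γ + β⌉₊ - deg k)
    (by omega) (a := γ) (by rw [hN4]; linarith)
  choose Ca hCa0 hCa using ha
  choose Cb hCb0 hCb using hb
  choose Cq hCq0 hCq using hq
  refine ⟨∑ j, Ca j + Cg + ∑ p ∈ poly d (γ + β - deg k), Cq p + (Ct + ∑ j, Cb j), ?_, ?_⟩
  · have h1 := Finset.sum_nonneg fun j (_ : j ∈ Finset.univ) => hCa0 j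
    have h2 := Finset.sum_nonneg fun j (_ : j ∈ Finset.univ) => hCb0 j
    have h3 := Finset.sum_nonneg fun p (_ : p ∈ poly d (γ + β - deg k)) => hCq0 p
    positivity
  intro Q Q' Gx Gy Gx' Gy' x y E hQ hGx hGy hQA hGxA hGyA hlin hx hy hh hlog
  set h := ‖x - y‖ with hhdef
  have hE0 := hGxA.nonneg (by linarith)
  set e := γ + β - deg k with he
  have hx1 := (Metric.closedBall_subset_closedBall (by linarith : ρ ≤ 3 * ρ)).trans hx
  have hy1 := (Metric.closedBall_subset_closedBall (by linarith : ρ ≤ 3 * ρ)).trans hy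
  have hy2 := (Metric.closedBall_subset_closedBall (by linarith : 2 * ρ ≤ 3 * ρ)).trans hy
  -- For `n < n₁` one has `2|x - y| ≤ ρ 2^{-n}`, as the Taylor estimate needs. If `2h/ρ > 1`, then
  -- `n₁ = 0` and there are no large scales.
  obtain ⟨n₁, hn₁, hn₁'⟩ := exists_dyad_lt (by positivity : 0 < 2 / ρ * h)
  have hexp : ∀ j, E * h ^ (γ - α j) * h ^ (β - deg k + α j) = E * h ^ e := fun j => by
    rw [mul_assoc, ← Real.rpow_add hh]; congr 2; rw [he]; ring
  have hsa : ∀ j ∈ Finset.univ.filter (fun j => (deg k : ℝ) < α j + β),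
      ∑' n, kcoef Kn (Q' j) k x n = ∑ n ∈ Finset.range n₁, kcoef Kn (Q' j) k x n +
        ∑' n, kcoef Kn (Q' j) k x (n + n₁) := fun j hj =>
    ((summable_kcoef hV hc hρ hrs hΛ (by omega) (by
      have := (Finset.mem_filter.1 hj).2; linarith) (hQ j) (hQA j) hx1).sum_add_tsum_nat_add n₁).symm
  have hsg : ∑' n, kcoef Kn Gx' k x n = ∑ n ∈ Finset.range n₁, kcoef Kn Gx' k x n +
        ∑' n, kcoef Kn Gx' k x (n + n₁) :=
    ((summable_kcoef hV hc hρ hrs hΛ (by omega) (by linarith) hGx hGxA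
      hx1).sum_add_tsum_nat_add n₁).symm
  have hsq : ∀ p ∈ poly d e, monomial p (x - y) / mfactorial p * ∑' n, kcoef Kn Gy' (k + p) y n =
      ∑ n ∈ Finset.range n₁, monomial p (x - y) / mfactorial p * kcoef Kn Gy' (k + p) y n +
        monomial p (x - y) / mfactorial p * ∑' n, kcoef Kn Gy' (k + p) y (n + n₁) := fun p h => by
    rw [← Finset.mul_sum, ← mul_add, (summable_kcoef hV hc hρ hrs hΛ (hp p h).1 (hp p h).2 hGy hGyA
      hy1).sum_add_tsum_nat_add n₁]
  rw [Finset.sum_congr rfl hsa, hsg, Finset.sum_congr rfl hsq, Finset.sum_add_distrib,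
    Finset.sum_add_distrib]
  -- At large scales `G_y = G_x + Σ_j Q_j` trades the terms with `α_j + β > |k|` for the Taylor
  -- remainder of `G_y` and the terms with `α_j + β ≤ |k|`, whose sums are controlled there.
  have hkey : ∑ j ∈ Finset.univ.filter (fun j => (deg k : ℝ) < α j + β),
        ∑ n ∈ Finset.range n₁, kcoef Kn (Q' j) k x n + ∑ n ∈ Finset.range n₁, kcoef Kn Gx' k x n -
      ∑ p ∈ poly d e, ∑ n ∈ Finset.range n₁,
        monomial p (x - y) / mfactorial p * kcoef Kn Gy' (k + p) y n =
      ∑ n ∈ Finset.range n₁, (kcoef Kn Gy' k x n -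
        ∑ p ∈ poly d ((⌈γ + β⌉₊ - deg k : ℕ) : ℝ),
          monomial p (x - y) / mfactorial p * kcoef Kn Gy' (k + p) y n) -
      ∑ j ∈ Finset.univ.filter (fun j => ¬ (deg k : ℝ) < α j + β),
        ∑ n ∈ Finset.range n₁, kcoef Kn (Q' j) k x n := by
    have h1 : ∀ n, kcoef Kn Gy' k x n = kcoef Kn Gx' k x n + ∑ j, kcoef Kn (Q' j) k x n := fun n => by
      simp only [kcoef, hlin]
      simp
    rw [Finset.sum_sub_distrib, ← poly_sub_deg, ← he, Finset.sum_comm (s := poly d e)]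
    simp only [h1]
    rw [Finset.sum_add_distrib, Finset.sum_comm (s := Finset.range n₁) (t := Finset.univ),
      ← Finset.sum_filter_add_sum_filter_not Finset.univ (fun j => (deg k : ℝ) < α j + β)
        (fun j => ∑ n ∈ Finset.range n₁, kcoef Kn (Q' j) k x n)]
    ring
  have b1 : |∑ j ∈ Finset.univ.filter (fun j => (deg k : ℝ) < α j + β),
      ∑' n, kcoef Kn (Q' j) k x (n + n₁)| ≤ (∑ j, Ca j) * (E * h ^ e) := by
    rw [Finset.sum_mul]
    refine (Finset.abs_sum_le_sum_abs _ _).trans (le_trans (Finset.sum_le_sum fun j hj => ?_)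
      (Finset.sum_le_sum_of_subset_of_nonneg (Finset.filter_subset _ _)
        fun j _ _ => mul_nonneg (hCa0 j) (by positivity)))
    rw [← hexp j]
    exact hCa j (Finset.mem_filter.1 hj).2 _ _ x _ h n₁ (hQ j) (hQA j) hx1 hh hn₁.le
  have b2 : |∑' n, kcoef Kn Gx' k x (n + n₁)| ≤ Cg * (E * h ^ e) := by
    rw [show e = β - deg k + γ by rw [he]; ring]
    exact hCg _ _ x _ h n₁ hGx hGxA hx1 hh hn₁.le
  have b3 : |∑ p ∈ poly d e, monomial p (x - y) / mfactorial p *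
      ∑' n, kcoef Kn Gy' (k + p) y (n + n₁)| ≤ (∑ p ∈ poly d e, Cq p) * (E * h ^ e) := by
    rw [Finset.sum_mul]
    refine (Finset.abs_sum_le_sum_abs _ _).trans (Finset.sum_le_sum fun p hpp => ?_)
    rw [abs_mul, abs_div, Nat.abs_cast]
    have h1 : |monomial p (x - y)| / (mfactorial p : ℝ) ≤ h ^ deg p := by
      refine (div_le_self (abs_nonneg _) ?_).trans (abs_monomial_le p _)
      exact_mod_cast mfactorial_pos p
    have h2 := hCq p hpp _ _ y _ h n₁ hGy hGyA hy1 hh hn₁.le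
    refine (mul_le_mul h1 h2 (abs_nonneg _) (by positivity)).trans (le_of_eq ?_)
    have h3 : h ^ e = h ^ deg p * h ^ (β - deg (k + p) + γ) := by
      rw [← Real.rpow_natCast, ← Real.rpow_add hh, deg_add, he]; congr 1; push_cast; ring
    rw [h3]; ring
  have b4 : |∑ n ∈ Finset.range n₁, (kcoef Kn Gy' k x n -
        ∑ p ∈ poly d ((⌈γ + β⌉₊ - deg k : ℕ) : ℝ),
          monomial p (x - y) / mfactorial p * kcoef Kn Gy' (k + p) y n)| ≤ Ct * (E * h ^ e) := by
    rw [show e = β - deg k + γ by rw [he]; ring]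
    exact hCt _ _ x y _ n₁ hGy hGyA hy2 hh hn₁'
  have b5 : |∑ j ∈ Finset.univ.filter (fun j => ¬ (deg k : ℝ) < α j + β),
        ∑ n ∈ Finset.range n₁, kcoef Kn (Q' j) k x n| ≤ (∑ j, Cb j) * (E * h ^ e) := by
    rw [Finset.sum_mul]
    refine (Finset.abs_sum_le_sum_abs _ _).trans (le_trans (Finset.sum_le_sum fun j hj => ?_)
      (Finset.sum_le_sum_of_subset_of_nonneg (Finset.filter_subset _ _)
        fun j _ _ => mul_nonneg (hCb0 j) (by positivity)))
    rw [← hexp j]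
    exact hCb j (Finset.mem_filter.1 hj).2 _ _ x _ h n₁ (hQ j) (hQA j) hx hh hn₁' (hlog j)
  rw [abs_le] at *
  constructor <;> linarith

end Pieces

section

/-! ### Real bounds from seminorms -/

theorem abs_le_of_homSeminorm_le {F : Space d → Test d → ℝ} {S : Set (Space d)} {Λ a M : ℝ} {r : ℕ}
    (hM : 0 ≤ M) (h : homSeminorm F S Λ r a ≤ ENNReal.ofReal M) {x : Space d} (hx : x ∈ S) {ε : ℝ}
    (hε : 0 < ε) (hεΛ : ε ≤ Λ) {φ : Test d} (hφ : φ ∈ unitTest d r) :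
    |F x (scale φ x ε)| ≤ M * ε ^ a := by
  simp only [homSeminorm, iSup_le_iff] at h
  have := h x hx ε ⟨hε, hεΛ⟩ φ hφ
  rwa [ENNReal.ofReal_le_ofReal_iff hM, div_le_iff₀ (Real.rpow_pos_of_pos hε a)] at this

theorem homBound_of_homSeminorm_lt_top {G : Space d → Distr d} {S : Set (Space d)} {Λ a : ℝ} {r : ℕ}
    (h : homSeminorm (fun x φ => G x φ) S Λ r a < ⊤) :
    HomBound G a r S Λ (homSeminorm (fun x φ => G x φ) S Λ r a).toReal :=
  fun _ hx _ hε hεΛ _ hφ => abs_le_of_homSeminorm_le (F := fun x φ => G x φ) ENNReal.toReal_nonneg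
    (ENNReal.ofReal_toReal h.ne).ge hx hε hεΛ hφ

theorem HomBound.homAt {G : Space d → Distr d} {S : Set (Space d)} {Λ a D : ℝ} {r : ℕ}
    (h : HomBound G a r S Λ D) {x : Space d} (hx : x ∈ S) : HomAt (G x) x a r Λ D := h x hx

theorem HomBound.sub {G₁ G₂ : Space d → Distr d} {S : Set (Space d)} {Λ a D₁ D₂ : ℝ} {r : ℕ}
    (h₁ : HomBound G₁ a r S Λ D₁) (h₂ : HomBound G₂ a r S Λ D₂) :
    HomBound (fun x => G₁ x - G₂ x) a r S Λ (D₁ + D₂) := fun x hx ε hε hεΛ φ hφ => by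
  have : (G₁ x - G₂ x) (scale φ x ε) = G₁ x (scale φ x ε) - G₂ x (scale φ x ε) := rfl
  rw [this, add_mul]
  exact (abs_sub _ _).trans (add_le_add (h₁ x hx ε hε hεΛ φ hφ) (h₂ x hx ε hε hεΛ φ hφ))

theorem cohSeminorm_le {F : Space d → Test d → ℝ} {S : Set (Space d)} {Λ a γ M : ℝ} {r : ℕ}
    (hM : 0 ≤ M)
    (h : ∀ x ∈ S, ∀ y ∈ S, ∀ ε, 0 < ε → ε ≤ Λ → ∀ φ ∈ unitTest d r,
      |F y (scale φ x ε) - F x (scale φ x ε)| ≤ M * (ε ^ a * (‖y - x‖ + ε) ^ (γ - a))) :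
    cohSeminorm F S Λ r a γ ≤ ENNReal.ofReal M := by
  simp only [cohSeminorm, iSup_le_iff]
  intro x hx y hy ε hε φ hφ
  have hε0 := hε.1
  rw [ENNReal.ofReal_le_ofReal_iff hM, div_le_iff₀ (by positivity)]
  exact h x hx y hy ε hε.1 hε.2 φ hφ

/-- In `ℝ≥0∞` one has `0 / 0 = 0` and `u / 0 = ⊤` otherwise, so a finite seminorm forces the
numerator to vanish wherever the denominator does. -/
theorem abs_le_of_ofReal_div_le {u v : ℝ} {M : ℝ≥0∞} (hM : M ≠ ⊤) (hv : 0 ≤ v)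
    (h : ENNReal.ofReal |u| / ENNReal.ofReal v ≤ M) : |u| ≤ M.toReal * v := by
  rcases hv.eq_or_lt with rfl | hv
  · by_contra hu
    rw [mul_zero, not_le] at hu
    rw [ENNReal.ofReal_zero, ENNReal.div_zero (by simpa using hu)] at h
    exact hM (top_le_iff.1 h)
  · rw [← ENNReal.ofReal_div_of_pos hv] at h
    have := ENNReal.toReal_mono hM h
    rwa [ENNReal.toReal_ofReal (by positivity), div_le_iff₀ hv] at this

theorem ofReal_div_le {u v M : ℝ} (hM : 0 ≤ M) (hv : 0 ≤ v) (h : |u| ≤ M * v) :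
    ENNReal.ofReal |u| / ENNReal.ofReal v ≤ ENNReal.ofReal M := by
  rcases hv.eq_or_lt with rfl | hv
  · have : |u| = 0 := le_antisymm (by simpa using h) (abs_nonneg u)
    simp [this]
  · rw [← ENNReal.ofReal_div_of_pos hv, ENNReal.ofReal_le_ofReal_iff hM, div_le_iff₀ hv]
    exact h

/-! ### Reexpansion of modelled distributions -/

theorem homBound_of_modelNorm {I : Type*} {α : I → ℝ} {r : ℕ} {S : Set (Space d)} {Λ : ℝ}
    {P : I → Space d → Distr d} (h : modelNorm α r S Λ P ≠ ⊤) (j : I) :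
    HomBound (P j) (α j) r S Λ (modelNorm α r S Λ P).toReal :=
  fun _ hx _ hε hεΛ _ hφ => abs_le_of_homSeminorm_le (F := fun x φ => P j x φ)
    ENNReal.toReal_nonneg
    ((le_iSup (fun i => homSeminorm (fun x φ => P i x φ) S Λ r (α i)) j).trans
      (ENNReal.ofReal_toReal h).ge) hx hε hεΛ hφ

variable {I : Type*} [Fintype I]

/-- The increment `Γ_{xy} f(y) - f(x)` of a modelled distribution. -/
noncomputable def increment (Γ : Space d → Space d → I → I → ℝ) (f : I → Space d → ℝ)
    (x y : Space d) (j : I) : ℝ :=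
  ∑ i, Γ x y j i * f i y - f j x

theorem IsModel.pairing_sub {α : I → ℝ} {r : ℕ} {P : I → Space d → Distr d}
    {Γ : Space d → Space d → I → I → ℝ} (h : IsModel α r P Γ) (f : I → Space d → ℝ)
    (x y : Space d) :
    pairing f P y - pairing f P x = ∑ j, increment Γ f x y j • P j x := by
  simp only [pairing, increment, sub_smul, Finset.sum_sub_distrib, Finset.sum_smul]
  congr 1
  rw [Finset.sum_comm]
  refine Finset.sum_congr rfl fun i _ => ?_
  rw [h.reexpansion i x y, Finset.smul_sum]
  refine Finset.sum_congr rfl fun j _ => ?_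
  rw [smul_smul, mul_comm]

/-- From `a ≤ α_j < γ` follows `|x-y|^{γ-α_j} ε^{α_j} ≤ ε^a (|y-x| + ε)^{γ-a}`, and the sum over `j`
costs the factor `card I`. -/
theorem cohBound_of_reexpansion {α : I → ℝ} {a γ E Λ : ℝ} {r : ℕ} (ha : ∀ j, a ≤ α j)
    (hγ : ∀ j, α j < γ) (hE : 0 ≤ E) {S : Set (Space d)} {G : Space d → Distr d}
    (h : ∀ x ∈ S, ∀ y ∈ S, ∃ Q : I → Distr d, G y - G x = ∑ j, Q j ∧
      ∀ j, HomAt (Q j) x (α j) r Λ (E * ‖x - y‖ ^ (γ - α j))) :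
    CohBound G a γ r S Λ (Fintype.card I * E) := by
  intro x hx y hy ε hε hεΛ φ hφ
  obtain ⟨Q, hQ, hQA⟩ := h x hx y hy
  have h1 : G y (scale φ x ε) - G x (scale φ x ε) = ∑ j, Q j (scale φ x ε) := by
    change (G y - G x) (scale φ x ε) = _
    rw [hQ]
    simp
  rw [h1, Fintype.card, ← nsmul_eq_mul, smul_mul_assoc, ← Finset.sum_const]
  refine (Finset.abs_sum_le_sum_abs _ _).trans (Finset.sum_le_sum fun j _ => ?_)
  refine (hQA j ε hε hεΛ φ hφ).trans ?_
  rw [mul_assoc]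
  refine mul_le_mul_of_nonneg_left ?_ hE
  have hp : 0 < ‖y - x‖ + ε := by positivity
  calc ‖x - y‖ ^ (γ - α j) * ε ^ α j = ‖x - y‖ ^ (γ - α j) * (ε ^ a * ε ^ (α j - a)) := by
        rw [← Real.rpow_add hε]; congr 2; ring
    _ ≤ (‖y - x‖ + ε) ^ (γ - α j) * (ε ^ a * (‖y - x‖ + ε) ^ (α j - a)) := by
        have h2 : ‖x - y‖ ^ (γ - α j) ≤ (‖y - x‖ + ε) ^ (γ - α j) :=
          Real.rpow_le_rpow (norm_nonneg _) (by rw [norm_sub_rev]; linarith)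
            (sub_nonneg.2 (hγ j).le)
        have h3 : ε ^ (α j - a) ≤ (‖y - x‖ + ε) ^ (α j - a) :=
          Real.rpow_le_rpow hε.le (by linarith [norm_nonneg (y - x)]) (sub_nonneg.2 (ha j))
        gcongr
    _ = ε ^ a * (‖y - x‖ + ε) ^ (γ - a) := by
        rw [mul_left_comm, ← Real.rpow_add hp]; congr 2; ring

theorem abs_increment_le {α : I → ℝ} {γ : ℝ} {S : Set (Space d)}
    {Γ : Space d → Space d → I → I → ℝ} {f : I → Space d → ℝ}
    (h : modelledNorm α γ S Γ f ≠ ⊤) {x y : Space d} (hx : x ∈ S) (hy : y ∈ S) (j : I) :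
    |increment Γ f x y j| ≤ (modelledNorm α γ S Γ f).toReal * ‖x - y‖ ^ (γ - α j) := by
  rw [norm_sub_rev]
  refine abs_le_of_ofReal_div_le h (by positivity) (le_trans ?_ le_add_self)
  exact (le_iSup₂_of_le x hx (le_iSup₂_of_le y hy (le_iSup_of_le j le_rfl)))

theorem abs_le_of_modelledNorm {α : I → ℝ} {γ : ℝ} {S : Set (Space d)}
    {Γ : Space d → Space d → I → I → ℝ} {f : I → Space d → ℝ}
    (h : modelledNorm α γ S Γ f ≠ ⊤) {x : Space d} (hx : x ∈ S) (j : I) :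
    |f j x| ≤ (modelledNorm α γ S Γ f).toReal := by
  have h1 : ENNReal.ofReal |f j x| ≤ modelledNorm α γ S Γ f :=
    le_trans (le_iSup₂_of_le x hx
      (le_iSup (fun i => ENNReal.ofReal |f i x|) j)) le_self_add
  have := ENNReal.toReal_mono h h1
  rwa [ENNReal.toReal_ofReal (abs_nonneg _)] at this

theorem abs_increment_sub_le {α : I → ℝ} {γ : ℝ} {S : Set (Space d)}
    {Γ₁ Γ₂ : Space d → Space d → I → I → ℝ} {f₁ f₂ : I → Space d → ℝ}
    (h : modelledDist α γ S Γ₁ Γ₂ f₁ f₂ ≠ ⊤) {x y : Space d} (hx : x ∈ S) (hy : y ∈ S) (j : I) :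
    |increment Γ₁ f₁ x y j - increment Γ₂ f₂ x y j| ≤
      (modelledDist α γ S Γ₁ Γ₂ f₁ f₂).toReal * ‖x - y‖ ^ (γ - α j) := by
  have h1 : increment Γ₁ f₁ x y j - increment Γ₂ f₂ x y j =
      ∑ i, (Γ₁ x y j i * f₁ i y - Γ₂ x y j i * f₂ i y) - (f₁ j x - f₂ j x) := by
    rw [increment, increment, Finset.sum_sub_distrib]; ring
  rw [h1]
  refine abs_le_of_ofReal_div_le h (by positivity) (le_trans ?_ le_add_self)
  exact (le_iSup₂_of_le x hx (le_iSup₂_of_le y hy (le_iSup_of_le j le_rfl)))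

theorem abs_sub_le_of_modelledDist {α : I → ℝ} {γ : ℝ} {S : Set (Space d)}
    {Γ₁ Γ₂ : Space d → Space d → I → I → ℝ} {f₁ f₂ : I → Space d → ℝ}
    (h : modelledDist α γ S Γ₁ Γ₂ f₁ f₂ ≠ ⊤) {x : Space d} (hx : x ∈ S) (j : I) :
    |f₁ j x - f₂ j x| ≤ (modelledDist α γ S Γ₁ Γ₂ f₁ f₂).toReal := by
  have h1 : ENNReal.ofReal |f₁ j x - f₂ j x| ≤ modelledDist α γ S Γ₁ Γ₂ f₁ f₂ :=
    le_trans (le_iSup₂_of_le x hx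
      (le_iSup (fun i => ENNReal.ofReal |f₁ i x - f₂ i x|) j)) le_self_add
  have := ENNReal.toReal_mono h h1
  rwa [ENNReal.toReal_ofReal (abs_nonneg _)] at this

theorem IsModel.modelNorm_lt_top {α : I → ℝ} {r : ℕ} {P : I → Space d → Distr d}
    {Γ : Space d → Space d → I → I → ℝ} (h : IsModel α r P Γ) {S : Set (Space d)} (hS : IsCompact S)
    {Λ : ℝ} (hΛ : 1 ≤ Λ) : modelNorm α r S Λ P < ⊤ := by
  rw [modelNorm, ← Finset.sup_univ_eq_iSup, Finset.sup_lt_iff (by simp)]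
  exact fun i _ => h.hom i S hS Λ hΛ

theorem modelNorm_sub_lt_top {α : I → ℝ} {r : ℕ} {S : Set (Space d)} {Λ : ℝ}
    {P₁ P₂ : I → Space d → Distr d} (h₁ : modelNorm α r S Λ P₁ < ⊤) (h₂ : modelNorm α r S Λ P₂ < ⊤) :
    modelNorm α r S Λ (P₁ - P₂) < ⊤ := by
  rw [modelNorm, ← Finset.sup_univ_eq_iSup, Finset.sup_lt_iff (by simp)]
  intro i _
  refine lt_of_le_of_lt (b := ENNReal.ofReal ((modelNorm α r S Λ P₁).toReal +
    (modelNorm α r S Λ P₂).toReal)) ?_ ENNReal.ofReal_lt_top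
  simp only [homSeminorm, iSup_le_iff]
  intro x hx ε hε φ hφ
  have hε0 := hε.1
  rw [ENNReal.ofReal_le_ofReal_iff (by positivity), div_le_iff₀ (by positivity)]
  exact ((homBound_of_modelNorm h₁.ne i).sub (homBound_of_modelNorm h₂.ne i)) x hx ε hε.1 hε.2 φ hφ

/-- The splitting `g₁ P₁ - g₂ P₂ = (g₁ - g₂) P₁ + g₂ (P₁ - P₂)` produces the two terms, and the
asymmetry between the two systems, in the final estimate. -/
theorem HomAt.smul_sub_smul {P₁ P₂ : Distr d} {x : Space d} {a Λ A B u v : ℝ} {r : ℕ}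
    {g₁ g₂ : ℝ} (hu : 0 ≤ u) (hv : 0 ≤ v) (hg : |g₁ - g₂| ≤ u) (hg₂ : |g₂| ≤ v)
    (h₁ : HomAt P₁ x a r Λ A) (h : HomAt (P₁ - P₂) x a r Λ B) :
    HomAt (g₁ • P₁ - g₂ • P₂) x a r Λ (u * A + v * B) := fun ε hε hεΛ φ hφ => by
  have h1 : (g₁ • P₁ - g₂ • P₂) (scale φ x ε) =
      (g₁ - g₂) * P₁ (scale φ x ε) + g₂ * (P₁ - P₂) (scale φ x ε) := by
    change g₁ * P₁ (scale φ x ε) - g₂ * P₂ (scale φ x ε) =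
      (g₁ - g₂) * P₁ (scale φ x ε) + g₂ * (P₁ (scale φ x ε) - P₂ (scale φ x ε))
    ring
  rw [h1, add_mul, mul_assoc, mul_assoc]
  refine (abs_add_le _ _).trans (add_le_add ?_ ?_)
  · rw [abs_mul]
    exact mul_le_mul hg (h₁ ε hε hεΛ φ hφ) (abs_nonneg _) hu
  · rw [abs_mul]
    exact mul_le_mul hg₂ (h ε hε hεΛ φ hφ) (abs_nonneg _) hv

/-! ### Algebra of the lifted coefficients -/

/-- The increments of the polynomial components of the lifted modelled distribution. -/
theorem hat_increment (α : I → ℝ) (γ β : ℝ) (hγ : ∀ i, α i < γ) (Kn : ℕ → Space d → Space d → ℝ)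
    (s : ℕ) (P : I → Space d → Distr d) (Γ : Space d → Space d → I → I → ℝ) (f : I → Space d → ℝ)
    (R : Distr d) (x y : Space d) (k : {k : Fin d → ℕ // k ∈ poly d (γ + β)}) :
    increment (hatGamma α γ β Kn s P Γ) (hatf α γ β Kn s P f R) x y (.inr k) =
      ∑ j ∈ Finset.univ.filter (fun j => (deg k.1 : ℝ) < α j + β),
        increment Γ f x y j * derivKP α β Kn s P k.1 j x +
      pointwiseDeriv (γ + β) k.1 (kernelInt Kn s (pairing f P x - R)) x -
      ∑ l ∈ poly d (γ + β), gammaPoly x y k.1 l *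
        pointwiseDeriv (γ + β) l (kernelInt Kn s (pairing f P y - R)) y := by
  have h1 : ∑ l : {k : Fin d → ℕ // k ∈ poly d (γ + β)},
      hatGamma α γ β Kn s P Γ x y (.inr k) (.inr l) * hatf α γ β Kn s P f R (.inr l) y =
      ∑ i, (∑ l ∈ poly d (α i + β), gammaPoly x y k.1 l * derivKP α β Kn s P l i y) * f i y -
      ∑ l ∈ poly d (γ + β), gammaPoly x y k.1 l *
        pointwiseDeriv (γ + β) l (kernelInt Kn s (pairing f P y - R)) y := by
    simp only [hatGamma, hatf, mul_sub, Finset.sum_sub_distrib]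
    congr 1
    · rw [Finset.sum_coe_sort (poly d (γ + β)) fun l => gammaPoly x y k.1 l *
        ∑ j ∈ Finset.univ.filter (fun j => (deg l : ℝ) < α j + β), f j y * derivKP α β Kn s P l j y]
      simp only [Finset.mul_sum, Finset.sum_mul]
      -- Since `α_i < γ`, the condition `|l| < α_i + β` already implies `|l| < γ + β`.
      rw [Finset.sum_comm' (s' := fun i => poly d (α i + β)) (t' := Finset.univ)]
      · exact Finset.sum_congr rfl fun i _ => Finset.sum_congr rfl fun l _ => by ring
      · intro l i
        simp only [mem_poly, Finset.mem_filter, Finset.mem_univ, true_and, and_true]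
        exact ⟨fun h => h.2, fun h => ⟨by linarith [hγ i], h⟩⟩
    · exact Finset.sum_coe_sort (poly d (γ + β)) fun l => gammaPoly x y k.1 l *
        pointwiseDeriv (γ + β) l (kernelInt Kn s (pairing f P y - R)) y
  have h2 : ∑ i, hatGamma α γ β Kn s P Γ x y (.inr k) (.inl i) * hatf α γ β Kn s P f R (.inl i) y =
      ∑ j ∈ Finset.univ.filter (fun j => (deg k.1 : ℝ) < α j + β),
        (∑ i, Γ x y j i * f i y) * derivKP α β Kn s P k.1 j x -
      ∑ i, (∑ l ∈ poly d (α i + β), gammaPoly x y k.1 l * derivKP α β Kn s P l i y) * f i y := by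
    simp only [hatGamma, hatf, sub_mul, Finset.sum_sub_distrib]
    congr 1
    simp only [Finset.sum_mul]
    rw [Finset.sum_comm]
    exact Finset.sum_congr rfl fun i _ => Finset.sum_congr rfl fun l _ => by ring
  -- The derivatives `D^l(K P^i_y)(y)` occur in both sums with opposite signs; this cancellation
  -- dictates the second sum in `Γ̂`.
  rw [increment, Fintype.sum_sum_type, h1, h2]
  simp only [hatf, increment, sub_mul, Finset.sum_sub_distrib]
  ring

theorem hat_increment_inl (α : I → ℝ) (γ β : ℝ) (Kn : ℕ → Space d → Space d → ℝ)
    (s : ℕ) (P : I → Space d → Distr d) (Γ : Space d → Space d → I → I → ℝ) (f : I → Space d → ℝ)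
    (R : Distr d) (x y : Space d) (i : I) :
    increment (hatGamma α γ β Kn s P Γ) (hatf α γ β Kn s P f R) x y (.inl i) =
      increment Γ f x y i := by
  rw [increment, Fintype.sum_sum_type]
  simp [hatGamma, hatf, increment]

/-! ### Extensions -/

namespace IsExtension

variable {s : ℕ} {T₁ T₂ : Distr d} {T₁' T₂' : DistrOfOrder d s}

theorem sub (h₁ : IsExtension s T₁ T₁') (h₂ : IsExtension s T₂ T₂') :
    IsExtension s (T₁ - T₂) (T₁' - T₂') := fun φ => by
  change T₁' _ - T₂' _ = T₁ φ - T₂ φ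
  rw [h₁ φ, h₂ φ]

theorem smul (c : ℝ) (h₁ : IsExtension s T₁ T₁') : IsExtension s (c • T₁) (c • T₁') := fun φ => by
  change c * T₁' _ = c * T₁ φ
  rw [h₁ φ]

theorem sum {ι : Type*} (A : Finset ι) {T : ι → Distr d} {T' : ι → DistrOfOrder d s}
    (h : ∀ i, IsExtension s (T i) (T' i)) :
    IsExtension s (∑ i ∈ A, T i) (∑ i ∈ A, T' i) := fun φ => by
  have h1 : (∑ i ∈ A, T' i) (TestFunction.monoCLM ℝ φ) = ∑ i ∈ A, T' i (TestFunction.monoCLM ℝ φ) := by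
    simp
  have h2 : (∑ i ∈ A, T i) φ = ∑ i ∈ A, T i φ := by simp
  rw [h1, h2]
  exact Finset.sum_congr rfl fun i _ => h i φ

theorem unique (h₁ : IsExtension s T₁ T₁') (h₂ : IsExtension s T₁ T₂') : T₁' = T₂' := by
  ext g
  exact tendsto_nhds_unique (tendsto_extension_moll h₁ g) (tendsto_extension_moll h₂ g)

end IsExtension

end

section

/-! ### Reconstruction errors -/

theorem HomAt.mono {T : Distr d} {x : Space d} {a Λ A B : ℝ} {r : ℕ} (h : HomAt T x a r Λ A)
    (hAB : A ≤ B) : HomAt T x a r Λ B := fun ε hε hεΛ φ hφ =>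
  (h ε hε hεΛ φ hφ).trans (by gcongr)

theorem HomAt.smul {T : Distr d} {x : Space d} {a Λ A g u : ℝ} {r : ℕ} (h : HomAt T x a r Λ A)
    (hu : 0 ≤ u) (hg : |g| ≤ u) : HomAt (g • T) x a r Λ (u * A) := fun ε hε hεΛ φ hφ => by
  change |g * T (scale φ x ε)| ≤ _
  rw [abs_mul, mul_assoc]
  exact mul_le_mul hg (h ε hε hεΛ φ hφ) (abs_nonneg _) hu

theorem exists_order (a : ℝ) (r : ℕ) : ∃ s : ℕ, r ≤ s ∧ -a < s := by
  obtain ⟨n, hn⟩ := exists_nat_gt (-a)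
  exact ⟨max r n, le_max_left _ _, hn.trans_le (by exact_mod_cast le_max_right _ _)⟩

theorem isCompact_add_closedBall {S : Set (Space d)} (hS : IsCompact S) (R : ℝ) :
    IsCompact (S + Metric.closedBall (0 : Space d) R) :=
  hS.add (isCompact_closedBall _ _)

theorem subset_add_closedBall (S : Set (Space d)) {R : ℝ} (hR : 0 ≤ R) :
    S ⊆ S + Metric.closedBall (0 : Space d) R := fun x hx =>
  ⟨x, hx, 0, Metric.mem_closedBall_self hR, add_zero x⟩

/-- Quantitative homogeneity of differences of reconstruction errors. -/
theorem exists_reconstruction_bound {a γ Λ : ℝ} (haγ : a < γ) (r : ℕ) (hΛ : 1 ≤ Λ)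
    {S : Set (Space d)} (hS : IsCompact S) (c : Set (Space d) → ℝ → ℝ≥0) :
    ∃ C, 0 ≤ C ∧ ∀ (F₁ F₂ : Space d → Distr d) (R₁ R₂ : Distr d) (B : ℝ), 0 ≤ B →
      CohBound (fun z => (F₁ z - R₁) - (F₂ z - R₂)) a γ r (S + Metric.closedBall 0 (Λ + 1)) Λ B →
      IsReconstruction a γ F₁ R₁ → IsReconstruction a γ F₂ R₂ →
      (γ ≤ 0 → ConsistentReconstructions a γ r c F₁ F₂ R₁ R₂) →
      HomBound (fun z => (F₁ z - R₁) - (F₂ z - R₂)) γ r S Λ (C * B) := by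
  rcases lt_or_ge 0 γ with hγ | hγ
  · obtain ⟨s, hrs, hs⟩ := exists_order a r
    obtain ⟨C, hC, h⟩ := exists_homBound_of_coh d hrs haγ hγ hΛ
    refine ⟨C, hC.le, fun F₁ F₂ R₁ R₂ B hB hcoh h₁ h₂ _ => ?_⟩
    have hS' := isCompact_add_closedBall hS (Λ + 1)
    exact h S _ B _ hB hcoh
      ((homBound_of_homSeminorm_lt_top (G := fun x => F₁ x - R₁) (h₁ s hs _ hS')).sub
        (homBound_of_homSeminorm_lt_top (G := fun x => F₂ x - R₂) (h₂ s hs _ hS')))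
  · refine ⟨c S Λ, (c S Λ).2, fun F₁ F₂ R₁ R₂ B hB hcoh _ _ h => ?_⟩
    -- The reconstructions do not depend on the base point, so the errors and the germs have the
    -- same increments.
    have h1 : cohSeminorm (fun x φ => (F₁ x - F₂ x) φ)
        (S + Metric.closedBall (0 : Space d) (Λ + 1)) Λ r a γ ≤ ENNReal.ofReal B := by
      refine cohSeminorm_le hB fun x hx y hy ε hε hεΛ φ hφ => ?_
      refine (le_of_eq ?_).trans (hcoh x hx y hy ε hε hεΛ φ hφ)
      congr 1
      change (F₁ y (scale φ x ε) - F₂ y (scale φ x ε)) - (F₁ x (scale φ x ε) - F₂ x (scale φ x ε)) =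
        ((F₁ y (scale φ x ε) - R₁ (scale φ x ε)) - (F₂ y (scale φ x ε) - R₂ (scale φ x ε))) -
        ((F₁ x (scale φ x ε) - R₁ (scale φ x ε)) - (F₂ x (scale φ x ε) - R₂ (scale φ x ε)))
      ring
    have h2 := ((h hγ).lipschitz S hS Λ hΛ).trans (mul_le_mul_right h1 (c S Λ : ℝ≥0∞))
    have h3 : (c S Λ : ℝ≥0∞) * ENNReal.ofReal B = ENNReal.ofReal (c S Λ * B) := by
      rw [ENNReal.ofReal_mul (NNReal.coe_nonneg _), ENNReal.ofReal_coe_nnreal]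
    rw [h3] at h2
    exact fun x hx ε hε hεΛ φ hφ => abs_le_of_homSeminorm_le
      (F := fun x φ => ((F₁ x - R₁) - (F₂ x - R₂)) φ) (mul_nonneg (c S Λ).2 hB) h2 hx hε hεΛ hφ

variable {I : Type*} [Fintype I]

/-- Qualitative homogeneity of reconstruction errors. -/
theorem exists_homAt_pairing_sub {α : I → ℝ} {a γ : ℝ} {r : ℕ} (ha : ∀ j, a ≤ α j)
    (hγ : ∀ j, α j < γ) (haγ : a < γ) {P : I → Space d → Distr d}
    {Γ : Space d → Space d → I → I → ℝ} {f : I → Space d → ℝ} {R : Distr d}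
    (hP : IsModel α r P Γ) (hf : IsModelled α γ Γ f) (hR : IsReconstruction a γ (pairing f P) R)
    (hR' : γ ≤ 0 → ∀ S : Set (Space d), IsCompact S →
      homSeminorm (fun x φ => (pairing f P x - R) φ) S 1 r γ < ⊤)
    (x : Space d) (Λ : ℝ) (hΛ : 1 ≤ Λ) :
    ∃ A, HomAt (pairing f P x - R) x γ r Λ A := by
  have hS := isCompact_add_closedBall (isCompact_singleton (x := x)) (Λ + 1)
  set S' := {x} + Metric.closedBall (0 : Space d) (Λ + 1)
  have hn := (hf.finite S' hS).ne
  have hm := (hP.modelNorm_lt_top hS hΛ).ne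
  have hcoh : CohBound (fun z => pairing f P z - R) a γ r S' Λ (Fintype.card I *
      ((modelledNorm α γ S' Γ f).toReal * (modelNorm α r S' Λ P).toReal)) := by
    refine cohBound_of_reexpansion ha hγ (by positivity) fun y hy z hz =>
      ⟨fun j => increment Γ f y z j • P j y, ?_, fun j => ?_⟩
    · rw [sub_sub_sub_cancel_right, hP.pairing_sub]
    · rw [mul_right_comm]
      exact ((homBound_of_modelNorm hm j).homAt hy).smul (by positivity)
        (abs_increment_le hn hy hz j)
  rcases lt_or_ge 0 γ with hγ0 | hγ0
  · obtain ⟨s, hrs, hs⟩ := exists_order a r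
    obtain ⟨C, hC, h⟩ := exists_homBound_of_coh d hrs haγ hγ0 hΛ
    exact ⟨_, (h {x} _ _ _ (by positivity) hcoh (homBound_of_homSeminorm_lt_top
      (G := fun x => pairing f P x - R) (hR s hs _ hS))).homAt rfl⟩
  · obtain ⟨D, hD⟩ := exists_homBound_extend haγ hΛ (by positivity) hcoh
      (homBound_of_homSeminorm_lt_top (G := fun x => pairing f P x - R) (hR' hγ0 _ hS))
    exact ⟨D, hD.homAt rfl⟩

/-! ### Linearity of the kernel coefficients -/

section Linearity

variable {m s r : ℕ} {β c ρ Λ : ℝ} {S₀ : Set (Space d)} {Kn : ℕ → Space d → Space d → ℝ}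

/-- Not purely formal, because `toTest` is `0` on functions that are not `C^s` with compact support:
the regularity and support of `K_n^* ∂^k φ` have to be known. -/
theorem smoothCoef_const_smul (hV : ∀ n, KernelBounds m s β c ρ (dyad n) S₀ (kjet (Kn n)))
    (T' : DistrOfOrder d s) (k : Fin d → ℕ) (b : ℝ) (φ : Test d) (n : ℕ) :
    smoothCoef Kn T' k (b • φ) n = b * smoothCoef Kn T' k φ n := by
  have h1 : dualInt (Kn n) (testDeriv k (b • φ)) =
      fun y => b * dualInt (Kn n) (testDeriv k φ) y := by
    funext y
    simp only [dualInt, testDeriv_apply, mderiv_const_smul]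
    rw [← integral_const_mul]
    simp only [mul_assoc]
  have hJ := (hV n).isJet_integral (testDeriv k φ).contDiff.continuous
    (testDeriv k φ).hasCompactSupport (k := 0) (by simp)
  have h0 : (fun y => ∫ x, testDeriv k φ x * kjet (Kn n) 0 0 x y) =
      dualInt (Kn n) (testDeriv k φ) := by
    rw [kjet_zero_zero]; rfl
  have h2 : ContDiff ℝ s (dualInt (Kn n) (testDeriv k φ)) := h0 ▸ hJ.contDiff (by simp)
  have h3 : HasCompactSupport (dualInt (Kn n) (testDeriv k φ)) := by
    obtain ⟨R, hR⟩ := (testDeriv k φ).hasCompactSupport.isCompact.isBounded.subset_closedBall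
      (0 : Space d)
    refine hasCompactSupport_of_closedBall (x := 0) (s := R * 1 + ρ * dyad n) fun y hy => ?_
    rw [← h0]
    refine (hV n).integral_scale_eq_zero (x := 0) (fun z hz => ?_) (by simp) (by simp) hy
    exact image_eq_zero_of_notMem_tsupport fun h => hz (by simpa using hR h)
  rw [smoothCoef, smoothCoef, h1, toTest_const_mul _ h2 h3, map_smul, smul_eq_mul]

/-- Brings `[K Π] = 0` into the form used in the borderline case. A small multiple of `η` lies in
the unit class, on which the smoothed derivative vanishes. -/
theorem hasSum_smoothCoef_zero (hV : ∀ n, KernelBounds m s β c ρ (dyad n) S₀ (kjet (Kn n)))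
    (hβ : 0 < β) (hc : 0 ≤ c) (hρ : 0 < ρ) (hrs : r ≤ s) (hΛ : 2 * ρ ≤ Λ) {k : Fin d → ℕ}
    {a A R D : ℝ} {T : Distr d} {x : Space d} (hT : IsExtension s T (extension s T))
    (hA : HomAt T x a r Λ A) (hR : 0 < R) (hRρ : R < ρ) (hR1 : R ≤ 1)
    (hx : Metric.closedBall x (3 * ρ) ⊆ S₀)
    {η : Test d} {N : ℕ} (hη : TestBounds η R D N) (hk : deg k + r ≤ N)
    (h0 : ∀ ε, 0 < ε → ε ≤ 1 → ∀ φ ∈ unitTest d r,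
      distDeriv k (kernelInt Kn s T) (scale φ x ε) = 0) {ε : ℝ} (hε : 0 < ε) (hε1 : ε ≤ 1) :
    HasSum (smoothCoef Kn (extension s T) k (scale η x ε)) 0 := by
  -- A divergent series also has `tsum` equal to `0`, so summability must be proved separately.
  have hsum := summable_smoothCoef hV hβ hc hρ hrs hΛ hT hA hR hRρ hx hη hk hε hε1
  have hD := hη.nonneg
  have hmem : (D + 1)⁻¹ • η ∈ unitTest d r := by
    rw [mem_unitTest_iff]
    refine ⟨fun y hy => ?_, fun l hl z => ?_⟩
    · have := hη.supp y fun h => hy (Metric.closedBall_subset_closedBall hR1 h)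
      change (D + 1)⁻¹ * η y = 0
      rw [this, mul_zero]
    · rw [mderiv_const_smul, abs_mul, abs_inv, abs_of_pos (by positivity : 0 < D + 1),
        inv_mul_le_iff₀ (by positivity)]
      linarith [hη.bound l (by omega) z]
  have h1 := h0 ε hε hε1 _ hmem
  rw [scale_smul, distDeriv] at h1
  have h2 : kernelInt Kn s T (testDeriv k ((D + 1)⁻¹ • scale η x ε)) =
      (D + 1)⁻¹ * ∑' n, smoothCoef Kn (extension s T) k (scale η x ε) n := by
    rw [← tsum_mul_left]
    exact tsum_congr fun n => smoothCoef_const_smul hV _ k _ _ n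
  rw [h2] at h1
  have h3 : ∑' n, smoothCoef Kn (extension s T) k (scale η x ε) n = 0 := by
    have h4 : ((-1 : ℝ)) ^ deg k ≠ 0 := pow_ne_zero _ (by norm_num)
    have h5 : (D + 1)⁻¹ ≠ 0 := by positivity
    simpa [h4, h5] using h1
  rw [← h3]
  exact hsum.hasSum

theorem kcoef_sub (T₁' T₂' : DistrOfOrder d s) (k : Fin d → ℕ) (x : Space d) (n : ℕ) :
    kcoef Kn (T₁' - T₂') k x n = kcoef Kn T₁' k x n - kcoef Kn T₂' k x n := rfl

theorem kcoef_smul_sub_smul (g₁ g₂ : ℝ) (T₁' T₂' : DistrOfOrder d s) (k : Fin d → ℕ) (x : Space d)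
    (n : ℕ) : kcoef Kn (g₁ • T₁' - g₂ • T₂') k x n =
      g₁ * kcoef Kn T₁' k x n - g₂ * kcoef Kn T₂' k x n := rfl

end Linearity

theorem distDeriv_eq_zero_of_compatNorm {α : I → ℝ} {β Λ : ℝ} {Kn : ℕ → Space d → Space d → ℝ}
    {s r : ℕ} {S : Set (Space d)} {P : I → Space d → Distr d}
    (h : compatNorm α β Kn s r S Λ P = 0) {i : I} {k : Fin d → ℕ} (hk : (deg k : ℝ) = α i + β)
    {x : Space d} (hx : x ∈ S) {ε : ℝ} (hε : 0 < ε) (hεΛ : ε ≤ Λ) {φ : Test d}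
    (hφ : φ ∈ unitTest d r) : distDeriv k (kernelInt Kn s (P i x)) (scale φ x ε) = 0 := by
  rw [compatNorm, Finset.sum_eq_zero_iff] at h
  have h1 := h i (Finset.mem_univ i)
  rw [Finset.sum_eq_zero_iff] at h1
  have h2 := h1 k (by
    rw [Finset.mem_filter, mem_poly]
    exact ⟨by linarith, hk⟩)
  have := abs_le_of_homSeminorm_le (M := 0) le_rfl (by rw [h2]; exact zero_le) hx hε hεΛ hφ
  simpa using this

/-- The data which enter the estimates on the lifted modelled distributions. -/
structure LiftData (α : I → ℝ) (γ β : ℝ) (Kn : ℕ → Space d → Space d → ℝ) (r s : ℕ)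
    (S : Set (Space d)) (P : I → Space d → Distr d) (f : I → Space d → ℝ) (R : Distr d) : Prop where
  model : ∀ j, ∀ x ∈ S, ∀ Λ : ℝ, 1 ≤ Λ → ∃ A, HomAt (P j x) x (α j) r Λ A
  error : ∀ x ∈ S, ∀ Λ : ℝ, 1 ≤ Λ → ∃ A, HomAt (pairing f P x - R) x γ r Λ A
  compat : ∀ j (k : Fin d → ℕ), (deg k : ℝ) = α j + β → ∀ x ∈ S, ∀ ε, 0 < ε → ε ≤ 1 →
    ∀ φ ∈ unitTest d r, distDeriv k (kernelInt Kn s (P j x)) (scale φ x ε) = 0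

namespace LiftData

variable {m r s : ℕ} {α : I → ℝ} {γ β ρ : ℝ} {K : Space d → Space d → ℝ}
  {Kn : ℕ → Space d → Space d → ℝ} {S : Set (Space d)} {P : I → Space d → Distr d}
  {f : I → Space d → ℝ} {R : Distr d}

theorem mono (h : LiftData α γ β Kn r s S P f R) {S₁ : Set (Space d)} (hS : S₁ ⊆ S) :
    LiftData α γ β Kn r s S₁ P f R where
  model := fun j x hx => h.model j x (hS hx)
  error := fun x hx => h.error x (hS hx)
  compat := fun j k hk x hx => h.compat j k hk x (hS hx)

theorem extension_model (h : LiftData α γ β Kn r s S P f R) (hrs : r ≤ s) (j : I) {x : Space d}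
    (hx : x ∈ S) : IsExtension s (P j x) (extension s (P j x)) :=
  isExtension_extension (HomAt.exists_isExtension hrs (h.model j x hx))

theorem extension_error (h : LiftData α γ β Kn r s S P f R) (hrs : r ≤ s) {x : Space d}
    (hx : x ∈ S) : IsExtension s (pairing f P x - R) (extension s (pairing f P x - R)) :=
  isExtension_extension (HomAt.exists_isExtension hrs (h.error x hx))

theorem derivKP_eq (h : LiftData α γ β Kn r s S P f R) (hK : IsRegularisingKernel β m s ρ K Kn)
    (hrs : r ≤ s) {j : I} {x : Space d} (hx : x ∈ S) {k : Fin d → ℕ}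
    (hk : (deg k : ℝ) < α j + β) (hkm : deg k + 1 ≤ m) :
    derivKP α β Kn s P k j x = ∑' n, kcoef Kn (extension s (P j x)) k x n :=
  pointwiseDeriv_eq (hasPointwiseDeriv_kernelInt hK hrs (h.model j x hx) hk hkm _)

theorem pointwiseDeriv_error_eq (h : LiftData α γ β Kn r s S P f R)
    (hK : IsRegularisingKernel β m s ρ K Kn) (hrs : r ≤ s) {x : Space d} (hx : x ∈ S)
    {k : Fin d → ℕ} (hk : (deg k : ℝ) < γ + β) (hkm : deg k + 1 ≤ m) :
    pointwiseDeriv (γ + β) k (kernelInt Kn s (pairing f P x - R)) x =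
      ∑' n, kcoef Kn (extension s (pairing f P x - R)) k x n :=
  pointwiseDeriv_eq (hasPointwiseDeriv_kernelInt hK hrs (h.error x hx) hk hkm _)

end LiftData

theorem isModel_liftData {α : I → ℝ} {a γ β : ℝ} {r s : ℕ} {Kn : ℕ → Space d → Space d → ℝ}
    (ha : ∀ j, a ≤ α j) (hγ : ∀ j, α j < γ) (haγ : a < γ) {S : Set (Space d)}
    {P : I → Space d → Distr d}
    {Γ : Space d → Space d → I → I → ℝ} {f : I → Space d → ℝ} {R : Distr d}
    (hP : IsModel α r P Γ) (hf : IsModelled α γ Γ f) (hR : IsReconstruction a γ (pairing f P) R)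
    (hR' : γ ≤ 0 → ∀ S : Set (Space d), IsCompact S →
      homSeminorm (fun x φ => (pairing f P x - R) φ) S 1 r γ < ⊤)
    (hcompat : compatNorm α β Kn s r S 1 P = 0) : LiftData α γ β Kn r s S P f R where
  model := fun j x _ _ hΛ =>
    ⟨_, (homBound_of_modelNorm (hP.modelNorm_lt_top (isCompact_singleton (x := x)) hΛ).ne j).homAt
      rfl⟩
  error := fun x _ => exists_homAt_pairing_sub ha hγ haγ hP hf hR hR' x
  compat := fun _ _ hk _ hx _ hε hε1 _ hφ => distDeriv_eq_zero_of_compatNorm hcompat hk hx hε hε1 hφ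

end

/-! ### Bounds on the polynomial components of the lift -/

section LiftBounds

variable {m s r : ℕ} {β c ρ Λ : ℝ} {S₀ S : Set (Space d)} {K : Space d → Space d → ℝ}
  {Kn : ℕ → Space d → Space d → ℝ} {I : Type*} [Fintype I]

/-- The pointwise part of the lifted norm is linear in `f_1^j P_1^j - f_2^j P_2^j` and in the
difference of the reconstruction errors. All series involved converge with positive exponents, so no
splitting of scales is needed. -/
theorem exists_hat_bound (hK : IsRegularisingKernel β m s ρ K Kn)
    (hV : ∀ n, KernelBounds m s β c ρ (dyad n) S₀ (kjet (Kn n)))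
    (hc : 0 ≤ c) (hrs : r ≤ s) (hΛ1 : 1 ≤ Λ) (hΛ : 2 * ρ ≤ Λ)
    (hS : ∀ x ∈ S, Metric.closedBall x (3 * ρ) ⊆ S₀) (α : I → ℝ) {γ : ℝ}
    (k : {k : Fin d → ℕ // k ∈ poly d (γ + β)}) (hm : γ + β < m) :
    ∃ C, 0 ≤ C ∧ ∀ (P₁ P₂ : I → Space d → Distr d) (f₁ f₂ : I → Space d → ℝ) (R₁ R₂ : Distr d)
      (E : ℝ), LiftData α γ β Kn r s S P₁ f₁ R₁ → LiftData α γ β Kn r s S P₂ f₂ R₂ →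
      HomBound (fun z => (pairing f₁ P₁ z - R₁) - (pairing f₂ P₂ z - R₂)) γ r S Λ E →
      (∀ x ∈ S, ∀ j, HomAt (f₁ j x • P₁ j x - f₂ j x • P₂ j x) x (α j) r Λ E) →
      ∀ x ∈ S, |hatf α γ β Kn s P₁ f₁ R₁ (.inr k) x - hatf α γ β Kn s P₂ f₂ R₂ (.inr k) x| ≤
        C * E := by
  obtain ⟨k, hk⟩ := k
  rw [mem_poly] at hk
  have hρ := hK.range_pos
  have hkm : deg k + 1 ≤ m := by
    have : (deg k : ℝ) < m := hk.trans hm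
    exact_mod_cast this
  -- With `h = ρ/2` the threshold `2h/ρ` equals `1`, so the tail estimate with `n₁ = 0` covers the
  -- whole series.
  have hh : 0 < ρ / 2 := by positivity
  have h0 : dyad 0 ≤ 2 / ρ * (ρ / 2) := by
    rw [dyad, pow_zero]; apply le_of_eq; field_simp
  have ha : ∀ j, ∃ C, 0 ≤ C ∧ ((deg k : ℝ) < α j + β → ∀ (T : Distr d) (T' : DistrOfOrder d s)
      (x : Space d) (A : ℝ), IsExtension s T T' → HomAt T x (α j) r Λ A →
      Metric.closedBall x ρ ⊆ S₀ → |∑' n, kcoef Kn T' k x n| ≤ C * A) := fun j => by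
    by_cases hj : (deg k : ℝ) < α j + β
    · obtain ⟨C, hC, h⟩ := exists_tail_bound hV hc hρ hrs hΛ (by omega : deg k ≤ m) (a := α j)
        (by linarith)
      refine ⟨C * (ρ / 2) ^ (β - deg k + α j), by positivity, fun _ T T' x A hT hA hx => ?_⟩
      have := h T T' x A (ρ / 2) 0 hT hA hx hh h0
      rw [mul_assoc, mul_comm _ A]
      exact this
    · exact ⟨0, le_rfl, fun h => absurd h hj⟩
  choose Ca hCa0 hCa using ha
  obtain ⟨Cg, hCg0, hCg⟩ := exists_tail_bound hV hc hρ hrs hΛ (by omega : deg k ≤ m) (a := γ)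
    (by linarith)
  refine ⟨∑ j, Ca j + Cg * (ρ / 2) ^ (β - deg k + γ), ?_, ?_⟩
  · have := Finset.sum_nonneg fun j (_ : j ∈ Finset.univ) => hCa0 j
    positivity
  intro P₁ P₂ f₁ f₂ R₁ R₂ E h₁ h₂ hG hQ x hx
  have hx0 := hS x hx
  have hx1 := (Metric.closedBall_subset_closedBall (by linarith : ρ ≤ 3 * ρ)).trans hx0
  have hE0 := (hG.homAt hx).nonneg (by linarith)
  obtain ⟨A₁, hA₁⟩ := h₁.error x hx Λ hΛ1
  obtain ⟨A₂, hA₂⟩ := h₂.error x hx Λ hΛ1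
  have e₁ := h₁.extension_error hrs hx
  have e₂ := h₂.extension_error hrs hx
  have hkey : hatf α γ β Kn s P₁ f₁ R₁ (.inr ⟨k, (mem_poly _ _).2 hk⟩) x -
      hatf α γ β Kn s P₂ f₂ R₂ (.inr ⟨k, (mem_poly _ _).2 hk⟩) x =
      ∑ j ∈ Finset.univ.filter (fun j => (deg k : ℝ) < α j + β),
        ∑' n, kcoef Kn (f₁ j x • extension s (P₁ j x) - f₂ j x • extension s (P₂ j x)) k x n -
      ∑' n, kcoef Kn (extension s (pairing f₁ P₁ x - R₁) - extension s (pairing f₂ P₂ x - R₂))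
        k x n := by
    simp only [hatf]
    rw [h₁.pointwiseDeriv_error_eq hK hrs hx hk hkm, h₂.pointwiseDeriv_error_eq hK hrs hx hk hkm]
    simp only [kcoef_sub (extension s (pairing f₁ P₁ x - R₁))]
    rw [Summable.tsum_sub (summable_kcoef hV hc hρ hrs hΛ (by omega) (by linarith) e₁ hA₁ hx1)
      (summable_kcoef hV hc hρ hrs hΛ (by omega) (by linarith) e₂ hA₂ hx1)]
    have : ∀ j ∈ Finset.univ.filter (fun j => (deg k : ℝ) < α j + β),
        ∑' n, kcoef Kn (f₁ j x • extension s (P₁ j x) - f₂ j x • extension s (P₂ j x)) k x n =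
        f₁ j x * derivKP α β Kn s P₁ k j x - f₂ j x * derivKP α β Kn s P₂ k j x := fun j hj => by
      have hj := (Finset.mem_filter.1 hj).2
      obtain ⟨B₁, hB₁⟩ := h₁.model j x hx Λ hΛ1
      obtain ⟨B₂, hB₂⟩ := h₂.model j x hx Λ hΛ1
      rw [h₁.derivKP_eq hK hrs hx hj hkm, h₂.derivKP_eq hK hrs hx hj hkm, ← tsum_mul_left,
        ← tsum_mul_left]
      simp only [kcoef_smul_sub_smul]
      exact Summable.tsum_sub ((summable_kcoef hV hc hρ hrs hΛ (by omega) (by linarith)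
        (h₁.extension_model hrs j hx) hB₁ hx1).mul_left _)
        ((summable_kcoef hV hc hρ hrs hΛ (by omega) (by linarith)
        (h₂.extension_model hrs j hx) hB₂ hx1).mul_left _)
    rw [Finset.sum_congr rfl this, Finset.sum_sub_distrib]
    ring
  rw [hkey, add_mul, Finset.sum_mul]
  refine (abs_sub _ _).trans (add_le_add ?_ ?_)
  · refine (Finset.abs_sum_le_sum_abs _ _).trans (le_trans (Finset.sum_le_sum fun j hj => ?_)
      (Finset.sum_le_sum_of_subset_of_nonneg (Finset.filter_subset _ _)
        fun j _ _ => mul_nonneg (hCa0 j) hE0))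
    exact hCa j (Finset.mem_filter.1 hj).2 _ _ x E (((h₁.extension_model hrs j hx).smul _).sub
      ((h₂.extension_model hrs j hx).smul _)) (hQ x hx j) hx1
  · rw [mul_assoc, mul_comm _ E]
    exact hCg _ _ x E (ρ / 2) 0 (e₁.sub e₂) (hG.homAt hx) hx1 hh h0

/-- The linear estimate `exists_schauder_bound`, applied to the differences `Q_j` and `G` of the two
systems, after `hat_increment` and the series for the pointwise derivatives. -/
theorem exists_hat_increment_bound (hK : IsRegularisingKernel β m s ρ K Kn)
    (hV : ∀ n, KernelBounds m s β c ρ (dyad n) S₀ (kjet (Kn n)))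
    (hc : 0 ≤ c) (hrs : r ≤ s) (hΛ1 : 1 ≤ Λ) (hΛ : 2 * ρ ≤ Λ)
    (hS : ∀ x ∈ S, Metric.closedBall x (3 * ρ) ⊆ S₀) (α : I → ℝ) {γ : ℝ}
    (hγ : ∀ j, α j < γ) (hγβ : ∀ n : ℕ, γ + β ≠ n)
    (k : {k : Fin d → ℕ // k ∈ poly d (γ + β)}) (hm : γ + β < m) :
    ∃ C, 0 ≤ C ∧ ∀ (P₁ P₂ : I → Space d → Distr d) (Γ₁ Γ₂ : Space d → Space d → I → I → ℝ)
      (f₁ f₂ : I → Space d → ℝ) (R₁ R₂ : Distr d) (E : ℝ),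
      IsModel α r P₁ Γ₁ → IsModel α r P₂ Γ₂ →
      LiftData α γ β Kn r s S P₁ f₁ R₁ → LiftData α γ β Kn r s S P₂ f₂ R₂ →
      HomBound (fun z => (pairing f₁ P₁ z - R₁) - (pairing f₂ P₂ z - R₂)) γ r S Λ E →
      (∀ x ∈ S, ∀ y ∈ S, ∀ j, HomAt (increment Γ₁ f₁ x y j • P₁ j x -
        increment Γ₂ f₂ x y j • P₂ j x) x (α j) r Λ (E * ‖x - y‖ ^ (γ - α j))) →
      ∀ x ∈ S, ∀ y ∈ S, x ≠ y →
        |increment (hatGamma α γ β Kn s P₁ Γ₁) (hatf α γ β Kn s P₁ f₁ R₁) x y (.inr k) -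
          increment (hatGamma α γ β Kn s P₂ Γ₂) (hatf α γ β Kn s P₂ f₂ R₂) x y (.inr k)| ≤
        C * E * ‖x - y‖ ^ (γ + β - deg k.1) := by
  obtain ⟨k, hk⟩ := k
  rw [mem_poly] at hk
  have hρ := hK.range_pos
  have hkm : deg k + 1 ≤ m := by
    have : (deg k : ℝ) < m := hk.trans hm
    exact_mod_cast this
  -- `R < ρ` keeps the smoothed kernels within radius `2ρ ≤ Λ`, and `R ≤ 1` puts a multiple of `η`
  -- into the unit class.
  set R := min (ρ / 2) 1 with hRdef
  have hR : 0 < R := by positivity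
  have hRρ : R < ρ := (min_le_left _ _).trans_lt (by linarith)
  have hR1 : R ≤ 1 := min_le_right _ _
  obtain ⟨η, hη1, hηR⟩ := exists_test_integral_eq_one d hR
  obtain ⟨D, -, hη⟩ := exists_testBounds η (deg k + r) hηR
  obtain ⟨C, hC, hmain⟩ := exists_schauder_bound hV hK.beta_pos hc hρ hrs hΛ α hγβ hm hk hR hRρ hη
    le_rfl hη1
  refine ⟨C, hC, ?_⟩
  intro P₁ P₂ Γ₁ Γ₂ f₁ f₂ R₁ R₂ E hP₁ hP₂ h₁ h₂ hG hQ x hx y hy hxy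
  have hball : ∀ {x}, x ∈ S → Metric.closedBall x ρ ⊆ S₀ := fun hx =>
    (Metric.closedBall_subset_closedBall (by linarith : ρ ≤ 3 * ρ)).trans (hS _ hx)
  have e₁ := fun z (hz : z ∈ S) => h₁.extension_error hrs hz
  have e₂ := fun z (hz : z ∈ S) => h₂.extension_error hrs hz
  have p₁ := fun j => h₁.extension_model hrs j hx
  have p₂ := fun j => h₂.extension_model hrs j hx
  have hext : ∀ j, IsExtension s (increment Γ₁ f₁ x y j • P₁ j x - increment Γ₂ f₂ x y j • P₂ j x)
      (increment Γ₁ f₁ x y j • extension s (P₁ j x) -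
        increment Γ₂ f₂ x y j • extension s (P₂ j x)) := fun j =>
    ((p₁ j).smul _).sub ((p₂ j).smul _)
  have hlin : extension s (pairing f₁ P₁ y - R₁) - extension s (pairing f₂ P₂ y - R₂) =
      extension s (pairing f₁ P₁ x - R₁) - extension s (pairing f₂ P₂ x - R₂) +
        ∑ j, (increment Γ₁ f₁ x y j • extension s (P₁ j x) -
          increment Γ₂ f₂ x y j • extension s (P₂ j x)) := by
    rw [← sub_eq_iff_eq_add']
    -- Extensions are obtained by choice; linear identities pass to them through uniqueness.
    refine IsExtension.unique (((e₁ y hy).sub (e₂ y hy)).sub ((e₁ x hx).sub (e₂ x hx))) ?_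
    have : (pairing f₁ P₁ y - R₁ - (pairing f₂ P₂ y - R₂)) -
        (pairing f₁ P₁ x - R₁ - (pairing f₂ P₂ x - R₂)) =
        ∑ j, (increment Γ₁ f₁ x y j • P₁ j x - increment Γ₂ f₂ x y j • P₂ j x) := by
      rw [Finset.sum_sub_distrib, ← hP₁.pairing_sub, ← hP₂.pairing_sub]
      abel
    rw [this]
    exact IsExtension.sum _ hext
  have hb := hmain _ _ _ _ _ _ x y E hext ((e₁ x hx).sub (e₂ x hx)) ((e₁ y hy).sub (e₂ y hy))
    (hQ x hx y hy) (hG.homAt hx) (hG.homAt hy) hlin (hS x hx) (hS y hy)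
    (norm_sub_pos_iff.2 hxy) fun j hj ε hε hε1 => ?_
  swap
  · obtain ⟨B₁, hB₁⟩ := h₁.model j x hx Λ hΛ1
    obtain ⟨B₂, hB₂⟩ := h₂.model j x hx Λ hΛ1
    have s₁ := hasSum_smoothCoef_zero hV hK.beta_pos hc hρ hrs hΛ (p₁ j) hB₁ hR hRρ hR1 (hS x hx)
      hη le_rfl (h₁.compat j k hj x hx) hε hε1
    have s₂ := hasSum_smoothCoef_zero hV hK.beta_pos hc hρ hrs hΛ (p₂ j) hB₂ hR hRρ hR1 (hS x hx)
      hη le_rfl (h₂.compat j k hj x hx) hε hε1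
    have := (s₁.mul_left (increment Γ₁ f₁ x y j)).sub (s₂.mul_left (increment Γ₂ f₂ x y j))
    rw [mul_zero, mul_zero, sub_zero] at this
    exact this
  rw [mul_assoc]
  refine (le_of_eq ?_).trans hb
  congr 1
  rw [hat_increment α γ β hγ, hat_increment α γ β hγ, sum_gammaPoly_mul, sum_gammaPoly_mul]
  have hmod : ∀ j ∈ Finset.univ.filter (fun j => (deg k : ℝ) < α j + β),
      ∑' n, kcoef Kn (increment Γ₁ f₁ x y j • extension s (P₁ j x) -
        increment Γ₂ f₂ x y j • extension s (P₂ j x)) k x n =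
      increment Γ₁ f₁ x y j * derivKP α β Kn s P₁ k j x -
        increment Γ₂ f₂ x y j * derivKP α β Kn s P₂ k j x := fun j hj => by
    have hj := (Finset.mem_filter.1 hj).2
    obtain ⟨B₁, hB₁⟩ := h₁.model j x hx Λ hΛ1
    obtain ⟨B₂, hB₂⟩ := h₂.model j x hx Λ hΛ1
    rw [h₁.derivKP_eq hK hrs hx hj hkm, h₂.derivKP_eq hK hrs hx hj hkm, ← tsum_mul_left,
      ← tsum_mul_left]
    simp only [kcoef_smul_sub_smul]
    exact Summable.tsum_sub ((summable_kcoef hV hc hρ hrs hΛ (by omega) (by linarith)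
      (p₁ j) hB₁ (hball hx)).mul_left _)
      ((summable_kcoef hV hc hρ hrs hΛ (by omega) (by linarith) (p₂ j) hB₂ (hball hx)).mul_left _)
  have herr : ∀ z ∈ S, ∀ l : Fin d → ℕ, (deg l : ℝ) < γ + β →
      ∑' n, kcoef Kn (extension s (pairing f₁ P₁ z - R₁) - extension s (pairing f₂ P₂ z - R₂)) l z n =
      pointwiseDeriv (γ + β) l (kernelInt Kn s (pairing f₁ P₁ z - R₁)) z -
        pointwiseDeriv (γ + β) l (kernelInt Kn s (pairing f₂ P₂ z - R₂)) z := fun z hz l hl => by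
    obtain ⟨A₁, hA₁⟩ := h₁.error z hz Λ hΛ1
    obtain ⟨A₂, hA₂⟩ := h₂.error z hz Λ hΛ1
    have hlm : deg l + 1 ≤ m := by
      have : (deg l : ℝ) < m := hl.trans hm
      exact_mod_cast this
    rw [h₁.pointwiseDeriv_error_eq hK hrs hz hl hlm, h₂.pointwiseDeriv_error_eq hK hrs hz hl hlm]
    simp only [kcoef_sub]
    exact Summable.tsum_sub (summable_kcoef hV hc hρ hrs hΛ (by omega) (by linarith) (e₁ z hz) hA₁
      (hball hz)) (summable_kcoef hV hc hρ hrs hΛ (by omega) (by linarith) (e₂ z hz) hA₂ (hball hz))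
  rw [Finset.sum_congr rfl hmod, herr x hx k hk]
  have herr' : ∀ p ∈ poly d (γ + β - deg k), monomial p (x - y) / mfactorial p *
      ∑' n, kcoef Kn (extension s (pairing f₁ P₁ y - R₁) - extension s (pairing f₂ P₂ y - R₂))
        (k + p) y n =
      monomial p (x - y) / mfactorial p *
        pointwiseDeriv (γ + β) (k + p) (kernelInt Kn s (pairing f₁ P₁ y - R₁)) y -
      monomial p (x - y) / mfactorial p *
        pointwiseDeriv (γ + β) (k + p) (kernelInt Kn s (pairing f₂ P₂ y - R₂)) y := fun p hp => by
    rw [mem_poly] at hp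
    rw [herr y hy (k + p) (by rw [deg_add]; push_cast; linarith)]
    ring
  rw [Finset.sum_congr rfl herr', Finset.sum_sub_distrib, Finset.sum_sub_distrib]
  ring

/-- On the diagonal only the zeroth Taylor term survives, and it cancels the derivative at `x`. This
settles the quotient `0/0` in the norm. -/
theorem hat_increment_self (α : I → ℝ) (γ β : ℝ) (hγ : ∀ i, α i < γ) (s : ℕ)
    (P : I → Space d → Distr d) (Γ : Space d → Space d → I → I → ℝ)
    (f : I → Space d → ℝ) (R : Distr d) (x : Space d) (h : ∀ j, increment Γ f x x j = 0)
    (k : {k : Fin d → ℕ // k ∈ poly d (γ + β)}) :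
    increment (hatGamma α γ β Kn s P Γ) (hatf α γ β Kn s P f R) x x (.inr k) = 0 := by
  have hk := (mem_poly _ _).1 k.2
  have h0 : (0 : Fin d → ℕ) ∈ poly d (γ + β - deg k.1) := (mem_poly _ _).2 (by simpa using hk)
  have h1 : ∀ p ∈ poly d (γ + β - deg k.1), p ≠ 0 → monomial p (x - x) / mfactorial p *
      pointwiseDeriv (γ + β) (k.1 + p) (kernelInt Kn s (pairing f P x - R)) x = 0 := fun p _ hp => by
    rw [sub_self, monomial_zero_right hp, zero_div, zero_mul]
  rw [hat_increment α γ β hγ, sum_gammaPoly_mul,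
    Finset.sum_eq_single_of_mem _ h0 h1]
  simp [h, monomial_zero_left, mfactorial_zero]

end LiftBounds

end MultilevelSchauder

/-! ### Proof of the proposition -/

open MultilevelSchauder

theorem proposition4p10 {d : ℕ} (hd : 1 ≤ d) {I : Type*} [Fintype I] [Nonempty I]
    (α : I → ℝ) (r : ℕ) (γ β : ℝ) (hγ : ∀ i, α i < γ) (hγβ : ∀ n : ℕ, γ + β ≠ n)
    {m rK : ℕ} {ρ : ℝ} (K : Space d → Space d → ℝ) (Kn : ℕ → Space d → Space d → ℝ)
    (hK : IsRegularisingKernel β m rK ρ K Kn) (hm : γ + β < m) (hr : r ≤ rK)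
    (c : Set (Space d) → ℝ → ℝ≥0)
    (S : Set (Space d)) (hS : IsCompact S)
    (Λ : ℝ) (hΛ : Λ = max 1 (2 * ρ))
    (S' : Set (Space d)) (hS' : S' = S + Metric.closedBall (0 : Space d) (Λ + 1)) :
    ∃ C : ℝ≥0,
      ∀ (P₁ P₂ : I → Space d → Distr d) (Γ₁ Γ₂ : Space d → Space d → I → I → ℝ)
        (f₁ f₂ : I → Space d → ℝ) (R₁ R₂ : Distr d),
        IsModel α r P₁ Γ₁ → IsModel α r P₂ Γ₂ →
        IsCompatible α β Kn rK P₁ → IsCompatible α β Kn rK P₂ →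
        compatNorm α β Kn rK r S' 1 P₁ = 0 → compatNorm α β Kn rK r S' 1 P₂ = 0 →
        IsModelled α γ Γ₁ f₁ → IsModelled α γ Γ₂ f₂ →
        IsReconstruction (⨅ i, α i) γ (pairing f₁ P₁) R₁ →
        IsReconstruction (⨅ i, α i) γ (pairing f₂ P₂) R₂ →
        (γ ≤ 0 → ConsistentReconstructions (⨅ i, α i) γ r c
          (pairing f₁ P₁) (pairing f₂ P₂) R₁ R₂) →
        modelledDist (hatAlpha α γ β) (γ + β) S
            (hatGamma α γ β Kn rK P₁ Γ₁) (hatGamma α γ β Kn rK P₂ Γ₂)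
            (hatf α γ β Kn rK P₁ f₁ R₁) (hatf α γ β Kn rK P₂ f₂ R₂) ≤
          C * ((1 + modelNorm α r S' Λ P₁) * modelledDist α γ S' Γ₁ Γ₂ f₁ f₂ +
            modelNorm α r S' Λ (P₁ - P₂) * modelledNorm α γ S' Γ₂ f₂) := by
  have hΛ1 : 1 ≤ Λ := hΛ ▸ le_max_left _ _
  have hΛρ : 2 * ρ ≤ Λ := hΛ ▸ le_max_right _ _
  have hρ := hK.range_pos
  have hS'c : IsCompact S' := hS' ▸ isCompact_add_closedBall hS _
  have hSS' : S ⊆ S' := hS' ▸ subset_add_closedBall S (by linarith)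
  have ha : ∀ j, ⨅ i, α i ≤ α j := fun j => ciInf_le (Set.finite_range α).bddBelow j
  have haγ : ⨅ i, α i < γ := (ha (Classical.arbitrary I)).trans_lt (hγ _)
  obtain ⟨cK, hcK, hV⟩ := hK.exists_kernelBounds (isCompact_add_closedBall hS (3 * ρ))
  have hball : ∀ x ∈ S, Metric.closedBall x (3 * ρ) ⊆ S + Metric.closedBall 0 (3 * ρ) :=
    fun x hx y hy => ⟨x, hx, y - x, by
      rwa [mem_closedBall_zero_iff, ← mem_closedBall_iff_norm], by simp⟩
  obtain ⟨Cr, hCr0, hCr⟩ := exists_reconstruction_bound haγ r hΛ1 hS c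
  have hb := fun k => exists_hat_bound hK hV hcK.le hr hΛ1 hΛρ hball α k hm
  have hi := fun k => exists_hat_increment_bound hK hV hcK.le hr hΛ1 hΛρ hball α hγ hγβ k hm
  choose Cb hCb0 hCb using hb
  choose Ci hCi0 hCi using hi
  -- One constant for both inputs: the `Q_j` carry `E`, the reconstruction errors carry `Cr * card I
  -- * E`.
  set M : ℝ := 1 + Cr * Fintype.card I with hM
  have hM1 : 1 ≤ M := by rw [hM]; linarith [mul_nonneg hCr0 (Nat.cast_nonneg (α := ℝ) (Fintype.card I))]
  set B : ℝ := (1 + ∑ k, Cb k * M) with hB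
  set B' : ℝ := (1 + ∑ k, Ci k * M) with hB'
  have hsb : ∀ k, Cb k * M ≤ B := fun k => by
    have := Finset.single_le_sum (f := fun k => Cb k * M)
      (fun k _ => mul_nonneg (hCb0 k) (by linarith)) (Finset.mem_univ k)
    rw [hB]; linarith
  have hsi : ∀ k, Ci k * M ≤ B' := fun k => by
    have := Finset.single_le_sum (f := fun k => Ci k * M)
      (fun k _ => mul_nonneg (hCi0 k) (by linarith)) (Finset.mem_univ k)
    rw [hB']; linarith
  have hB1 : 1 ≤ B := by
    have := Finset.sum_nonneg fun k (_ : k ∈ Finset.univ) => mul_nonneg (hCb0 k) (by linarith : 0 ≤ M)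
    rw [hB]; linarith
  have hB'1 : 1 ≤ B' := by
    have := Finset.sum_nonneg fun k (_ : k ∈ Finset.univ) => mul_nonneg (hCi0 k) (by linarith : 0 ≤ M)
    rw [hB']; linarith
  refine ⟨Real.toNNReal (B + B'), ?_⟩
  intro P₁ P₂ Γ₁ Γ₂ f₁ f₂ R₁ R₂ hP₁ hP₂ _ _ hc₁ hc₂ hf₁ hf₂ hR₁ hR₂ hcons
  have hm₁ := hP₁.modelNorm_lt_top hS'c hΛ1
  have hm₁₂ := modelNorm_sub_lt_top hm₁ (hP₂.modelNorm_lt_top hS'c hΛ1)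
  have hn₂ := hf₂.finite S' hS'c
  by_cases htop : modelledDist α γ S' Γ₁ Γ₂ f₁ f₂ = ⊤
  -- The convention `0 * ⊤ = 0` in `ℝ≥0∞` makes it necessary that both factors in front of the
  -- infinite distance are nonzero.
  · have h1 : (1 + modelNorm α r S' Λ P₁) ≠ 0 := by simp
    have h2 : ((Real.toNNReal (B + B') : ℝ≥0) : ℝ≥0∞) ≠ 0 := by
      simp only [ne_eq, ENNReal.coe_eq_zero, Real.toNNReal_eq_zero, not_le]
      linarith
    rw [htop, ENNReal.mul_top h1, top_add, ENNReal.mul_top h2]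
    exact le_top
  set X := (1 + modelNorm α r S' Λ P₁) * modelledDist α γ S' Γ₁ Γ₂ f₁ f₂ +
            modelNorm α r S' Λ (P₁ - P₂) * modelledNorm α γ S' Γ₂ f₂ with hX
  have hX1 : (1 + modelNorm α r S' Λ P₁) * modelledDist α γ S' Γ₁ Γ₂ f₁ f₂ ≠ ⊤ :=
    ENNReal.mul_ne_top (ENNReal.add_ne_top.2 ⟨ENNReal.one_ne_top, hm₁.ne⟩) htop
  have hX2 : modelNorm α r S' Λ (P₁ - P₂) * modelledNorm α γ S' Γ₂ f₂ ≠ ⊤ :=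
    ENNReal.mul_ne_top hm₁₂.ne hn₂.ne
  have hXtop : X ≠ ⊤ := ENNReal.add_ne_top.2 ⟨hX1, hX2⟩
  set A₁ := (modelNorm α r S' Λ P₁).toReal with hA₁
  set A₁₂ := (modelNorm α r S' Λ (P₁ - P₂)).toReal with hA₁₂
  set F := (modelledDist α γ S' Γ₁ Γ₂ f₁ f₂).toReal with hF
  set N := (modelledNorm α γ S' Γ₂ f₂).toReal with hN
  have hA₁0 : 0 ≤ A₁ := ENNReal.toReal_nonneg
  have hA₁₂0 : 0 ≤ A₁₂ := ENNReal.toReal_nonneg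
  have hF0 : 0 ≤ F := ENNReal.toReal_nonneg
  have hN0 : 0 ≤ N := ENNReal.toReal_nonneg
  have hXr : X.toReal = (1 + A₁) * F + A₁₂ * N := by
    rw [hX, ENNReal.toReal_add hX1 hX2, ENNReal.toReal_mul, ENNReal.toReal_mul,
      ENNReal.toReal_add ENNReal.one_ne_top hm₁.ne, ENNReal.toReal_one]
  -- The bracket on the right-hand side. From here on the two systems enter the estimates only
  -- through it, as `F * A₁ + N * A₁₂ ≤ E` and `F ≤ E`.
  set E := X.toReal with hE
  have hE0 : 0 ≤ E := ENNReal.toReal_nonneg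
  have hE1 : F * A₁ + N * A₁₂ ≤ E := by rw [hXr]; linarith
  have hFE : F ≤ E := by rw [hXr]; nlinarith
  have hEM : E ≤ M * E := by nlinarith
  have hmodP : ∀ x ∈ S', ∀ j, HomAt (P₁ j x) x (α j) r Λ A₁ := fun x hx j =>
    (homBound_of_modelNorm hm₁.ne j).homAt hx
  have hmodD : ∀ x ∈ S', ∀ j, HomAt (P₁ j x - P₂ j x) x (α j) r Λ A₁₂ := fun x hx j =>
    (homBound_of_modelNorm hm₁₂.ne j).homAt hx
  have hQ : ∀ x ∈ S', ∀ y ∈ S', ∀ j, HomAt (increment Γ₁ f₁ x y j • P₁ j x -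
      increment Γ₂ f₂ x y j • P₂ j x) x (α j) r Λ (E * ‖x - y‖ ^ (γ - α j)) := by
    intro x hx y hy j
    refine (HomAt.smul_sub_smul (by positivity) (by positivity)
      (abs_increment_sub_le htop hx hy j) (abs_increment_le hn₂.ne hx hy j)
      (hmodP x hx j) (hmodD x hx j)).mono ?_
    calc _ = (F * A₁ + N * A₁₂) * ‖x - y‖ ^ (γ - α j) := by ring
      _ ≤ _ := by gcongr
  have hcoh : CohBound (fun z => (pairing f₁ P₁ z - R₁) - (pairing f₂ P₂ z - R₂)) (⨅ i, α i) γ r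
      S' Λ (Fintype.card I * E) := by
    refine cohBound_of_reexpansion ha hγ hE0 fun x hx y hy => ⟨_, ?_, hQ x hx y hy⟩
    rw [Finset.sum_sub_distrib, ← hP₁.pairing_sub, ← hP₂.pairing_sub]
    abel
  have hG : HomBound (fun z => (pairing f₁ P₁ z - R₁) - (pairing f₂ P₂ z - R₂)) γ r S Λ (M * E) := by
    have h1 := hCr (pairing f₁ P₁) (pairing f₂ P₂) R₁ R₂ (Fintype.card I * E) (by positivity)
      (hS' ▸ hcoh) hR₁ hR₂ hcons
    intro x hx
    refine ((h1.homAt hx).mono ?_)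
    rw [hM]; linarith
  have hQM : ∀ x ∈ S, ∀ y ∈ S, ∀ j, HomAt (increment Γ₁ f₁ x y j • P₁ j x -
      increment Γ₂ f₂ x y j • P₂ j x) x (α j) r Λ (M * E * ‖x - y‖ ^ (γ - α j)) :=
    fun x hx y hy j => (hQ x (hSS' hx) y (hSS' hy) j).mono (by gcongr)
  have hfM : ∀ x ∈ S, ∀ j, HomAt (f₁ j x • P₁ j x - f₂ j x • P₂ j x) x (α j) r Λ (M * E) :=
    fun x hx j => (HomAt.smul_sub_smul hF0 hN0 (abs_sub_le_of_modelledDist htop (hSS' hx) j)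
      (abs_le_of_modelledNorm hn₂.ne (hSS' hx) j) (hmodP x (hSS' hx) j)
      (hmodD x (hSS' hx) j)).mono (hE1.trans hEM)
  have hL₁ := isModel_liftData ha hγ haγ hP₁ hf₁ hR₁ (fun h => (hcons h).left) hc₁
  have hL₂ := isModel_liftData ha hγ haγ hP₂ hf₂ hR₂ (fun h => (hcons h).right) hc₂
  have hL₁ : LiftData α γ β Kn r rK S P₁ f₁ R₁ := hL₁.mono hSS'
  have hL₂ : LiftData α γ β Kn r rK S P₂ f₂ R₂ := hL₂.mono hSS'
  have hfin : ((Real.toNNReal (B + B') : ℝ≥0) : ℝ≥0∞) * X =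
      ENNReal.ofReal (B * E) + ENNReal.ofReal (B' * E) := by
    rw [← ENNReal.ofReal_add (by positivity) (by positivity), ← add_mul,
      ENNReal.ofReal_mul (by positivity), hE, ENNReal.ofReal_toReal hXtop]
    rfl
  rw [hfin, modelledDist]
  refine add_le_add ?_ ?_
  · simp only [iSup_le_iff]
    rintro x hx (i | k)
    · refine ENNReal.ofReal_le_ofReal ((abs_sub_le_of_modelledDist htop (hSS' hx) i).trans ?_)
      nlinarith
    · refine ENNReal.ofReal_le_ofReal ((hCb k P₁ P₂ f₁ f₂ R₁ R₂ _ hL₁ hL₂ hG hfM x hx).trans ?_)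
      rw [← mul_assoc]
      exact mul_le_mul_of_nonneg_right (hsb k) hE0
  · simp only [iSup_le_iff]
    intro x hx y hy ĵ
    have hrw : ∑ j, (hatGamma α γ β Kn rK P₁ Γ₁ x y ĵ j * hatf α γ β Kn rK P₁ f₁ R₁ j y -
          hatGamma α γ β Kn rK P₂ Γ₂ x y ĵ j * hatf α γ β Kn rK P₂ f₂ R₂ j y) -
        (hatf α γ β Kn rK P₁ f₁ R₁ ĵ x - hatf α γ β Kn rK P₂ f₂ R₂ ĵ x) =
        increment (hatGamma α γ β Kn rK P₁ Γ₁) (hatf α γ β Kn rK P₁ f₁ R₁) x y ĵ -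
        increment (hatGamma α γ β Kn rK P₂ Γ₂) (hatf α γ β Kn rK P₂ f₂ R₂) x y ĵ := by
      rw [increment, increment, Finset.sum_sub_distrib]; ring
    rw [hrw]
    refine ofReal_div_le (by positivity) (by positivity) ?_
    rcases ĵ with i | k
    · rw [hat_increment_inl, hat_increment_inl, hatAlpha, add_sub_add_right_eq_sub]
      refine (abs_increment_sub_le htop (hSS' hx) (hSS' hy) i).trans ?_
      gcongr
      nlinarith
    · rw [hatAlpha]
      rcases eq_or_ne x y with rfl | hxy
      -- Finiteness of the norm of `f₂` makes its increments vanish on the diagonal; finiteness of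
      -- the distance then gives the same for `f₁`.
      · have z : ∀ j, (‖x - x‖ : ℝ) ^ (γ - α j) = 0 := fun j => by
          rw [sub_self, norm_zero, Real.zero_rpow (sub_pos.2 (hγ j)).ne']
        have h2 : ∀ j, increment Γ₂ f₂ x x j = 0 := fun j => by
          have := abs_increment_le (α := α) hn₂.ne (hSS' hx) (hSS' hx) j
          rw [z, mul_zero] at this
          exact abs_nonpos_iff.1 this
        have h1 : ∀ j, increment Γ₁ f₁ x x j = 0 := fun j => by
          have := abs_increment_sub_le (α := α) htop (hSS' hx) (hSS' hx) j
          rw [z, mul_zero, h2, sub_zero] at this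
          exact abs_nonpos_iff.1 this
        rw [hat_increment_self α γ β hγ rK P₁ Γ₁ f₁ R₁ x h1,
          hat_increment_self α γ β hγ rK P₂ Γ₂ f₂ R₂ x h2, sub_zero, abs_zero]
        positivity
      · refine (hCi k P₁ P₂ Γ₁ Γ₂ f₁ f₂ R₁ R₂ _ hP₁ hP₂ hL₁ hL₂ hG hQM x hx y hy hxy).trans ?_
        rw [← mul_assoc]
        exact mul_le_mul_of_nonneg_right (mul_le_mul_of_nonneg_right (hsi k) hE0)
          (Real.rpow_nonneg (norm_nonneg _) _)
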